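/- **Setting.** Let $F$ be a finite-dimensional $\mathbb Z$-graded (real or complex) cochain complex with differential $d$ and a non-degenerate degree $-1$ symplectic pairing $\omega$ compatible with $d$, and let $(F',d',\omega')$ be another such graded space with differential and pairing. Let $\iota:F'\to F$, $\pi:F\to F'$, $\kappa:F^\bullet\to F^{\bullet-1}$ be a strong deformation retraction of $F$ onto $F'$: $\iota,\pi$ are chain maps, $\pi\iota=1$, $d\kappa+\kappa d=1-\iota\pi$, $\kappa^2=\kappa\iota=\pi\kappa=0$. Assume it is self-dual: $\omega(x,\iota y')=\omega'(\pi x,y')$ and $\omega(x,\kappa y)=\pm\omega(\kappa x,y)$ (the sign being such that $\omega(x,\kappa x)$ is a graded-symmetric quadratic form). Let $S=S_0+S_{\rm int}$ with $S_0=\frac12\omega(x,dx)$ and $S_{\rm int}$ a formal power series on $F$ of ghost degree $0$, with terms of polynomial degree $\ge 3$ only, not depending on $\hbar$, such that $\{S,S\}=0$ and $\Delta S=0$, where $\{-,-\}$ and $\Delta$ are the antibracket and the BV Laplacian of $\omega$. On $\widehat S F^*[[\hbar]]$ (complex coefficients) put $Q_{\rm int}=\{S_{\rm int},-\}$ and $Q_\hbar=\{S,-\}-i\hbar\Delta$;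 let $\hat\kappa=\langle\kappa(x),\partial/\partial x\rangle$ be the derivation extending the transpose of $\kappa$, let $H=[Q_\hbar,\hat\kappa]=Q_\hbar\hat\kappa+\hat\kappa Q_\hbar$, and let $K=\nu\hat\kappa$, where, for the splitting $F=\iota(F')\oplus F''$ with $F''=\ker\pi$, $\nu$ multiplies functions of polynomial degree $N\ge1$ in $F''$ by $1/N$ and kills functions of degree $0$ in $F''$. For a perturbation $\delta$, the perturbation of a triple $(i,p,K)$ by $\delta$ is the triple $$\Big(\sum_{k\ge0}(-K\delta)^k\,i,\ \ \sum_{k\ge0}p\,(-\delta K)^k,\ \ \sum_{k\ge0}K(-\delta K)^k\Big).$$ Let $(i_\hbar,p_\hbar,K_\hbar)$ be the perturbation of $(\pi^*,\iota^*,K)$ by $-i\hbar\Delta$, and let $(i_{\rm int},p_{\rm int},K_{\rm int})$ be the perturbation of $(i_\hbar,p_\hbar,K_\hbar)$ by $Q_{\rm int}$. **Path integral.** Consider the 1d AKSZ theory on $[0,T]$ with target $T^*F$ (coordinates $x,p$) and target Hamiltonian $\Theta=\omega^{-1}\!\left(p,\frac{\partial S}{\partial x}\right)+\frac12\omega^{-1}(p,p)$.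 Gauge-fixed with the fermion $\int_0^T dt\,\langle p,\kappa(x)\rangle$, it has the action $\int_0^T dt\,(\langle p,\partial_t x\rangle-\mathbb H(x,p))$, where $\mathbb H=\{\Theta,\langle p,\kappa(x)\rangle\}$ is the canonical Poisson bracket on $T^*F$. For $O\in\widehat S F^*[[\hbar]]$ and a formal point $x_{\rm out}$ of $F$, let $$\langle O\rangle_T(x_{\rm out})=\int_{p(0)=0,\;x(T)=x_{\rm out}}\mathcal D[x]\,\mathcal D[p]\;O(x(0))\,e^{\frac i\hbar\int_0^T dt\,(\langle p,\partial_t x\rangle-\mathbb H(x,p))}$$ be defined perturbatively in $\mathbb H$ as the series $$\sum_{n\ge0}\frac1{n!}\int_{[0,T]^n}dt_1\cdots dt_n\,\Big\langle e^{\frac i\hbar\langle p(T),x_{\rm out}\rangle}\prod_{s=1}^n\Big(-\frac i\hbar\mathbb H(x(t_s),p(t_s))\Big)\,O(x(0))\Big\rangle_0 ,$$ where $\langle-\rangle_0$ is computed by Wick's theorem with the propagators $\langle p_i(t)x^j(t')\rangle_0=-i\hbar\,\theta(t-t')\,\delta_i^j$ and $\langle xx\rangle_0=\langle pp\rangle_0=0$,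 with $\theta(s)=1$ for $s>0$ and $\theta(s)=0$ for $s\le0$ (so $\mathbb H$ is normally ordered, without self-contractions). **Theorem.** All convergence below is coefficientwise, i.e. in $\mathbb C$ for every Taylor coefficient at every order of $\hbar$. The series defining $i_\hbar,p_\hbar,K_\hbar$ and $i_{\rm int},p_{\rm int},K_{\rm int}$ converge. For every $T>0$ and $O\in\widehat S F^*[[\hbar]]$ the integrals defining $\langle O\rangle_T$ exist, their sum over $n$ converges and contains no negative powers of $\hbar$. The series $e^{-TH}O=\sum_n\frac{(-T)^n}{n!}H^nO$ converges, and $$(e^{-TH}O)(x_{\rm out})=\langle O\rangle_T(x_{\rm out}).$$ Moreover, for all $O\in\widehat S F^*[[\hbar]]$ and $O'\in\widehat S F'^*[[\hbar]]$, $$i_{\rm int}(O')(x_{\rm out})=\lim_{T\to\infty}\langle O'\circ\pi\rangle_T(x_{\rm out}),\qquad p_{\rm int}(O)(x'_{\rm out})=\lim_{T\to\infty}\langle O\rangle_T(\iota(x'_{\rm out})),$$ $$K_{\rm int}(O)(x_{\rm out})=\int_0^\infty dT\;\langle\hat\kappa O\rangle_T(x_{\rm out}),$$ where the last integral converges absolutely;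 here $dT\,\hat\kappa O$, evaluated at $x(0)$, is the $dT$ component of $O\big(x(0)+dT\,\kappa(x(0))\big)$. In the formula for $p_{\rm int}$, $\langle O\rangle_T(\iota(x'_{\rm out}))$ is the path integral with boundary conditions $p(0)=0$, $x(T)=\iota(x'_{\rm out})$. -/

import Mathlib

open scoped PowerSeries.WithPiTopology

noncomputable section

/-! ## Formal functions on a graded vector space

Let `V` index linear coordinates `x^v`, homogeneous of ghost degree `g v : ℤ` (their parity is the
parity of `g v`), and let `R` be a commutative ring of scalars, placed in degree `0`. A formal
(graded-commutative) power series `f` in these coordinates is recorded by its Taylor coefficients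
at the origin: for a list `[v₁, v₂, …, vₙ]`,

  `f [v₁, v₂, …, vₙ] = (∂_{vₙ} ⋯ ∂_{v₂} ∂_{v₁} f)(0)`   (left derivatives, `∂_{v₁}` acts first).

This is the identification of the completed symmetric algebra `Ŝ(F^*) = ∏ₙ Sⁿ(F^*)` with sequences
of graded symmetric multilinear forms on `F`. An array of scalars is the array of Taylor
coefficients of a formal power series iff it is graded symmetric (`GradedSymm`). -/

/-- Arrays of Taylor coefficients with values in `R`, in variables indexed by `V`. -/
abbrev SuperSeries (R V : Type*) := List V → R

namespace SuperSeries

variable {R V W : Type*}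

/-- Total degree of a list of variables. -/
def deg (g : V → ℤ) (L : List V) : ℤ := (L.map g).sum

/-- Exchanging two neighbouring derivatives `∂_v, ∂_w` costs the Koszul sign `(-1)^{|v||w|}`. -/
def GradedSymm [Ring R] (g : V → ℤ) (f : SuperSeries R V) : Prop :=
  ∀ (L₁ : List V) (v w : V) (L₂ : List V),
    f (L₁ ++ v :: w :: L₂) = (g v * g w).negOnePow • f (L₁ ++ w :: v :: L₂)

/-- The left partial derivative `∂_v f`. -/
def pderiv (v : V) (f : SuperSeries R V) : SuperSeries R V := fun L => f (v :: L)

/-- `f ↦ (-1)^{|v||f|} f`, on the components of `f` of definite parity. -/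
def twist [Ring R] (g : V → ℤ) (v : V) (f : SuperSeries R V) : SuperSeries R V :=
  fun L => (g v * deg g L).negOnePow • f L

/-- The right partial derivative of `f` by `x^v`: it is `(-1)^{|v|(|f|+|v|)} ∂_v f`. -/
def rpderiv [Ring R] (g : V → ℤ) (v : V) (f : SuperSeries R V) : SuperSeries R V :=
  twist g v (pderiv v f)

/-- Taylor coefficients of a product, from `(f h)(0) = f(0) h(0)` and the graded Leibniz rule
`∂_v (f h) = (∂_v f) h + (-1)^{|v||f|} f (∂_v h)`. -/
def mulCoeff [Ring R] (g : V → ℤ) :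
    List V → SuperSeries R V → SuperSeries R V → R
  | [], f, h => f [] * h []
  | v :: L, f, h => mulCoeff g L (pderiv v f) h + mulCoeff g L (twist g v f) (pderiv v h)

/-- The graded commutative product of formal power series. -/
def mul [Ring R] (g : V → ℤ) (f h : SuperSeries R V) : SuperSeries R V :=
  fun L => mulCoeff g L f h

theorem mulCoeff_units_smul [Ring R] (g : V → ℤ) (c : ℤˣ) (L : List V) :
    ∀ f h : SuperSeries R V, mulCoeff g L f (c • h) = c • mulCoeff g L f h := by
  induction L with
  | nil => intro f h; simp [mulCoeff, mul_smul_comm]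
  | cons v L ih =>
    intro f h
    have e : pderiv v (c • h) = c • pderiv v h := rfl
    simp only [mulCoeff, e, ih, smul_add]

/-- The product is compatible with signs in the second factor. -/
theorem mul_units_smul [Ring R] (g : V → ℤ) (c : ℤˣ) (f h : SuperSeries R V) :
    mul g f (c • h) = c • mul g f h := funext fun L => mulCoeff_units_smul g c L f h

open Classical in
/-- The constant function `1`. -/
def one [Ring R] : SuperSeries R V := fun L => if L = [] then 1 else 0

open Classical in
/-- The coordinate function `x^v`. -/
def coord [Ring R] (v : V) : SuperSeries R V := fun L => if L = [v] then 1 else 0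

/-- Powers. -/
def pow [Ring R] (g : V → ℤ) (f : SuperSeries R V) : ℕ → SuperSeries R V
  | 0 => one
  | n + 1 => mul g f (pow g f n)

/-- The exponential of a formal power series without constant term; `fᵇ` has no Taylor
coefficients of order less than `b`. -/
def exp [Ring R] [Algebra ℂ R] (g : V → ℤ) (f : SuperSeries R V) : SuperSeries R V :=
  fun L => ∑ b ∈ Finset.range (L.length + 1), ((b.factorial : ℂ)⁻¹) • pow g f b L

/-- Taylor coefficients of the pullback of `f` by a degree-preserving linear map with matrix `M`:
`f` is evaluated at `y^w = ∑ᵥ M w v x^v` (chain rule). -/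
def pullbackCoeff [Ring R] [Algebra ℂ R] [Fintype W] (M : W → V → ℂ) :
    List V → SuperSeries R W → R
  | [], f => f []
  | v :: L, f => ∑ w, M w v • pullbackCoeff M L (pderiv w f)

/-- Pullback of a function by the linear map with matrix `M`. -/
def pullback [Ring R] [Algebra ℂ R] [Fintype W] (M : W → V → ℂ) (f : SuperSeries R W) :
    SuperSeries R V := fun L => pullbackCoeff M L f

open Classical in
/-- Renaming of variables: `f` evaluated at `y^w = x^{φ w}`. -/
def rename [Ring R] [Algebra ℂ R] [Fintype W] (φ : W → V) (f : SuperSeries R W) :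
    SuperSeries R V := pullback (fun w v => if v = φ w then 1 else 0) f

/-- Extension of scalars from `ℂ`. -/
def lift (R : Type*) [Ring R] [Algebra ℂ R] (f : SuperSeries ℂ V) : SuperSeries R V :=
  fun L => algebraMap ℂ R (f L)

/-- The derivation `∑ x^k A^j_k ∂_j` extending the transpose of the linear map with matrix `A`,
i.e. `x^j ↦ ∑ₖ A^j_k x^k`. -/
def linDer [Ring R] [Algebra ℂ R] [Fintype V] (g : V → ℤ) (A : V → V → ℂ)
    (f : SuperSeries R V) : SuperSeries R V :=
  ∑ k, ∑ j, A j k • mul g (coord k) (pderiv j f)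

/-- The degree `1` bracket `{f,h} = w^{ij} (f ←∂_i) (∂_j h)`. -/
def bracket [Ring R] [Algebra ℂ R] [Fintype V] (g : V → ℤ) (w : V → V → ℂ)
    (f h : SuperSeries R V) : SuperSeries R V :=
  ∑ i, ∑ j, w i j • mul g (rpderiv g i f) (pderiv j h)

/-- The BV Laplacian `½ (-1)^{|i|} w^{ij} ∂_i ∂_j`; it is `∑ ∂²/∂x^a∂ξ_a` in Darboux
coordinates, where `w^{xξ} = 1 = -w^{ξx}`. -/
def laplacian [Ring R] [Algebra ℂ R] [Fintype V] (g : V → ℤ) (w : V → V → ℂ)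
    (f : SuperSeries R V) : SuperSeries R V :=
  (1 / 2 : ℂ) • ∑ i, ∑ j, (g i).negOnePow • w i j • pderiv i (pderiv j f)

end SuperSeries

open SuperSeries

/-! ## Interacting BV theories -/

/-- The inverse `(ω⁻¹)^{ij}` of the symplectic form, normalized so that
`∑_i (ω⁻¹)^{ij} ω_{ik} = δ^j_k`, i.e. `{x, ξ} = 1` for `ω = δx ∧ δξ`. -/
def omegaInv {I : Type*} [Fintype I] [DecidableEq I] (ω : Matrix I I ℂ) : I → I → ℂ :=
  fun i j => ω⁻¹ j i

/-- The free action `S₀(x) = ½ ω(x, d x) = ½ ∑ ω_{ij} (d x)^j x^i`, where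
`(d x)^j = ∑ₖ d^j_k x^k`. -/
def freeAction {I : Type*} [Fintype I] (gh : I → ℤ) (ω d : Matrix I I ℂ) : SuperSeries ℂ I :=
  (1 / 2 : ℂ) • ∑ i, ∑ j, ∑ k, (ω i j * d j k) • mul gh (coord k) (coord i)

/-- A perturbed free BV theory on a finite-dimensional graded space of fields `F` (a real theory is
one whose matrices are real; functions are complex valued in any case), with an infrared
space `F'`, a self-dual strong deformation retraction of `F` onto `F'`, and an `ħ`-independent
action. `F` and `F'` are given with homogeneous bases `(e_i)`, `(e'_a)` indexed by `I`, `I'`;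
`gh i` is the ghost degree of the coordinate `x^i`, i.e. minus the cohomological degree of `e_i`. -/
structure BVTheory (I I' : Type*) [Fintype I] [DecidableEq I] [Fintype I'] [DecidableEq I'] where
  gh : I → ℤ
  gh' : I' → ℤ
  /-- the degree `-1` symplectic pairings `ω_{ij} = ω(e_i, e_j)` on `F` and `F'` -/
  ω : Matrix I I ℂ
  ω' : Matrix I' I' ℂ
  /-- the differentials, `d e_k = ∑ d^j_k e_j` -/
  d : Matrix I I ℂ
  d' : Matrix I' I' ℂ
  /-- the retraction `ι : F' → F`, `π : F → F'` and the chain homotopy `κ` on `F` -/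
  ι : Matrix I I' ℂ
  π : Matrix I' I ℂ
  κ : Matrix I I ℂ
  /-- the interaction -/
  Sint : SuperSeries ℂ I
  ω_deg : ∀ i j, ω i j ≠ 0 → gh i + gh j = -1
  ω'_deg : ∀ a b, ω' a b ≠ 0 → gh' a + gh' b = -1
  ω_skew : ∀ i j, ω i j = - ω j i
  ω'_skew : ∀ a b, ω' a b = - ω' b a
  ω_nondeg : IsUnit ω.det
  ω'_nondeg : IsUnit ω'.det
  d_deg : ∀ j k, d j k ≠ 0 → gh j = gh k - 1
  d'_deg : ∀ a b, d' a b ≠ 0 → gh' a = gh' b - 1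
  κ_deg : ∀ j k, κ j k ≠ 0 → gh j = gh k + 1
  ι_deg : ∀ i a, ι i a ≠ 0 → gh i = gh' a
  π_deg : ∀ a i, π a i ≠ 0 → gh' a = gh i
  d_sq : d * d = 0
  d'_sq : d' * d' = 0
  /-- compatibility of `d` with `ω` -/
  d_ω : ∀ i k, (ω * d) i k = (gh i).negOnePow • (ω * d) k i
  /-- `ι`, `π` are chain maps, and form with `κ` a strong deformation retraction -/
  d_ι : d * ι = ι * d'
  π_d : π * d = d' * π
  π_ι : π * ι = 1
  homotopy : d * κ + κ * d = 1 - ι * π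
  κ_sq : κ * κ = 0
  κ_ι : κ * ι = 0
  π_κ : π * κ = 0
  /-- self-duality: `ω(x, ι y') = ω'(π x, y')` and `ω(x, κ y) = ± ω(κ x, y)` -/
  ω_ι : ω * ι = π.transpose * ω'
  κ_ω : ∀ i k, (ω * κ) i k = - (gh i).negOnePow • (ω * κ) k i
  /-- `S_int` is a formal function of ghost degree `0` with terms of polynomial degree `≥ 3` -/
  Sint_symm : GradedSymm gh Sint
  Sint_deg : ∀ L, Sint L ≠ 0 → deg gh L = 0
  Sint_order : ∀ L, L.length < 3 → Sint L = 0
  /-- the quantum master equation for `S = S₀ + S_int`; as `S` does not depend on `ħ`, it splits -/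
  master : bracket gh (omegaInv ω) (freeAction gh ω d + Sint) (freeAction gh ω d + Sint) = 0
  laplacian_zero : laplacian gh (omegaInv ω) (freeAction gh ω d + Sint) = 0

/-- `-iħ`, as a formal power series in `ħ`. -/
def negIHbar : PowerSeries ℂ := PowerSeries.C (-Complex.I) * PowerSeries.X

/-! ## Homological perturbation series

Formal functions with values in `ℂ[[ħ]]` carry the topology of convergence in `ℂ` of every Taylor
coefficient in every order of `ħ`; the series below are summed in this topology. -/

section HPL

variable {A B : Type*}

/-- The terms of `∑ (-Kδ)^k i`. -/
def hplITerm [Neg A] (K δ : A → A) (i : B → A) (f : B) (k : ℕ) : A :=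
  (fun a => - K (δ a))^[k] (i f)

/-- The terms of `∑ p (-δK)^k`. -/
def hplPTerm [Neg A] (K δ : A → A) (p : A → B) (f : A) (k : ℕ) : B :=
  p ((fun a => - δ (K a))^[k] f)

/-- The terms of `∑ K (-δK)^k`. -/
def hplKTerm [Neg A] (K δ : A → A) (f : A) (k : ℕ) : A := hplPTerm K δ K f k

end HPL

namespace BVTheory

variable {I I' : Type*} [Fintype I] [DecidableEq I] [Fintype I'] [DecidableEq I']
variable (τ : BVTheory I I')

/-- `Ŝ F^*[[ħ]]`: arrays with values in `ℂ[[ħ]]`; the actual functions are the graded symmetric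
ones. -/
abbrev Fun (_ : BVTheory I I') := SuperSeries (PowerSeries ℂ) I

/-- `Ŝ F'^*[[ħ]]`. -/
abbrev Fun' (_ : BVTheory I I') := SuperSeries (PowerSeries ℂ) I'

/-- `(ω⁻¹)^{ij}`. -/
def w : I → I → ℂ := omegaInv τ.ω

/-- The action `S = S₀ + S_int`. -/
def S : SuperSeries ℂ I := freeAction τ.gh τ.ω τ.d + τ.Sint

/-- The BV Laplacian. -/
def Δ (f : τ.Fun) : τ.Fun := laplacian τ.gh τ.w f

/-- `-iħΔ`. -/
def quantumPart (f : τ.Fun) : τ.Fun := negIHbar • τ.Δ f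

/-- `Q_int = {S_int, -}`. -/
def Qint (f : τ.Fun) : τ.Fun := bracket τ.gh τ.w (lift _ τ.Sint) f

/-- The quantum BV differential `Q_ħ = {S, -} - iħΔ`. -/
def Qħ (f : τ.Fun) : τ.Fun := bracket τ.gh τ.w (lift _ τ.S) f + τ.quantumPart f

/-- `κ̂ = ⟨κ(x), ∂/∂x⟩`, the derivation extending `κ^∨`. -/
def κhat (f : τ.Fun) : τ.Fun := linDer τ.gh τ.κ f

/-- The TQM Hamiltonian: the graded commutator `H = [Q_ħ, κ̂]` of two odd operators. -/
def H (f : τ.Fun) : τ.Fun := τ.Qħ (τ.κhat f) + τ.κhat (τ.Qħ f)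

/-- `i = π^*`. -/
def i (f : τ.Fun') : τ.Fun := pullback τ.π f

/-- `p = ι^*`. -/
def p (f : τ.Fun) : τ.Fun' := pullback τ.ι f

/-- Taylor coefficients of the component of polynomial degree `N` in `F''` of a function, for the
splitting `F = F' ⊕ F''` with projectors `P' = ιπ`, `P'' = 1 - ιπ`. -/
def uvCoeff : List I → ℕ → τ.Fun → PowerSeries ℂ
  | [], 0, f => f []
  | [], _ + 1, _ => 0
  | v :: L, 0, f => ∑ j, (τ.ι * τ.π) j v • uvCoeff L 0 (pderiv j f)
  | v :: L, N + 1, f =>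
      ∑ j, ((τ.ι * τ.π) j v • uvCoeff L (N + 1) (pderiv j f) +
        (1 - τ.ι * τ.π : Matrix I I ℂ) j v • uvCoeff L N (pderiv j f))

/-- The operator `ν`: multiplication by `1/N` on functions of degree `N ≥ 1` in `F''`, zero on
functions of `F'` only. -/
def ν (f : τ.Fun) : τ.Fun :=
  fun L => ∑ N ∈ Finset.Icc 1 L.length, ((N : ℂ)⁻¹) • τ.uvCoeff L N f

/-- The chain homotopy `K = κ^sym = ν κ̂` of the classical free theory: the extension of `κ` to
formal functions symmetrized over orderings of the tensor factors. -/
def K (f : τ.Fun) : τ.Fun := τ.ν (τ.κhat f)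

/-- The retraction data of the free quantum theory: perturbation of `(i, p, K)` by `-iħΔ`. -/
def iħ (f : τ.Fun') : τ.Fun := ∑' k, hplITerm τ.K τ.quantumPart τ.i f k

def pħ (f : τ.Fun) : τ.Fun' := ∑' k, hplPTerm τ.K τ.quantumPart τ.p f k

def Kħ (f : τ.Fun) : τ.Fun := ∑' k, hplKTerm τ.K τ.quantumPart f k

/-- The retraction data of the interacting theory: perturbation of `(i_ħ, p_ħ, K_ħ)` by `Q_int`. -/
def iInt (f : τ.Fun') : τ.Fun := ∑' k, hplITerm τ.Kħ τ.Qint τ.iħ f k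

def pInt (f : τ.Fun) : τ.Fun' := ∑' k, hplPTerm τ.Kħ τ.Qint τ.pħ f k

def Kint (f : τ.Fun) : τ.Fun := ∑' k, hplKTerm τ.Kħ τ.Qint f k

/-- All the homological perturbation series above converge. -/
def HPLConverges : Prop :=
  (∀ f : τ.Fun', GradedSymm τ.gh' f →
    Summable (hplITerm τ.K τ.quantumPart τ.i f) ∧ Summable (hplITerm τ.Kħ τ.Qint τ.iħ f)) ∧
  (∀ f : τ.Fun, GradedSymm τ.gh f →
    Summable (hplPTerm τ.K τ.quantumPart τ.p f) ∧ Summable (hplPTerm τ.Kħ τ.Qint τ.pħ f) ∧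
    Summable (hplKTerm τ.K τ.quantumPart f) ∧ Summable (hplKTerm τ.Kħ τ.Qint f))

/-- The terms of the series `e^{-TH} O = ∑ₙ (-T)ⁿ/n! Hⁿ O`. -/
def expTerm (T : ℝ) (O : τ.Fun) (n : ℕ) : τ.Fun :=
  (((-T : ℝ) : ℂ) ^ n / (n.factorial : ℂ)) • τ.H^[n] O

/-- `e^{-TH} O`. -/
def expNegTH (T : ℝ) (O : τ.Fun) : τ.Fun := ∑' n, τ.expTerm T O n

/-! ## The 1d AKSZ theory with target `T^*F` and its gauge-fixing

Coordinates on `T^*F` are indexed by `I ⊕ I`: `x^i` is `Sum.inl i` and `p_i` is `Sum.inr i`. The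
canonical pairing of a fibre vector with a base vector is `⟨p, y⟩ = ∑ y^i p_i`. -/

/-- Degrees of the coordinates `x^i`, `p_i` on `T^*F`. -/
def ghN : I ⊕ I → ℤ := Sum.elim τ.gh (fun i => - τ.gh i)

/-- The canonical degree `0` Poisson bracket on `T^*F`, with `{p_i, x^j} = δ_i^j`. -/
def poisson (f h : SuperSeries ℂ (I ⊕ I)) : SuperSeries ℂ (I ⊕ I) :=
  ∑ i, (mul τ.ghN (rpderiv τ.ghN (Sum.inr i) f) (pderiv (Sum.inl i) h) -
    (τ.gh i).negOnePow • mul τ.ghN (rpderiv τ.ghN (Sum.inl i) f) (pderiv (Sum.inr i) h))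

/-- The target AKSZ Hamiltonian `Θ = ω⁻¹(p, ∂S/∂x) + ½ ω⁻¹(p, p)`. -/
def Θ : SuperSeries ℂ (I ⊕ I) :=
  (∑ i, ∑ j, τ.w i j •
    mul τ.ghN (rename Sum.inl (rpderiv τ.gh i τ.S)) (coord (Sum.inr j))) +
  (1 / 2 : ℂ) • ∑ i, ∑ j, (τ.gh i).negOnePow • τ.w i j •
    mul τ.ghN (coord (Sum.inr i)) (coord (Sum.inr j))

/-- `⟨p, κ(x)⟩`; the gauge-fixing fermion of the theory is `∫₀ᵀ dt ⟨p, κ(x)⟩`. -/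
def Ψ : SuperSeries ℂ (I ⊕ I) :=
  ∑ k, ∑ j, τ.κ j k • mul τ.ghN (coord (Sum.inl k)) (coord (Sum.inr j))

/-- The 1-form components of the superfields on the gauge-fixing Lagrangian, which is the graph of
the differential of the gauge-fixing fermion: `x̃^i = x^i + (-1)^{|i|} (∂Ψ/∂p_i) dt`,
`p̃_i = p_i - (∂Ψ/∂x^i) dt`. Here `(-1)^{|i|} (∂Ψ/∂p_i) dt = - dt κ(x)^i`. -/
def superfieldDt : I ⊕ I → SuperSeries ℂ (I ⊕ I)
  | Sum.inl i => (τ.gh i).negOnePow • pderiv (Sum.inr i) τ.Ψ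
  | Sum.inr i => (-1 : ℤˣ) • pderiv (Sum.inl i) τ.Ψ

/-- The coefficient of `dt` in `Θ(x̃, p̃)` on the gauge-fixing Lagrangian (Taylor expansion,
`dt² = 0`): the AKSZ action `∫₀ᵀ ⟨p̃, d_t x̃⟩ + Θ(x̃, p̃)` restricts to
`∫₀ᵀ dt (⟨p, ∂_t x⟩ + gaugeFixedDensity)`. -/
def gaugeFixedDensity : SuperSeries ℂ (I ⊕ I) :=
  ∑ v, mul τ.ghN (rpderiv τ.ghN v τ.Θ) (τ.superfieldDt v)

/-- The classical Hamiltonian `ℍ = {Θ, ⟨p, κ(x)⟩}`. -/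
def Hcl : SuperSeries ℂ (I ⊕ I) := τ.poisson τ.Θ τ.Ψ

/-- The gauge-fixed AKSZ action is `∫₀ᵀ dt (⟨p, ∂_t x⟩ - ℍ(x, p))`. -/
theorem gaugeFixedDensity_eq : τ.gaugeFixedDensity = - τ.Hcl := by
  simp only [gaugeFixedDensity, Hcl, poisson, Fintype.sum_sum_type, superfieldDt, mul_units_smul,
    Finset.sum_sub_distrib]
  simp [add_comm, sub_eq_add_neg]

end BVTheory

/-! ## The perturbative path integral

The integral over paths with `p(0) = 0`, `x(T) = x_out` of `O(x(0)) exp (i/ħ ∫₀ᵀ (⟨p, ∂_t x⟩ - ℍ))`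
with `ℍ` treated as the perturbation. Splitting off the discontinuous extension of `x_out` by zero
to `[0,T)` turns the boundary condition into `x(T) = 0` and adds the term `⟨p(T), x_out⟩` to the
kinetic action. At order `n` there are insertions of `ℍ` at `n` times, to be integrated over
`[0,T]`; the Gaussian expectation value with respect to `∫₀ᵀ ⟨p, ∂_t x⟩` is given by Wick's
theorem. -/

/-- Scalars during the computation: formal Laurent series in `ħ`. -/
abbrev LaurentH := LaurentSeries ℂ

/-- The coefficient `c ħᵏ`. -/
def hbarPow (k : ℤ) (c : ℂ) : LaurentH := HahnSeries.single k c

/-- The variables of the integrand at order `n`: the coordinates `y^a` (`a ∈ J`) of the boundary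
value, the values of `x` at the times `t_1, …, t_n` and (for `none`) at time `0`, and the values
of `p` at the times `t_1, …, t_n` and (for `none`) at time `T`. -/
inductive PathVar (I J : Type*) (n : ℕ)
  | out (a : J)
  | x (s : Option (Fin n)) (i : I)
  | p (s : Option (Fin n)) (i : I)

/-- The Heaviside function, with `θ(0) = 0`: this is the normal ordering prescription for `ℍ`
(no contractions inside one vertex; `p` is displaced to a slightly earlier time than `x`). -/
def heaviside (s : ℝ) : ℝ := if 0 < s then 1 else 0

namespace BVTheory

variable {I I' J : Type*} [Fintype I] [DecidableEq I] [Fintype I'] [DecidableEq I'] [Fintype J]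
variable (τ : BVTheory I I')

/-- Degrees of the variables, for boundary coordinates of degrees `gJ`. -/
def ghPath (gJ : J → ℤ) {n : ℕ} : PathVar I J n → ℤ
  | .out a => gJ a
  | .x _ i => τ.gh i
  | .p _ i => - τ.gh i

/-- `F ↦ ∑ ⟨p_i(s) x^i(s')⟩₀ ∂/∂x^i(s') ∂/∂p_i(s) F`, the sum of all single contractions, for the
free propagator `⟨p_i(t) x^j(t')⟩₀ = -iħ θ(t-t') δ_i^j`, `⟨xx⟩₀ = ⟨pp⟩₀ = 0`. This propagator
inverts `∂_t` with the boundary conditions `p(0) = 0` and `x(T) = 0`. -/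
def contract (_ : BVTheory I I') {n : ℕ} (T : ℝ) (t : Fin n → ℝ)
    (F : SuperSeries LaurentH (PathVar I J n)) : SuperSeries LaurentH (PathVar I J n) :=
  hbarPow 1 (-Complex.I) • ∑ s, ∑ s', ∑ i : I,
    ((heaviside (Option.elim s T t - Option.elim s' 0 t) : ℝ) : ℂ) •
      pderiv (PathVar.x s' i) (pderiv (PathVar.p s i) F)

/-- The Gaussian expectation value `⟨F⟩₀`, a function of the boundary value: by Wick's theorem it is
`exp (contract) F` at `x = p = 0` (that is, its Taylor coefficients in the `out` variables). -/
def wick (τ : BVTheory I I') {n : ℕ} (T : ℝ) (t : Fin n → ℝ)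
    (F : SuperSeries LaurentH (PathVar I J n)) : SuperSeries LaurentH J :=
  fun L => ∑ᶠ N : ℕ, ((N.factorial : ℂ)⁻¹) • ((τ.contract T t)^[N] F) (L.map PathVar.out)

/-- The vertex `-(i/ħ) ℍ(x(t_s), p(t_s))`. -/
def vertex {n : ℕ} (s : Fin n) : SuperSeries LaurentH (PathVar I J n) :=
  hbarPow (-1) (-Complex.I) •
    rename (Sum.elim (PathVar.x (some s)) (PathVar.p (some s))) (lift LaurentH τ.Hcl)

/-- The boundary term `(i/ħ) ⟨p(T), x_out⟩` with `x_out = b(y)`, `x_out^i = ∑ₐ b^i_a y^a`. -/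
def boundary (gJ : J → ℤ) (b : Matrix I J ℂ) (n : ℕ) :
    SuperSeries LaurentH (PathVar I J n) :=
  hbarPow (-1) Complex.I • ∑ i, ∑ a, b i a •
    mul (τ.ghPath gJ) (coord (PathVar.out a)) (coord (PathVar.p none i))

/-- The observable `O(x(0))`. -/
def inserted {n : ℕ} (O : τ.Fun) : SuperSeries LaurentH (PathVar I J n) :=
  rename (PathVar.x none) (fun L => HahnSeries.ofPowerSeries ℤ ℂ (O L))

/-- The expectation value
`⟨ exp ((i/ħ)⟨p(T), x_out⟩) ∏ₛ (-(i/ħ) ℍ(x(t_s), p(t_s))) O(x(0)) ⟩₀`. -/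
def integrand (gJ : J → ℤ) (b : Matrix I J ℂ) (T : ℝ) (O : τ.Fun) (n : ℕ) (t : Fin n → ℝ) :
    SuperSeries LaurentH J :=
  τ.wick T t (mul (τ.ghPath gJ) (SuperSeries.exp (τ.ghPath gJ) (τ.boundary gJ b n))
    ((List.ofFn τ.vertex).foldr (mul (τ.ghPath gJ)) (τ.inserted O)))

/-- Order `n` of the perturbative path integral, `(1/n!) ∫_{[0,T]ⁿ} dt₁ ⋯ dtₙ (integrand)`: the
Taylor coefficient at `L` in the boundary value, at order `ħᵏ`. -/
def pathIntegralTerm (gJ : J → ℤ) (b : Matrix I J ℂ) (T : ℝ) (O : τ.Fun)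
    (L : List J) (k : ℤ) (n : ℕ) : ℂ :=
  ((n.factorial : ℂ)⁻¹) *
    ∫ t in Set.Icc (0 : Fin n → ℝ) (fun _ => T), (τ.integrand gJ b T O n t L).coeff k

/-- The perturbative path integral over paths with `p(0) = 0` and `x(T) = x_out = b(y)` of
`O(x(0)) exp ((i/ħ) (gauge-fixed action))`, as a formal function of `y`. -/
def pathIntegral (gJ : J → ℤ) (b : Matrix I J ℂ) (T : ℝ) (O : τ.Fun) :
    SuperSeries (PowerSeries ℂ) J :=
  fun L => PowerSeries.mk fun k => ∑' n, τ.pathIntegralTerm gJ b T O L k n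

/-- The perturbative path integral makes sense: the integrals over times exist, no negative powers
of `ħ` survive, and the sum over the orders of perturbation theory converges. -/
def PathIntegralConverges (gJ : J → ℤ) (b : Matrix I J ℂ) (T : ℝ) (O : τ.Fun) : Prop :=
  (∀ n L k, MeasureTheory.IntegrableOn (fun t => (τ.integrand gJ b T O n t L).coeff k)
    (Set.Icc (0 : Fin n → ℝ) (fun _ => T))) ∧
  (∀ n L (k : ℤ), k < 0 → τ.pathIntegralTerm gJ b T O L k n = 0) ∧
  (∀ L k, Summable (τ.pathIntegralTerm gJ b T O L k))

/-- The `dT` component of `O(x + dT κ(x)) = O(x) + dT ⟨κ(x), ∂/∂x⟩ O`, i.e. of `O(x̃)` at the initial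
point. (There `x̃ = x - dt κ(x)`, and `dt = -dT` for a displacement of the initial point of an
interval of length `T`.) -/
def dTComponent (O : τ.Fun) : τ.Fun := τ.κhat O

end BVTheory

end

open scoped PowerSeries.WithPiTopology

open SuperSeries

noncomputable section

set_option linter.unusedSectionVars false
set_option linter.unusedVariables false

/-! Give every linear coordinate weight 1 and ħ weight 3. The operators d, κ̂, ν, K, π^* and ι^*
preserve the resulting decreasing filtration `Fil`, while δ = Q_int - iħΔ raises it by one: S_int is
at least cubic, and the two derivatives in Δ cost less than ħ gains. All perturbation series are
therefore geometric series that converge coefficientwise, and the two successive perturbations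
amount to a single one by δ: i_int(O') is the solution s of s + Kδs = π^*O', and p_int, K_int are
ι^*, K composed with (1 + δK)⁻¹ (`iInt_eq`, `res_eq`).

Let N be the operator counting the degree in F''. From dκ̂ + κ̂d = N and κ̂ = NK one gets H i_int =
0, H K_int = κ̂, p_int H = 0, p_int i_int = 1 and p_int K_int = 0 (`H_iInt`, `H_Kint`, `pInt_H`).
Moreover H equals N up to higher filtration, and on ker p_int the component of degree 0 in F'' is
itself of higher filtration. So modulo each step of the filtration every element of ker p_int is
killed by a product of factors H - a with integers a ≥ 1 (`exists_prodH`), and e^{-TH} decays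
exponentially on it (`exists_expFlow_bound`). Writing O as i_int p_int O plus an element of ker
p_int gives both limits; integrating d/dT e^{-TH} K_int O = -e^{-TH} κ̂O gives the formula for
K_int.

On the other side, ℍ is at most quadratic in p, with normal form ∑ A_j p_j + ∑ B_ij p_i p_j
(`Hcl_eq`), and H is the normally ordered operator with this symbol, divided by -iħ, under p = -iħ∂
(`H_eq_symbolOp`). By Wick's theorem a momentum differentiates everything at earlier times
(`wick_coord_p_mul`). At pairwise different times in the open interval each vertex thus acts as -H
on what precedes it, and p(T) translates x to x_out (`wickSum_chain`). The integrand of order n is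
almost everywhere the constant (-H)ⁿO, pulled back along the boundary condition; integrating over
[0,T]ⁿ yields the n-th term of e^{-TH}O. -/

namespace SuperSeries

/-! ### The graded commutative algebra of formal power series -/

section Algebra

variable {R V W S : Type*} [CommRing R] {g : V → ℤ}

theorem deg_nil : deg g ([] : List V) = 0 := rfl

theorem deg_cons (v : V) (L : List V) : deg g (v :: L) = g v + deg g L := by simp [deg]

/-- A series is its constant term together with its partial derivatives, since a list is empty or
has a head. Most identities below are proved by the corresponding induction on the list:
differentiate both sides and apply the induction hypothesis to the derivatives. -/
theorem ext_pderiv {f h : SuperSeries R V} (h0 : f [] = h []) (h1 : ∀ v, pderiv v f = pderiv v h) :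
    f = h := by
  funext L
  cases L with
  | nil => exact h0
  | cons v L => exact congrFun (h1 v) L

theorem pderiv_apply (v : V) (f : SuperSeries R V) (L : List V) : pderiv v f L = f (v :: L) := rfl

theorem twist_apply (v : V) (f : SuperSeries R V) (L : List V) :
    twist g v f L = (g v * deg g L).negOnePow • f L := rfl

@[simp] theorem pderiv_zero (v : V) : pderiv v (0 : SuperSeries R V) = 0 := rfl

theorem pderiv_add (v : V) (f h : SuperSeries R V) : pderiv v (f + h) = pderiv v f + pderiv v h :=
  rfl

theorem pderiv_smul [SMul S R] (c : S) (v : V) (f : SuperSeries R V) :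
    pderiv v (c • f) = c • pderiv v f := rfl

theorem pderiv_sum {ι : Type*} (s : Finset ι) (v : V) (f : ι → SuperSeries R V) :
    pderiv v (∑ a ∈ s, f a) = ∑ a ∈ s, pderiv v (f a) := by
  funext L; simp [pderiv, Finset.sum_apply]

@[simp] theorem twist_zero (v : V) : twist g v (0 : SuperSeries R V) = 0 := by
  funext L; simp [twist]

theorem twist_add (v : V) (f h : SuperSeries R V) :
    twist g v (f + h) = twist g v f + twist g v h := by
  funext L; simp [twist]

theorem twist_smul [Monoid S] [DistribMulAction S R] [SMulCommClass ℤˣ S R] (c : S) (v : V)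
    (f : SuperSeries R V) : twist g v (c • f) = c • twist g v f := by
  funext L; simp only [twist, Pi.smul_apply]; rw [smul_comm]

theorem twist_sum {ι : Type*} (s : Finset ι) (v : V) (f : ι → SuperSeries R V) :
    twist g v (∑ a ∈ s, f a) = ∑ a ∈ s, twist g v (f a) := by
  funext L; simp [twist, Finset.sum_apply, Finset.smul_sum]

theorem pderiv_twist (v w : V) (f : SuperSeries R V) :
    pderiv w (twist g v f) = (g v * g w).negOnePow • twist g v (pderiv w f) := by
  funext L
  simp only [pderiv, twist, Pi.smul_apply, deg_cons, smul_smul, ← Int.negOnePow_add, mul_add]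

theorem twist_twist_comm (v w : V) (f : SuperSeries R V) :
    twist g v (twist g w f) = twist g w (twist g v f) := by
  funext L; simp only [twist]; rw [smul_comm]

theorem pderiv_mul (v : V) (f h : SuperSeries R V) :
    pderiv v (mul g f h) = mul g (pderiv v f) h + mul g (twist g v f) (pderiv v h) := rfl

theorem mul_nil (f h : SuperSeries R V) : mul g f h [] = f [] * h [] := rfl

theorem mul_cons (v : V) (L : List V) (f h : SuperSeries R V) :
    mul g f h (v :: L) = mul g (pderiv v f) h L + mul g (twist g v f) (pderiv v h) L := rfl

theorem mul_add (f h k : SuperSeries R V) : mul g f (h + k) = mul g f h + mul g f k := by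
  funext L
  induction L generalizing f h k with
  | nil => simp [mul_nil, _root_.mul_add]
  | cons v L ih =>
    simp only [mul_cons, Pi.add_apply, pderiv_add, ih]; abel

theorem add_mul (f h k : SuperSeries R V) : mul g (f + h) k = mul g f k + mul g h k := by
  funext L
  induction L generalizing f h k with
  | nil => simp [mul_nil, _root_.add_mul]
  | cons v L ih =>
    simp only [mul_cons, Pi.add_apply, pderiv_add, twist_add, ih]; abel

@[simp] theorem mul_zero (f : SuperSeries R V) : mul g f 0 = 0 := by
  have := mul_add (g := g) f 0 0
  simpa using this

@[simp] theorem zero_mul (f : SuperSeries R V) : mul g 0 f = 0 := by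
  have := add_mul (g := g) 0 0 f
  simpa using this

theorem mul_sum {ι : Type*} (s : Finset ι) (f : SuperSeries R V) (h : ι → SuperSeries R V) :
    mul g f (∑ a ∈ s, h a) = ∑ a ∈ s, mul g f (h a) :=
  map_sum (AddMonoidHom.mk' (mul g f) (mul_add f)) h s

theorem sum_mul {ι : Type*} (s : Finset ι) (f : ι → SuperSeries R V) (h : SuperSeries R V) :
    mul g (∑ a ∈ s, f a) h = ∑ a ∈ s, mul g (f a) h :=
  map_sum (AddMonoidHom.mk' (fun f => mul g f h) (fun a b => add_mul a b h)) f s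

theorem mul_smul [Monoid S] [DistribMulAction S R] [SMulCommClass S R R]
    (c : S) (f h : SuperSeries R V) : mul g f (c • h) = c • mul g f h := by
  funext L
  induction L generalizing f h with
  | nil => simp [mul_nil, mul_smul_comm]
  | cons v L ih => simp only [mul_cons, Pi.smul_apply, pderiv_smul, ih, smul_add]

theorem smul_mul [Monoid S] [DistribMulAction S R] [IsScalarTower S R R] [SMulCommClass ℤˣ S R]
    (c : S) (f h : SuperSeries R V) : mul g (c • f) h = c • mul g f h := by
  funext L
  induction L generalizing f h with
  | nil => simp only [mul_nil, Pi.smul_apply, smul_mul_assoc]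
  | cons v L ih => simp only [mul_cons, Pi.smul_apply, pderiv_smul, twist_smul, ih, smul_add]

/-- The sign (-1)^{|v||f|} is multiplicative in f, so twisting is an algebra automorphism. This is
what makes the recursive product associative. -/
theorem twist_mul (v : V) (f h : SuperSeries R V) :
    twist g v (mul g f h) = mul g (twist g v f) (twist g v h) := by
  funext L
  induction L generalizing f h with
  | nil => simp [twist, mul_nil, deg_nil]
  | cons w L ih =>
    have e : twist g v (mul g f h) (w :: L)
        = (g v * g w).negOnePow • twist g v (pderiv w (mul g f h)) L := by
      rw [← Pi.smul_apply, ← pderiv_twist]; rfl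
    rw [e, pderiv_mul, twist_add, Pi.add_apply, ih, ih, mul_cons, pderiv_twist, pderiv_twist,
      smul_mul, mul_smul, smul_add, twist_twist_comm v w]; rfl

theorem mul_assoc (f h k : SuperSeries R V) : mul g (mul g f h) k = mul g f (mul g h k) := by
  funext L
  induction L generalizing f h k with
  | nil => simp [mul_nil, _root_.mul_assoc]
  | cons v L ih =>
    simp only [mul_cons, pderiv_mul, add_mul, mul_add, Pi.add_apply, twist_mul, ih]; abel

/-- Series all of whose components have ghost degree `e`. -/
def Homog (g : V → ℤ) (e : ℤ) (f : SuperSeries R V) : Prop := ∀ L, f L ≠ 0 → deg g L = e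

theorem Homog.pderiv {e e' : ℤ} {f : SuperSeries R V} (hf : Homog g e f) {v : V}
    (he : e = e' + g v) : Homog g e' (pderiv v f) := by
  intro L hL
  have := hf (v :: L) hL
  rw [deg_cons] at this; omega

theorem Homog.twist {e : ℤ} {f : SuperSeries R V} (hf : Homog g e f) (v : V) :
    twist g v f = (g v * e).negOnePow • f := by
  funext L
  by_cases h : f L = 0
  · simp [SuperSeries.twist, h]
  · simp [SuperSeries.twist, hf L h]

theorem Homog.zero (e : ℤ) : Homog g e (0 : SuperSeries R V) := fun L h => absurd rfl h

theorem Homog.add {e : ℤ} {f h : SuperSeries R V} (hf : Homog g e f) (hh : Homog g e h) :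
    Homog g e (f + h) := by
  intro L hL
  by_cases h0 : f L = 0
  · exact hh L (by simpa [h0] using hL)
  · exact hf L h0

theorem Homog.smul [Monoid S] [DistribMulAction S R] {e : ℤ} {f : SuperSeries R V}
    (hf : Homog g e f) (c : S) : Homog g e (c • f) := by
  intro L hL
  refine hf L fun h0 => hL ?_
  simp [h0]

theorem Homog.sum {ι : Type*} {s : Finset ι} {e : ℤ} {f : ι → SuperSeries R V}
    (hf : ∀ a ∈ s, Homog g e (f a)) : Homog g e (∑ a ∈ s, f a) :=
  Finset.sum_induction f (Homog g e) (fun _ _ => Homog.add) (Homog.zero e) hf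

/-- Meant for matrix entries, whose degree constraint is available only where they do not vanish. -/
theorem Homog.smul_of_ne [Zero S] [SMulWithZero S R] {e : ℤ} {f : SuperSeries R V}
    {c : S} (hf : c ≠ 0 → Homog g e f) : Homog g e (c • f) := by
  intro L hL
  by_cases hc : c = 0
  · simp [hc] at hL
  · exact hf hc L (fun h0 => hL (by simp [h0]))

theorem Homog.mul {e e' : ℤ} {f h : SuperSeries R V} (hf : Homog g e f) (hh : Homog g e' h) :
    Homog g (e + e') (mul g f h) := by
  intro L
  induction L generalizing f h e e' with
  | nil =>
    intro hL
    rw [mul_nil] at hL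
    have h1 := hf [] (left_ne_zero_of_mul hL)
    have h2 := hh [] (right_ne_zero_of_mul hL)
    rw [deg_nil] at *; omega
  | cons v L ih =>
    intro hL
    rw [mul_cons, hf.twist] at hL
    rw [deg_cons]
    by_cases h0 : SuperSeries.mul g (SuperSeries.pderiv v f) h L = 0
    · rw [h0, zero_add] at hL
      have := ih (hf.smul _) (hh.pderiv (e' := e' - g v) (by ring)) hL
      omega
    · have := ih (hf.pderiv (e' := e - g v) (by ring)) hh h0
      omega

theorem Homog.mul' {e e' e'' : ℤ} {f h : SuperSeries R V} (hf : Homog g e f) (hh : Homog g e' h)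
    (he : e + e' = e'') : Homog g e'' (SuperSeries.mul g f h) := he ▸ hf.mul hh

theorem Homog.twist_homog {e : ℤ} {f : SuperSeries R V} (hf : Homog g e f) (v : V) :
    Homog g e (SuperSeries.twist g v f) := by
  rw [hf.twist]; exact hf.smul _

theorem Homog.rpderiv {e e' : ℤ} {f : SuperSeries R V} (hf : Homog g e f) {v : V}
    (he : e = e' + g v) : Homog g e' (rpderiv g v f) := (hf.pderiv he).twist_homog v

theorem negOnePow_congr {a b : ℤ} (h : Even (a - b)) : a.negOnePow = b.negOnePow :=
  (Int.negOnePow_eq_iff a b).2 h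

/-- Graded commutativity; only one factor needs to be homogeneous. -/
theorem mul_comm_of_homog {e : ℤ} {f : SuperSeries R V} (hf : Homog g e f)
    (h : SuperSeries R V) :
    mul g f h = mul g (fun L => (e * deg g L).negOnePow • h L) f := by
  funext L
  induction L generalizing e f h with
  | nil => simp [mul_nil, deg_nil, mul_comm]
  | cons v L ih =>
    rw [mul_cons, mul_cons, hf.twist, smul_mul, Pi.smul_apply, ih hf,
      ih (hf.pderiv (e' := e - g v) (by ring)), add_comm]
    congr 1
    · rw [← Pi.smul_apply, ← smul_mul]
      congr 2
      funext M
      simp only [pderiv, Pi.smul_apply, smul_smul, ← Int.negOnePow_add, deg_cons]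
      congr 1
      apply negOnePow_congr
      simp only [Int.even_add, Int.even_sub, Int.even_mul]; tauto
    · congr 2
      funext M
      simp only [twist, smul_smul, ← Int.negOnePow_add]
      congr 1
      apply negOnePow_congr
      simp only [Int.even_add, Int.even_sub, Int.even_mul]; tauto

theorem mul_comm_homog {e e' : ℤ} {f h : SuperSeries R V} (hf : Homog g e f)
    (hh : Homog g e' h) : mul g f h = (e * e').negOnePow • mul g h f := by
  rw [mul_comm_of_homog hf, ← smul_mul]
  congr 1
  funext L
  by_cases h0 : h L = 0
  · simp [h0]
  · simp [hh L h0]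

theorem mul_comm_even {f : SuperSeries R V} (hf : Homog g 0 f) (h : SuperSeries R V) :
    mul g f h = mul g h f := by
  rw [mul_comm_of_homog hf]; simp

theorem mul_left_comm_homog {e e' : ℤ} {f h : SuperSeries R V} (hf : Homog g e f)
    (hh : Homog g e' h) (k : SuperSeries R V) :
    mul g f (mul g h k) = (e * e').negOnePow • mul g h (mul g f k) := by
  rw [← mul_assoc, mul_comm_homog hf hh, smul_mul, mul_assoc]

/-! Graded symmetry -/

theorem GradedSymm.pderiv {f : SuperSeries R V} (hf : GradedSymm g f) (v : V) :
    GradedSymm g (pderiv v f) := fun L₁ u w L₂ => hf (v :: L₁) u w L₂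

theorem GradedSymm.pderiv_comm {f : SuperSeries R V} (hf : GradedSymm g f) (v w : V) :
    SuperSeries.pderiv v (SuperSeries.pderiv w f)
      = (g v * g w).negOnePow • SuperSeries.pderiv w (SuperSeries.pderiv v f) := by
  funext L
  have := hf [] w v L
  rw [_root_.mul_comm] at this
  exact this

theorem GradedSymm.zero : GradedSymm g (0 : SuperSeries R V) := by intro L₁ v w L₂; simp

theorem GradedSymm.add {f h : SuperSeries R V} (hf : GradedSymm g f) (hh : GradedSymm g h) :
    GradedSymm g (f + h) := by
  intro L₁ v w L₂
  simp only [Pi.add_apply, hf L₁ v w L₂, hh L₁ v w L₂, smul_add]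

theorem GradedSymm.smul [Monoid S] [DistribMulAction S R] [SMulCommClass ℤˣ S R]
    {f : SuperSeries R V} (hf : GradedSymm g f) (c : S) : GradedSymm g (c • f) := by
  intro L₁ v w L₂
  simp only [Pi.smul_apply, hf L₁ v w L₂]
  rw [smul_comm]

theorem GradedSymm.neg {f : SuperSeries R V} (hf : GradedSymm g f) : GradedSymm g (-f) := by
  intro L₁ v w L₂
  simp only [Pi.neg_apply, hf L₁ v w L₂, smul_neg]

theorem GradedSymm.sum {ι : Type*} {s : Finset ι} {f : ι → SuperSeries R V}
    (hf : ∀ a ∈ s, GradedSymm g (f a)) : GradedSymm g (∑ a ∈ s, f a) :=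
  Finset.sum_induction f (GradedSymm g) (fun _ _ => GradedSymm.add) GradedSymm.zero hf

theorem deg_append (L M : List V) : deg g (L ++ M) = deg g L + deg g M := by simp [deg]

theorem GradedSymm.twist {f : SuperSeries R V} (hf : GradedSymm g f) (v : V) :
    GradedSymm g (twist g v f) := by
  intro L₁ u w L₂
  simp only [SuperSeries.twist, deg_append, deg_cons, hf L₁ u w L₂]
  rw [smul_comm]
  congr 3
  ring

theorem GradedSymm.rpderiv {f : SuperSeries R V} (hf : GradedSymm g f) (v : V) :
    GradedSymm g (rpderiv g v f) := (hf.pderiv v).twist v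

/-- Of the four terms of ∂_w∂_v(fh), the two with both derivatives on one factor are exchanged by
the symmetry of that factor, and the two mixed ones are exchanged with each other. -/
theorem GradedSymm.mul {f h : SuperSeries R V} (hf : GradedSymm g f) (hh : GradedSymm g h) :
    GradedSymm g (mul g f h) := by
  intro L₁
  induction L₁ generalizing f h with
  | nil =>
    intro v w L₂
    simp only [List.nil_append, mul_cons, pderiv_twist, smul_mul]
    rw [hf.pderiv_comm v w, hh.pderiv_comm v w, twist_twist_comm v w,
      _root_.mul_comm (g w) (g v)]
    simp only [smul_mul, mul_smul, Pi.smul_apply, smul_add, smul_smul, Int.units_mul_self, one_smul]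
    abel
  | cons u L₁ ih =>
    intro v w L₂
    simp only [List.cons_append, mul_cons]
    rw [ih (hf.pderiv u) hh, ih (hf.twist u) (hh.pderiv u), smul_add]

/-! Constants and coordinates -/

theorem pderiv_one (v : V) : pderiv v (one : SuperSeries R V) = 0 := by
  funext L; simp [pderiv, one]

theorem twist_one (v : V) : twist g v (one : SuperSeries R V) = one := by
  funext L
  by_cases h : L = []
  · simp [twist, h, deg_nil]
  · simp [twist, one, h]

theorem one_mul (f : SuperSeries R V) : mul g one f = f := by
  funext L
  induction L generalizing f with
  | nil => simp [mul_nil, one]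
  | cons v L ih => simp [mul_cons, pderiv_one, twist_one, ih, pderiv]

theorem homog_one : Homog g 0 (one : SuperSeries R V) := by
  intro L hL
  by_cases h : L = []
  · simp [h, deg_nil]
  · simp [one, h] at hL

theorem gradedSymm_one : GradedSymm g (one : SuperSeries R V) := by
  intro L₁ v w L₂; simp [one]

theorem mul_one (f : SuperSeries R V) : mul g f one = f := by
  rw [← mul_comm_even homog_one, one_mul]

open Classical in
theorem pderiv_coord (v w : V) :
    pderiv w (coord v : SuperSeries R V) = if w = v then one else 0 := by
  funext L
  by_cases h : w = v
  · subst h; simp [pderiv, coord, one]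
  · simp [pderiv, coord, h]

theorem pderiv_coord_self (v : V) : pderiv v (coord v : SuperSeries R V) = one := by
  classical rw [pderiv_coord, if_pos rfl]

theorem pderiv_coord_ne {v w : V} (h : w ≠ v) : pderiv w (coord v : SuperSeries R V) = 0 := by
  classical rw [pderiv_coord, if_neg h]

theorem coord_nil (v : V) : (coord v : SuperSeries R V) [] = 0 := by simp [coord]

theorem homog_coord (v : V) : Homog g (g v) (coord v : SuperSeries R V) := by
  intro L hL
  by_cases h : L = [v]
  · simp [h, deg]
  · simp [coord, h] at hL

theorem gradedSymm_coord (u : V) : GradedSymm g (coord u : SuperSeries R V) := by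
  intro L₁ v w L₂
  have h1 : ∀ a b c : V, ¬ (L₁ ++ a :: b :: L₂ = [c]) := fun a b c h => by
    have := congrArg List.length h
    simp only [List.length_append, List.length_cons, List.length_nil] at this
    omega
  simp [coord, h1]

/-! Change of scalars -/

theorem map_mul {R' : Type*} [CommRing R'] (φ : R →+* R') (f h : SuperSeries R V) :
    mul g (fun L => φ (f L)) (fun L => φ (h L)) = fun L => φ (mul g f h L) := by
  funext L
  induction L generalizing f h with
  | nil => simp [mul_nil]
  | cons v L ih =>
    have e : twist g v (fun L => φ (f L)) = fun L => φ (twist g v f L) := by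
      funext M; simp [twist, Units.smul_def]
    rw [mul_cons, e]
    have := ih (pderiv v f) h
    have h2 := ih (twist g v f) (pderiv v h)
    simp only [mul_cons, map_add]
    rw [← this, ← h2]; rfl

end Algebra

/-! ### Extension of scalars, linear substitutions and renamings of variables -/

section Scalars

variable {R V W : Type*} [CommRing R] [Algebra ℂ R] {g : V → ℤ} {g' : W → ℤ}

theorem lift_mul (f h : SuperSeries ℂ V) : lift R (mul g f h) = mul g (lift R f) (lift R h) :=
  (map_mul (algebraMap ℂ R) f h).symm

theorem lift_pderiv (v : V) (f : SuperSeries ℂ V) : lift R (pderiv v f) = pderiv v (lift R f) := rfl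

theorem lift_add (f h : SuperSeries ℂ V) : lift R (f + h) = lift R f + lift R h := by
  funext L; simp [lift]

theorem lift_sum {ι : Type*} (s : Finset ι) (f : ι → SuperSeries ℂ V) :
    lift R (∑ a ∈ s, f a) = ∑ a ∈ s, lift R (f a) := by
  funext L; simp [lift, Finset.sum_apply]

theorem lift_smul (c : ℂ) (f : SuperSeries ℂ V) : lift R (c • f) = c • lift R f := by
  funext L; simp [lift, Algebra.smul_def]

theorem lift_twist (v : V) (f : SuperSeries ℂ V) : lift R (twist g v f) = twist g v (lift R f) := by
  funext L; simp [lift, twist, Units.smul_def]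

theorem lift_rpderiv (v : V) (f : SuperSeries ℂ V) :
    lift R (rpderiv g v f) = rpderiv g v (lift R f) := by
  rw [rpderiv, lift_twist, lift_pderiv]; rfl

theorem lift_coord (v : V) : lift R (coord v : SuperSeries ℂ V) = coord v := by
  funext L; simp only [lift, coord]; split_ifs <;> simp

theorem Homog.lift {e : ℤ} {f : SuperSeries ℂ V} (hf : Homog g e f) : Homog g e (lift R f) := by
  intro L hL
  exact hf L fun h0 => hL (by simp [SuperSeries.lift, h0])

theorem GradedSymm.lift {f : SuperSeries ℂ V} (hf : GradedSymm g f) :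
    GradedSymm g (lift R f) := by
  intro L₁ v w L₂
  simp [SuperSeries.lift, hf L₁ v w L₂, Units.smul_def]

/-! Pullbacks -/

variable [Fintype W]

theorem pullback_nil (M : W → V → ℂ) (f : SuperSeries R W) : pullback M f [] = f [] := rfl

theorem pullback_cons (M : W → V → ℂ) (f : SuperSeries R W) (v : V) (L : List V) :
    pullback M f (v :: L) = ∑ w, M w v • pullback M (pderiv w f) L := rfl

theorem pderiv_pullback (M : W → V → ℂ) (f : SuperSeries R W) (v : V) :
    pderiv v (pullback M f) = ∑ w, M w v • pullback M (pderiv w f) := by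
  funext L; simp [pderiv, pullback_cons, Finset.sum_apply]

theorem pullback_add (M : W → V → ℂ) (f h : SuperSeries R W) :
    pullback M (f + h) = pullback M f + pullback M h := by
  funext L
  induction L generalizing f h with
  | nil => simp [pullback_nil]
  | cons v L ih =>
    simp only [pullback_cons, Pi.add_apply, pderiv_add, ih, smul_add, Finset.sum_add_distrib]

theorem pullback_smul {S : Type*} [Monoid S] [DistribMulAction S R] [SMulCommClass S ℂ R]
    (M : W → V → ℂ) (c : S) (f : SuperSeries R W) : pullback M (c • f) = c • pullback M f := by
  funext L
  induction L generalizing f with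
  | nil => simp [pullback_nil]
  | cons v L ih =>
    simp only [pullback_cons, Pi.smul_apply, pderiv_smul, ih, Finset.smul_sum]
    exact Finset.sum_congr rfl fun w _ => (smul_comm _ _ _).symm

theorem pullback_zero (M : W → V → ℂ) : pullback M (0 : SuperSeries R W) = 0 := by
  have := pullback_smul M (0 : ℂ) (0 : SuperSeries R W)
  simpa using this

theorem pullback_sum {ι : Type*} (s : Finset ι) (M : W → V → ℂ) (f : ι → SuperSeries R W) :
    pullback M (∑ a ∈ s, f a) = ∑ a ∈ s, pullback M (f a) :=
  map_sum (AddMonoidHom.mk' (pullback M) (pullback_add M)) f s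

theorem pullback_comp {U : Type*} [Fintype V] (M : W → V → ℂ) (M' : V → U → ℂ)
    (f : SuperSeries R W) :
    pullback M' (pullback M f) = pullback (fun w u => ∑ v, M w v * M' v u) f := by
  funext L
  induction L generalizing f with
  | nil => simp [pullback_nil]
  | cons v L ih =>
    simp only [pullback_cons, pderiv_pullback, pullback_sum, pullback_smul, Finset.sum_apply,
      Pi.smul_apply, ih, Finset.smul_sum, Finset.sum_smul, smul_smul]
    rw [Finset.sum_comm]
    simp only [_root_.mul_comm]

theorem pullback_of_one [DecidableEq W] {M : W → W → ℂ} (hM : ∀ w v, M w v = if w = v then 1 else 0)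
    (f : SuperSeries R W) : pullback M f = f := by
  funext L
  induction L generalizing f with
  | nil => rfl
  | cons v L ih =>
    rw [pullback_cons, Finset.sum_eq_single v]
    · simp [ih, pderiv, hM]
    · intro w _ hw; simp [hM, hw]
    · simp

theorem GradedSymm.pullback {M : W → V → ℂ} (hM : ∀ w v, M w v ≠ 0 → g' w = g v)
    {f : SuperSeries R W} (hf : GradedSymm g' f) : GradedSymm g (pullback M f) := by
  intro L₁
  induction L₁ generalizing f with
  | nil =>
    intro u v L₂
    simp only [List.nil_append, pullback_cons, Finset.smul_sum]
    rw [Finset.sum_comm]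
    refine Finset.sum_congr rfl fun a _ => Finset.sum_congr rfl fun b _ => ?_
    by_cases h1 : M a v = 0
    · simp [h1]
    by_cases h2 : M b u = 0
    · simp [h2]
    rw [hf.pderiv_comm a b, pullback_smul, hM _ _ h1, hM _ _ h2, Pi.smul_apply,
      _root_.mul_comm (g v), smul_comm (M b u), smul_comm (M b u) (Int.negOnePow _),
      smul_comm (M a v) (Int.negOnePow _)]
  | cons a L₁ ih =>
    intro u v L₂
    simp only [List.cons_append, pullback_cons, Finset.smul_sum]
    refine Finset.sum_congr rfl fun b _ => ?_
    rw [ih (hf.pderiv b), smul_comm]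

/-! Renamings -/

/-- For injective φ a single term of the chain rule survives. Together with the vanishing of
derivatives outside the range of φ this reduces every statement on renamings to a case distinction
on the first variable. -/
theorem pderiv_rename {φ : W → V} (hφ : Function.Injective φ) (f : SuperSeries R W) (w : W) :
    pderiv (φ w) (rename φ f) = rename φ (pderiv w f) := by
  classical
  rw [rename, pderiv_pullback, Finset.sum_eq_single w]
  · simp [rename]
  · intro a _ ha
    simp [hφ.ne_iff.2 ha.symm]
  · simp

theorem pderiv_rename_of_notMem {φ : W → V} (f : SuperSeries R W) {v : V}
    (hv : ∀ w, φ w ≠ v) : pderiv v (rename φ f) = 0 := by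
  rw [rename, pderiv_pullback]
  exact Finset.sum_eq_zero fun a _ => by simp [(hv a).symm]

theorem rename_nil (φ : W → V) (f : SuperSeries R W) : rename φ f [] = f [] := rfl

theorem rename_add (φ : W → V) (f h : SuperSeries R W) :
    rename φ (f + h) = rename φ f + rename φ h := pullback_add _ f h

theorem rename_zero (φ : W → V) : rename φ (0 : SuperSeries R W) = 0 := pullback_zero _

theorem rename_smul {S : Type*} [Monoid S] [DistribMulAction S R] [SMulCommClass S ℂ R]
    (φ : W → V) (c : S) (f : SuperSeries R W) : rename φ (c • f) = c • rename φ f :=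
  pullback_smul _ c f

theorem rename_sum {ι : Type*} (s : Finset ι) (φ : W → V) (f : ι → SuperSeries R W) :
    rename φ (∑ a ∈ s, f a) = ∑ a ∈ s, rename φ (f a) := pullback_sum s _ f

theorem GradedSymm.rename {φ : W → V} (hg : ∀ w, g (φ w) = g' w)
    {f : SuperSeries R W} (hf : GradedSymm g' f) : GradedSymm g (rename φ f) := by
  refine GradedSymm.pullback (fun w v h => ?_) hf
  by_cases hv : v = φ w
  · rw [hv, hg]
  · simp [hv] at h

theorem rename_one (φ : W → V) : rename φ (one : SuperSeries R W) = one := by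
  refine ext_pderiv (by simp [rename_nil, one]) fun v => ?_
  rw [rename, pderiv_pullback]
  simp [pderiv_one, pullback_zero]

theorem rename_coord {φ : W → V} (hφ : Function.Injective φ) (w : W) :
    rename φ (coord w : SuperSeries R W) = coord (φ w) := by
  refine ext_pderiv (by simp [rename_nil, coord_nil]) fun v => ?_
  by_cases hv : ∃ a, φ a = v
  · obtain ⟨a, rfl⟩ := hv
    rw [pderiv_rename hφ]
    by_cases h : a = w
    · rw [h, pderiv_coord_self, pderiv_coord_self, rename_one]
    · rw [pderiv_coord_ne h, pderiv_coord_ne (hφ.ne h), rename_zero]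
  · push Not at hv
    rw [pderiv_rename_of_notMem _ hv, pderiv_coord_ne (hv w).symm]

theorem Homog.rename {φ : W → V} (hφ : Function.Injective φ) (hg : ∀ w, g (φ w) = g' w)
    {e : ℤ} {f : SuperSeries R W} (hf : Homog g' e f) : Homog g e (rename φ f) := by
  intro L
  induction L generalizing f e with
  | nil => exact fun h => hf [] h
  | cons v L ih =>
    intro hL
    change SuperSeries.pderiv v (SuperSeries.rename φ f) L ≠ 0 at hL
    by_cases hv : ∃ a, φ a = v
    · obtain ⟨a, rfl⟩ := hv
      rw [pderiv_rename hφ] at hL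
      have := ih (hf.pderiv (e' := e - g' a) (v := a) (by ring)) hL
      rw [deg_cons, hg]; omega
    · push Not at hv
      simp [pderiv_rename_of_notMem _ hv] at hL

theorem rename_twist {φ : W → V} (hφ : Function.Injective φ) (hg : ∀ w, g (φ w) = g' w)
    (w : W) (f : SuperSeries R W) :
    rename φ (twist g' w f) = twist g (φ w) (rename φ f) := by
  funext L
  induction L generalizing f with
  | nil => simp [rename_nil, twist_apply, deg_nil]
  | cons v L ih =>
    change pderiv v (rename φ (twist g' w f)) L = pderiv v (twist g (φ w) (rename φ f)) L
    by_cases hv : ∃ a, φ a = v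
    · obtain ⟨a, rfl⟩ := hv
      rw [pderiv_rename hφ, pderiv_twist, pderiv_twist, pderiv_rename hφ, rename_smul,
        Pi.smul_apply, Pi.smul_apply, ih, hg, hg]
    · push Not at hv
      rw [pderiv_twist, pderiv_rename_of_notMem _ hv, pderiv_rename_of_notMem _ hv]
      simp

theorem rename_mul {φ : W → V} (hφ : Function.Injective φ) (hg : ∀ w, g (φ w) = g' w)
    (f h : SuperSeries R W) : rename φ (mul g' f h) = mul g (rename φ f) (rename φ h) := by
  funext L
  induction L generalizing f h with
  | nil => rfl
  | cons v L ih =>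
    change pderiv v (rename φ (mul g' f h)) L = pderiv v (mul g (rename φ f) (rename φ h)) L
    rw [pderiv_mul]
    by_cases hv : ∃ a, φ a = v
    · obtain ⟨a, rfl⟩ := hv
      rw [pderiv_rename hφ, pderiv_mul, rename_add, Pi.add_apply, ih, ih, pderiv_rename hφ,
        pderiv_rename hφ, rename_twist hφ hg]; rfl
    · push Not at hv
      rw [pderiv_rename_of_notMem _ hv, pderiv_rename_of_notMem _ hv,
        pderiv_rename_of_notMem _ hv]
      simp

end Scalars

end SuperSeries

/-! ### Derivations with linear coefficients -/

namespace SuperSeries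

section LinDer

variable {R V : Type*} [CommRing R] [Algebra ℂ R] [Fintype V] {g : V → ℤ}

theorem linDer_add (A : V → V → ℂ) (f h : SuperSeries R V) :
    linDer g A (f + h) = linDer g A f + linDer g A h := by
  simp only [linDer, pderiv_add, mul_add, smul_add, Finset.sum_add_distrib]

theorem linDer_smul (A : V → V → ℂ) (c : ℂ) (f : SuperSeries R V) :
    linDer g A (c • f) = c • linDer g A f := by
  unfold linDer
  rw [Finset.smul_sum]
  refine Finset.sum_congr rfl fun k _ => ?_
  rw [Finset.smul_sum]
  refine Finset.sum_congr rfl fun j _ => ?_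
  rw [pderiv_smul, mul_smul, smul_comm]

theorem linDer_units_smul (A : V → V → ℂ) (c : ℤˣ) (f : SuperSeries R V) :
    linDer g A (c • f) = c • linDer g A f := by
  unfold linDer
  rw [Finset.smul_sum]
  refine Finset.sum_congr rfl fun k _ => ?_
  rw [Finset.smul_sum]
  refine Finset.sum_congr rfl fun j _ => ?_
  rw [pderiv_smul, mul_smul, smul_comm]

theorem linDer_zero (A : V → V → ℂ) : linDer g A (0 : SuperSeries R V) = 0 := by
  have := linDer_smul (g := g) A 0 (0 : SuperSeries R V)
  rwa [zero_smul, zero_smul] at this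

/-- `linDer` as a linear map. -/
def linDerₗ (g : V → ℤ) (A : V → V → ℂ) : SuperSeries R V →ₗ[ℂ] SuperSeries R V where
  toFun := linDer g A
  map_add' := linDer_add A
  map_smul' := linDer_smul A

theorem linDer_sum {ι : Type*} (s : Finset ι) (A : V → V → ℂ) (f : ι → SuperSeries R V) :
    linDer g A (∑ a ∈ s, f a) = ∑ a ∈ s, linDer g A (f a) := by
  have := map_sum (linDerₗ (R := R) g A) f s
  exact this

theorem linDer_nil (A : V → V → ℂ) (f : SuperSeries R V) : linDer g A f [] = 0 := by
  simp [linDer, Finset.sum_apply, mul_nil, coord_nil]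

theorem GradedSymm.linDer (A : V → V → ℂ) {f : SuperSeries R V} (hf : GradedSymm g f) :
    GradedSymm g (linDer g A f) :=
  GradedSymm.sum fun k _ => GradedSymm.sum fun j _ =>
    (GradedSymm.mul (gradedSymm_coord k) (hf.pderiv j)).smul (A j k)

/-- The graded commutator of ∂_v with a linear vector field is a vector field with constant
coefficients. Since these derivations vanish at the origin, this relation determines them and drives
all inductions about them. -/
theorem pderiv_linDer {A : V → V → ℂ} {a : ℤ} (hA : ∀ j k, A j k ≠ 0 → g j = g k + a)
    {f : SuperSeries R V} (hf : GradedSymm g f) (v : V) :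
    pderiv v (linDer g A f) =
      ∑ j, A j v • pderiv j f + (g v * a).negOnePow • linDer g A (pderiv v f) := by
  simp only [linDer, pderiv_sum, pderiv_smul, pderiv_mul, smul_add, Finset.sum_add_distrib]
  congr 1
  · rw [Finset.sum_eq_single v]
    · simp only [pderiv_coord_self, one_mul]
    · intro k _ hk
      simp [pderiv_coord_ne hk.symm]
    · simp
  · simp only [Finset.smul_sum]
    refine Finset.sum_congr rfl fun k _ => Finset.sum_congr rfl fun j _ => ?_
    by_cases h : A j k = 0
    · simp [h]
    rw [smul_comm _ (A j k)]
    congr 1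
    rw [(homog_coord k).twist, hf.pderiv_comm v j, mul_smul, smul_mul, smul_smul,
      ← Int.negOnePow_add, hA j k h]
    congr 1
    apply negOnePow_congr
    simp only [Int.even_add, Int.even_sub, Int.even_mul]; tauto

/-- Both sides vanish at the origin and have the same commutator with every ∂_v. The matrices
multiply in the opposite order because the derivations act on coordinates through transposes.
Applied to κ, κ and to d, κ. -/
theorem linDer_anticomm {A B : V → V → ℂ} {a b : ℤ} (hA : ∀ j k, A j k ≠ 0 → g j = g k + a)
    (hB : ∀ j k, B j k ≠ 0 → g j = g k + b) (ha : Odd a) (hb : Odd b)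
    {f : SuperSeries R V} (hf : GradedSymm g f) :
    linDer g A (linDer g B f) + linDer g B (linDer g A f) =
      linDer g (fun i k => ∑ j, (B i j * A j k + A i j * B j k)) f := by
  have hC : ∀ i k, (∑ j, (B i j * A j k + A i j * B j k)) ≠ 0 → g i = g k + (a + b) := by
    intro i k h
    obtain ⟨j, -, hj⟩ := Finset.exists_ne_zero_of_sum_ne_zero h
    by_cases h1 : B i j * A j k = 0
    · rw [h1, zero_add] at hj
      have h3 := hA _ _ (left_ne_zero_of_mul hj)
      have h4 := hB _ _ (right_ne_zero_of_mul hj)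
      omega
    · have h3 := hB _ _ (left_ne_zero_of_mul h1)
      have h4 := hA _ _ (right_ne_zero_of_mul h1)
      omega
  funext L
  induction L generalizing f with
  | nil => simp [linDer_nil]
  | cons v L ih =>
    have e : ∀ x : ℤ, Odd x → (g v * x).negOnePow = (g v).negOnePow := by
      intro x hx
      apply negOnePow_congr
      simp only [Int.even_sub, Int.even_mul, ← Int.not_odd_iff_even (n := x), hx]; tauto
    -- Moving ∂_j past the second derivation gives a matrix product plus a term with a derivation;
    -- as X shifts degrees by an odd number, the sign of that term is opposite to the sign for v, so
    -- these cross terms cancel in the anticommutator.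
    have key : ∀ (X Y : V → V → ℂ) (x y : ℤ) (hX : ∀ j k, X j k ≠ 0 → g j = g k + x)
        (hY : ∀ j k, Y j k ≠ 0 → g j = g k + y), Odd x → Odd y →
        ∑ j, X j v • pderiv j (linDer g Y f) = ∑ i, (∑ j, Y i j * X j v) • pderiv i f -
          (g v).negOnePow • ∑ j, X j v • linDer g Y (pderiv j f) := by
      intro X Y x y hX hY hx hy
      simp only [pderiv_linDer hY hf, smul_add, Finset.sum_add_distrib, Finset.smul_sum,
        smul_smul, Finset.sum_smul, sub_eq_add_neg, ← Finset.sum_neg_distrib]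
      congr 1
      · rw [Finset.sum_comm]
        simp only [mul_comm]
      · refine Finset.sum_congr rfl fun j _ => ?_
        by_cases h : X j v = 0
        · simp [h]
        rw [hX j v h, smul_comm]
        have : ((g v + x) * y).negOnePow = (g v + 1).negOnePow := by
          apply negOnePow_congr
          have h1 := Int.not_even_iff_odd.2 hx
          have h2 := Int.not_even_iff_odd.2 hy
          simp only [Int.even_sub, Int.even_mul, Int.even_add, h1, h2]; tauto
        rw [smul_comm, this, Int.negOnePow_succ, Units.neg_smul, smul_neg, smul_comm]
    have h2 : (g v * (a + b)).negOnePow = 1 := by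
      rw [Int.negOnePow_even]
      exact (ha.add_odd hb).mul_left _
    have main : pderiv v (linDer g A (linDer g B f) + linDer g B (linDer g A f)) =
        ∑ j, (∑ i, (B j i * A i v + A j i * B i v)) • pderiv j f +
        (linDer g A (linDer g B (pderiv v f)) + linDer g B (linDer g A (pderiv v f))) := by
      rw [pderiv_add, pderiv_linDer hA (hf.linDer B), pderiv_linDer hB (hf.linDer A),
        pderiv_linDer hB hf, pderiv_linDer hA hf, key A B a b hA hB ha hb, key B A b a hB hA hb ha,
        e a ha, e b hb]
      simp only [linDer_add, linDer_sum, linDer_smul, linDer_units_smul, smul_add, smul_smul, Int.units_mul_self,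
        one_smul, Finset.sum_add_distrib, add_smul]
      abel
    change pderiv v (linDer g A (linDer g B f) + linDer g B (linDer g A f)) L = pderiv v (linDer g _ f) L
    rw [main, pderiv_linDer hC hf, h2, one_smul]
    have := ih (hf.pderiv v)
    simp only [Pi.add_apply] at this ⊢
    rw [this]

end LinDer

end SuperSeries

/-! ### The filtration in which a coordinate weighs 1 and ħ weighs 3 -/

namespace SuperSeries

section Filtration

variable {V W : Type*} {g : V → ℤ}

/-- The series whose Taylor coefficients at `L`, in order `ħᵏ`, vanish for `3 k + |L| < m`. -/
def Fil (V : Type*) (m : ℕ) : Submodule ℂ (SuperSeries (PowerSeries ℂ) V) where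
  carrier := {f | ∀ L k, 3 * k + L.length < m → PowerSeries.coeff k (f L) = 0}
  add_mem' := fun {f h} hf hh L k hk => by simp [hf L k hk, hh L k hk]
  zero_mem' := fun L k _ => by simp
  smul_mem' := fun c f hf L k hk => by simp [hf L k hk]

theorem fil_anti {m m' : ℕ} (h : m ≤ m') : Fil V m' ≤ Fil V m :=
  fun f hf L k hk => hf L k (by omega)

theorem mem_fil_zero (f : SuperSeries (PowerSeries ℂ) V) : f ∈ Fil V 0 :=
  fun L k hk => absurd hk (by omega)

/-- The filtration is separated, so an identity may be checked modulo each of its steps; there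
infinite sums become finite. -/
theorem eq_zero_of_mem_fil {f : SuperSeries (PowerSeries ℂ) V} (h : ∀ m, f ∈ Fil V m) : f = 0 := by
  funext L
  ext k
  simpa using h (3 * k + L.length + 1) L k (by omega)

theorem eq_of_sub_mem_fil {f h : SuperSeries (PowerSeries ℂ) V} (H : ∀ m, f - h ∈ Fil V m) :
    f = h := sub_eq_zero.1 (eq_zero_of_mem_fil H)

theorem units_smul_mem_fil {m : ℕ} {f : SuperSeries (PowerSeries ℂ) V} (c : ℤˣ)
    (hf : f ∈ Fil V m) : c • f ∈ Fil V m := by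
  rcases Int.units_eq_one_or c with rfl | rfl
  · simpa using hf
  · simpa using (Fil V m).neg_mem hf

theorem pderiv_mem_fil {m m' : ℕ} {f : SuperSeries (PowerSeries ℂ) V} (hf : f ∈ Fil V m)
    (h : m' ≤ m - 1) (v : V) : pderiv v f ∈ Fil V m' :=
  fun L k hk => hf (v :: L) k (by simp only [List.length_cons]; omega)

theorem twist_mem_fil {m : ℕ} {f : SuperSeries (PowerSeries ℂ) V} (hf : f ∈ Fil V m) (v : V) :
    twist g v f ∈ Fil V m := by
  intro L k hk
  have := hf L k hk
  rw [twist_apply, Units.smul_def, map_zsmul, this, smul_zero]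

theorem mul_mem_fil {a b c : ℕ} {f h : SuperSeries (PowerSeries ℂ) V} (hf : f ∈ Fil V a)
    (hh : h ∈ Fil V b) (hc : c ≤ a + b) : mul g f h ∈ Fil V c := by
  intro L
  induction L generalizing f h a b c with
  | nil =>
    intro k hk
    rw [mul_nil, PowerSeries.coeff_mul]
    refine Finset.sum_eq_zero fun x hx => ?_
    rw [Finset.HasAntidiagonal.mem_antidiagonal] at hx
    simp only [List.length_nil] at hk
    by_cases h1 : 3 * x.1 < a
    · rw [hf [] x.1 (by simpa using h1), MulZeroClass.zero_mul]
    · rw [hh [] x.2 (by simp only [List.length_nil]; omega), MulZeroClass.mul_zero]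
  | cons v L ih =>
    intro k hk
    simp only [List.length_cons] at hk
    rw [mul_cons, map_add, ih (pderiv_mem_fil hf (m' := a - 1) (by omega) v) hh
      (c := c - 1) (by omega) k (by omega),
      ih (twist_mem_fil hf v) (pderiv_mem_fil hh (m' := b - 1) (by omega) v)
      (c := c - 1) (by omega) k (by omega), add_zero]

theorem coord_mem_fil (v : V) : coord v ∈ Fil V 1 := by
  intro L k hk
  have : L = [] := List.length_eq_zero_iff.1 (by omega)
  simp [this, coord]

theorem lift_mem_fil {m : ℕ} {f : SuperSeries ℂ V} (hf : ∀ L, L.length < m → f L = 0) :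
    lift (PowerSeries ℂ) f ∈ Fil V m := by
  intro L k hk
  simp [lift, hf L (by omega)]

theorem rpderiv_mem_fil {m m' : ℕ} {f : SuperSeries (PowerSeries ℂ) V} (hf : f ∈ Fil V m)
    (h : m' ≤ m - 1) (v : V) : rpderiv g v f ∈ Fil V m' := twist_mem_fil (pderiv_mem_fil hf h v) v

/-- The weight 3 of ħ is the least integer exceeding the weight 2 lost in the BV Laplacian. -/
theorem negIHbar_smul_mem_fil {m m' : ℕ} {f : SuperSeries (PowerSeries ℂ) V} (hf : f ∈ Fil V m)
    (h : m' ≤ m + 3) : negIHbar • f ∈ Fil V m' := by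
  intro L k hk
  rw [Pi.smul_apply, smul_eq_mul, negIHbar, _root_.mul_assoc, PowerSeries.coeff_C_mul]
  cases k with
  | zero => rw [PowerSeries.coeff_zero_X_mul, MulZeroClass.mul_zero]
  | succ k => rw [PowerSeries.coeff_succ_X_mul, hf L k (by omega), MulZeroClass.mul_zero]

theorem linDer_mem_fil [Fintype V] {m : ℕ} {f : SuperSeries (PowerSeries ℂ) V} (hf : f ∈ Fil V m)
    (A : V → V → ℂ) : linDer g A f ∈ Fil V m :=
  Submodule.sum_mem _ fun k _ => Submodule.sum_mem _ fun j _ => Submodule.smul_mem _ _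
    (mul_mem_fil (coord_mem_fil k) (pderiv_mem_fil hf (m' := m - 1) (by omega) j) (by omega))

theorem pullback_mem_fil [Fintype W] {m : ℕ} {f : SuperSeries (PowerSeries ℂ) W}
    (hf : f ∈ Fil W m) (M : W → V → ℂ) : pullback M f ∈ Fil V m := by
  intro L
  induction L generalizing f m with
  | nil => exact fun k hk => hf [] k hk
  | cons v L ih =>
    intro k hk
    rw [pullback_cons, map_sum]
    simp only [List.length_cons] at hk
    refine Finset.sum_eq_zero fun w _ => ?_
    rw [map_smul, ih (pderiv_mem_fil hf (m' := m - 1) (by omega) w) k (by omega), smul_zero]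

end Filtration

end SuperSeries

/-! ### Decomposition of functions by polynomial degree in F'' -/

namespace BVTheory

variable {I I' : Type*} [Fintype I] [DecidableEq I] [Fintype I'] [DecidableEq I']
variable (τ : BVTheory I I')

/-- The projector onto the image of `ι`. -/
abbrev P' : I → I → ℂ := fun j v => (τ.ι * τ.π) j v

/-- The projector onto the kernel of `π`. -/
abbrev P'' : I → I → ℂ := fun j v => (1 - τ.ι * τ.π : Matrix I I ℂ) j v

/-- The component of polynomial degree `N` in `F''`. -/
def uv (N : ℕ) (f : τ.Fun) : τ.Fun := fun L => τ.uvCoeff L N f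

/-- `uvPred N` is the component of degree `N - 1` in `F''`. -/
def uvPred : ℕ → τ.Fun → τ.Fun
  | 0, _ => 0
  | N + 1, f => τ.uv N f

theorem uv_nil_zero (f : τ.Fun) : τ.uv 0 f [] = f [] := rfl

theorem uv_nil_succ (N : ℕ) (f : τ.Fun) : τ.uv (N + 1) f [] = 0 := rfl

/-- Splitting the direction e_v into its parts in F' and F'': only the derivative along F'' lowers
the degree. `uvPred` lets N = 0 be treated with the other degrees. -/
theorem pderiv_uv (N : ℕ) (f : τ.Fun) (v : I) :
    pderiv v (τ.uv N f) = ∑ j, τ.P' j v • τ.uv N (pderiv j f) +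
      ∑ j, τ.P'' j v • τ.uvPred N (pderiv j f) := by
  funext L
  cases N with
  | zero => simp [pderiv, uv, uvPred, uvCoeff, Finset.sum_apply]
  | succ N => simp [pderiv, uv, uvPred, uvCoeff, Finset.sum_apply, Finset.sum_add_distrib]

theorem uv_add (N : ℕ) (f h : τ.Fun) : τ.uv N (f + h) = τ.uv N f + τ.uv N h := by
  funext L
  induction L generalizing f h N with
  | nil => cases N <;> simp [uv_nil_zero, uv_nil_succ]
  | cons v L ih =>
    change pderiv v (τ.uv N (f + h)) L = pderiv v (τ.uv N f) L + pderiv v (τ.uv N h) L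
    rw [pderiv_uv, pderiv_uv, pderiv_uv]
    have h2 : ∀ a b : τ.Fun, τ.uvPred N (a + b) L = τ.uvPred N a L + τ.uvPred N b L := by
      cases N with
      | zero => intro a b; simp [uvPred]
      | succ N => intro a b; exact ih N a b
    simp only [Pi.add_apply, Finset.sum_apply, Pi.smul_apply, pderiv_add, ih, h2, smul_add,
      Finset.sum_add_distrib]
    abel

theorem uv_smul {S : Type*} [Monoid S] [DistribMulAction S (PowerSeries ℂ)]
    [SMulCommClass S ℂ (PowerSeries ℂ)] (N : ℕ) (c : S) (f : τ.Fun) :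
    τ.uv N (c • f) = c • τ.uv N f := by
  funext L
  induction L generalizing f N with
  | nil => cases N <;> simp [uv_nil_zero, uv_nil_succ]
  | cons v L ih =>
    change pderiv v (τ.uv N (c • f)) L = c • pderiv v (τ.uv N f) L
    rw [pderiv_uv, pderiv_uv]
    have h2 : ∀ a : τ.Fun, τ.uvPred N (c • a) L = c • τ.uvPred N a L := by
      cases N with
      | zero => intro a; simp [uvPred]
      | succ N => intro a; exact ih N a
    simp only [Pi.add_apply, Finset.sum_apply, Pi.smul_apply, pderiv_smul, ih, h2, smul_add,
      Finset.smul_sum]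
    congr 1 <;> exact Finset.sum_congr rfl fun _ _ => (smul_comm _ _ _).symm

/-- `uv` as a linear map. -/
def uvₗ (N : ℕ) : τ.Fun →ₗ[ℂ] τ.Fun where
  toFun := τ.uv N
  map_add' := τ.uv_add N
  map_smul' := τ.uv_smul N

theorem uv_sum {ι : Type*} (s : Finset ι) (N : ℕ) (f : ι → τ.Fun) :
    τ.uv N (∑ a ∈ s, f a) = ∑ a ∈ s, τ.uv N (f a) := by
  have := map_sum (τ.uvₗ N) f s
  exact this

theorem uv_mem_fil {m : ℕ} {f : τ.Fun} (hf : f ∈ Fil I m) (N : ℕ) : τ.uv N f ∈ Fil I m := by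
  intro L
  induction L generalizing f m N with
  | nil =>
    intro k hk
    cases N with
    | zero => exact hf [] k hk
    | succ N => simp [uv_nil_succ]
  | cons v L ih =>
    intro k hk
    simp only [List.length_cons] at hk
    change PowerSeries.coeff k (pderiv v (τ.uv N f) L) = 0
    rw [pderiv_uv]
    simp only [Pi.add_apply, Finset.sum_apply, map_add, map_sum, Pi.smul_apply, map_smul]
    have h1 := fun j => pderiv_mem_fil hf (m' := m - 1) (by omega) j
    rw [Finset.sum_eq_zero fun j _ => ?_, Finset.sum_eq_zero fun j _ => ?_, add_zero]
    · cases N with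
      | zero => simp [uvPred]
      | succ N => rw [uvPred, ih (h1 j) N k (by omega), smul_zero]
    · rw [ih (h1 j) N k (by omega), smul_zero]

theorem P'_deg (j v : I) (h : τ.P' j v ≠ 0) : τ.gh j = τ.gh v := by
  simp only [P', Matrix.mul_apply] at h
  obtain ⟨a, -, ha⟩ := Finset.exists_ne_zero_of_sum_ne_zero h
  rw [τ.ι_deg _ _ (left_ne_zero_of_mul ha), τ.π_deg _ _ (right_ne_zero_of_mul ha)]

theorem P''_deg (j v : I) (h : τ.P'' j v ≠ 0) : τ.gh j = τ.gh v + 0 := by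
  by_cases hjv : j = v
  · rw [hjv, add_zero]
  · rw [add_zero]
    refine τ.P'_deg j v fun h' => h ?_
    have h'' : (τ.ι * τ.π) j v = 0 := h'
    simp [P'', Matrix.one_apply_ne hjv, h'']

/-- Two derivatives produce one term for each pair of projectors; exchanging the variables permutes
the four terms, and no extra sign arises because both projectors preserve degrees. -/
theorem gradedSymm_uv {f : τ.Fun} (hf : GradedSymm τ.gh f) (N : ℕ) :
    GradedSymm τ.gh (τ.uv N f) := by
  have expand : ∀ (N : ℕ) (f : τ.Fun) (v : I) (L : List I), τ.uv N f (v :: L) =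
      ∑ j, τ.P' j v • τ.uv N (pderiv j f) L + ∑ j, τ.P'' j v • τ.uvPred N (pderiv j f) L := by
    intro N f v L
    change pderiv v (τ.uv N f) L = _
    rw [pderiv_uv]; simp [Finset.sum_apply]
  have expandPred : ∀ (N : ℕ) (f : τ.Fun) (v : I) (L : List I), τ.uvPred N f (v :: L) =
      ∑ j, τ.P' j v • τ.uvPred N (pderiv j f) L +
        ∑ j, τ.P'' j v • τ.uvPred (N - 1) (pderiv j f) L := by
    intro N f v L
    cases N with
    | zero => simp [uvPred]
    | succ N => exact expand N f v L
  have uvPred_smul : ∀ (N : ℕ) (c : ℤˣ) (f : τ.Fun), τ.uvPred N (c • f) = c • τ.uvPred N f := by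
    intro N c f
    cases N with
    | zero => simp [uvPred]
    | succ N => exact τ.uv_smul N c f
  have swap : ∀ (Y : τ.Fun → τ.Fun) (hY : ∀ (c : ℤˣ) (f : τ.Fun), Y (c • f) = c • Y f)
      (A B : I → I → ℂ) (hA : ∀ j v, A j v ≠ 0 → τ.gh j = τ.gh v)
      (hB : ∀ j v, B j v ≠ 0 → τ.gh j = τ.gh v) (f : τ.Fun) (hf : GradedSymm τ.gh f)
      (u v : I) (L : List I),
      ∑ j, A j u • ∑ i, B i v • Y (pderiv i (pderiv j f)) L =
      (τ.gh u * τ.gh v).negOnePow •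
        ∑ i, B i v • ∑ j, A j u • Y (pderiv j (pderiv i f)) L := by
    intro Y hY A B hA hB f hf u v L
    simp only [Finset.smul_sum]
    rw [Finset.sum_comm]
    refine Finset.sum_congr rfl fun i _ => Finset.sum_congr rfl fun j _ => ?_
    by_cases h1 : A j u = 0
    · simp [h1]
    by_cases h2 : B i v = 0
    · simp [h2]
    rw [hf.pderiv_comm i j, hY, hA _ _ h1, hB _ _ h2, Pi.smul_apply, smul_comm (B i v) (A j u),
      mul_comm (τ.gh v), smul_comm (B i v) (Int.negOnePow _), smul_comm (A j u) (Int.negOnePow _)]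
  intro L₁
  induction L₁ generalizing f N with
  | nil =>
    intro u v L
    simp only [List.nil_append, expand, expandPred, smul_add, Finset.sum_add_distrib]
    have hP'' : ∀ j v, τ.P'' j v ≠ 0 → τ.gh j = τ.gh v := fun j v h => by
      simpa using τ.P''_deg j v h
    rw [swap _ (τ.uv_smul N) _ _ τ.P'_deg τ.P'_deg f hf u v L,
      swap _ (uvPred_smul N) _ _ τ.P'_deg hP'' f hf u v L,
      swap _ (uvPred_smul N) _ _ hP'' τ.P'_deg f hf u v L,
      swap _ (uvPred_smul (N - 1)) _ _ hP'' hP'' f hf u v L]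
    abel
  | cons a L₁ ih =>
    intro u v L
    simp only [List.cons_append, expand, smul_add, Finset.smul_sum]
    congr 1
    · refine Finset.sum_congr rfl fun j _ => ?_
      rw [ih (hf.pderiv j), smul_comm]
    · refine Finset.sum_congr rfl fun j _ => ?_
      cases N with
      | zero => simp [uvPred]
      | succ N =>
        rw [uvPred, ih (hf.pderiv j), smul_comm]

theorem uv_zero (f : τ.Fun) : τ.uv 0 f = pullback τ.P' f := by
  funext L
  induction L generalizing f with
  | nil => rfl
  | cons v L ih =>
    change pderiv v (τ.uv 0 f) L = _
    rw [pderiv_uv, pullback_cons]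
    simp [uvPred, Finset.sum_apply, ih]

theorem uv_zero_eq (f : τ.Fun) : τ.uv 0 f = τ.i (τ.p f) := by
  rw [uv_zero]; exact (pullback_comp (fun a j => τ.ι a j) (fun a j => τ.π a j) f).symm

/-- The projectors add up to 1, and a Taylor coefficient at L has at most as many arguments in F''
as L has entries. -/
theorem sum_uv (f : τ.Fun) (L : List I) (M : ℕ) (hM : L.length ≤ M) :
    ∑ N ∈ Finset.range (M + 1), τ.uv N f L = f L := by
  induction L generalizing f M with
  | nil =>
    rw [Finset.sum_range_succ']
    simp [uv_nil_zero, uv_nil_succ]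
  | cons v L ih =>
    simp only [List.length_cons] at hM
    obtain ⟨M, rfl⟩ : ∃ K, M = K + 1 := ⟨M - 1, by omega⟩
    simp only [← pderiv_apply, pderiv_uv, Pi.add_apply, Finset.sum_apply, Pi.smul_apply,
      Finset.sum_add_distrib]
    rw [Finset.sum_comm, Finset.sum_comm (s := Finset.range _)]
    simp only [← Finset.smul_sum]
    have h2 : ∀ j, ∑ N ∈ Finset.range (M + 1 + 1), τ.uvPred N (pderiv j f) L = pderiv j f L := by
      intro j
      rw [Finset.sum_range_succ']
      simpa [uvPred] using ih (pderiv j f) M (by omega)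
    -- Collecting the two sums leaves the matrix `P' + P''`, which is the identity.
    simp only [ih _ (M + 1) (by omega), h2, ← Finset.sum_add_distrib, ← add_smul]
    rw [Finset.sum_eq_single v]
    · simp [P', P'']
    · intro j _ hj
      simp [P', P'', Matrix.one_apply_ne hj]
    · simp

theorem ιπ_sq : (τ.ι * τ.π) * (τ.ι * τ.π) = τ.ι * τ.π := by
  rw [Matrix.mul_assoc, ← Matrix.mul_assoc τ.π, τ.π_ι, Matrix.one_mul]

theorem P'_mul_P'' (i v : I) : ∑ j, τ.P' i j * τ.P'' j v = 0 := by
  have : (τ.ι * τ.π) * (1 - τ.ι * τ.π) = 0 := by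
    rw [Matrix.mul_sub, ιπ_sq, Matrix.mul_one, sub_self]
  simpa [Matrix.mul_apply] using congrFun (congrFun this i) v

theorem P''_mul_P'' (i v : I) : ∑ j, τ.P'' i j * τ.P'' j v = τ.P'' i v := by
  have : (1 - τ.ι * τ.π) * (1 - τ.ι * τ.π) = 1 - τ.ι * τ.π := by
    rw [Matrix.sub_mul, Matrix.mul_sub (τ.ι * τ.π), ιπ_sq, Matrix.mul_one, sub_self, sub_zero,
      Matrix.one_mul]
  have := congrFun (congrFun this i) v
  rwa [Matrix.mul_apply] at this

/-- The four matrix conditions say that B is zero on F' and maps F'' to itself; the derivation then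
replaces an argument in F'' by another one and keeps their number. -/
theorem linDer_uv {B : I → I → ℂ} {b : ℤ} (hB : ∀ j k, B j k ≠ 0 → τ.gh j = τ.gh k + b)
    (h1 : ∀ i v, ∑ j, B i j * τ.P' j v = 0) (h2 : ∀ i v, ∑ j, τ.P' i j * B j v = 0)
    (e2 : ∀ i v, ∑ j, B i j * τ.P'' j v = B i v) (e1 : ∀ i v, ∑ j, τ.P'' i j * B j v = B i v)
    {f : τ.Fun} (hf : GradedSymm τ.gh f)
    (N : ℕ) : linDer τ.gh B (τ.uv N f) = τ.uv N (linDer τ.gh B f) := by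
  have sum1 : ∀ (A C : I → I → ℂ) (Y : I → PowerSeries ℂ) (v : I),
      ∑ j, A j v • ∑ i, C i j • Y i = ∑ i, (∑ j, C i j * A j v) • Y i := by
    intro A C Y v
    simp only [Finset.smul_sum, Finset.sum_smul, smul_smul]
    rw [Finset.sum_comm]
    simp only [mul_comm]
  have expand : ∀ (N : ℕ) (f : τ.Fun) (v : I) (L : List I), pderiv v (τ.uv N f) L =
      ∑ j, τ.P' j v • τ.uv N (pderiv j f) L +
        ∑ j, τ.P'' j v • τ.uvPred N (pderiv j f) L := by
    intro N f v L
    rw [pderiv_uv]; simp [Finset.sum_apply]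
  funext L
  induction L generalizing f N with
  | nil =>
    cases N <;> simp [linDer_nil, uv_nil_zero, uv_nil_succ]
  | cons v L ih =>
    change pderiv v (linDer τ.gh B (τ.uv N f)) L = pderiv v (τ.uv N (linDer τ.gh B f)) L
    rw [pderiv_linDer hB (τ.gradedSymm_uv hf N), expand, pderiv_uv]
    have ihP : ∀ j, linDer τ.gh B (τ.uvPred N (pderiv j f)) L =
        τ.uvPred N (linDer τ.gh B (pderiv j f)) L := by
      intro j
      cases N with
      | zero => simp [uvPred, linDer_zero]
      | succ N => exact ih (hf.pderiv j) N
    have uvPred_lin : ∀ (j : I), τ.uvPred N (pderiv j (linDer τ.gh B f)) L =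
        ∑ i, B i j • τ.uvPred N (pderiv i f) L +
          (τ.gh j * b).negOnePow • τ.uvPred N (linDer τ.gh B (pderiv j f)) L := by
      intro j
      rw [pderiv_linDer hB hf]
      cases N with
      | zero => simp [uvPred]
      | succ N => simp [uvPred, uv_add, uv_sum, uv_smul, Finset.sum_apply]
    simp only [uvPred_lin]
    simp only [Pi.add_apply, Finset.sum_apply, Pi.smul_apply, expand, linDer_add, linDer_sum,
      linDer_smul, smul_add, Finset.sum_add_distrib, ih (hf.pderiv _), ihP, pderiv_linDer hB hf,
      uv_add, uv_sum, uv_smul, sum1]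
    simp only [h1, h2, e1, e2, zero_smul, Finset.sum_const_zero, zero_add,
      Finset.smul_sum]
    have c1 : ∀ (A : I → I → ℂ) (hA : ∀ j, A j v ≠ 0 → τ.gh j = τ.gh v)
        (Y : I → PowerSeries ℂ), ∑ j, (τ.gh v * b).negOnePow • A j v • Y j =
        ∑ j, A j v • (τ.gh j * b).negOnePow • Y j := by
      intro A hA Y
      refine Finset.sum_congr rfl fun j _ => ?_
      by_cases h : A j v = 0
      · simp [h]
      · rw [hA j h, smul_comm]
    rw [c1 τ.P' (fun j h => τ.P'_deg j v h),
      c1 τ.P'' (fun j h => by simpa using τ.P''_deg j v h)]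
    abel

/-- Euler's identity for the degree in F''. In the induction, a derivative along F' leaves the count
N, while one along F'' leaves N - 1 and contributes the missing 1 through its commutator with the
Euler field. -/
theorem linDer_P''_uv {f : τ.Fun} (hf : GradedSymm τ.gh f) (N : ℕ) :
    linDer τ.gh τ.P'' (τ.uv N f) = (N : ℂ) • τ.uv N f := by
  have expand : ∀ (N : ℕ) (f : τ.Fun) (v : I) (L : List I), pderiv v (τ.uv N f) L =
      ∑ j, τ.P' j v • τ.uv N (pderiv j f) L +
        ∑ j, τ.P'' j v • τ.uvPred N (pderiv j f) L := by
    intro N f v L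
    rw [pderiv_uv]; simp [Finset.sum_apply]
  have sum1 : ∀ (A C : I → I → ℂ) (Y : I → PowerSeries ℂ) (v : I),
      ∑ j, A j v • ∑ i, C i j • Y i = ∑ i, (∑ j, C i j * A j v) • Y i := by
    intro A C Y v
    simp only [Finset.smul_sum, Finset.sum_smul, smul_smul]
    rw [Finset.sum_comm]
    simp only [mul_comm]
  funext L
  induction L generalizing f N with
  | nil => cases N <;> simp [linDer_nil, uv_nil_succ]
  | cons v L ih =>
    change pderiv v (linDer τ.gh τ.P'' (τ.uv N f)) L = (N : ℂ) • pderiv v (τ.uv N f) L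
    have ihP : ∀ j, linDer τ.gh τ.P'' (τ.uvPred N (pderiv j f)) L =
        ((N : ℂ) - 1) • τ.uvPred N (pderiv j f) L := by
      intro j
      cases N with
      | zero => simp [uvPred, linDer_zero]
      | succ N => simpa [uvPred] using ih (hf.pderiv j) N
    have e1 := τ.P'_mul_P''
    have e2 := τ.P''_mul_P''
    rw [pderiv_linDer τ.P''_deg (τ.gradedSymm_uv hf N), expand, pderiv_uv]
    simp only [Pi.add_apply, Finset.sum_apply, Pi.smul_apply, linDer_add, linDer_sum,
      linDer_smul, smul_add, Finset.sum_add_distrib, expand, ih (hf.pderiv _), ihP]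
    have s1 := sum1 τ.P'' τ.P' (fun j => τ.uv N (pderiv j f) L) v
    have s2 := sum1 τ.P'' τ.P'' (fun j => τ.uvPred N (pderiv j f) L) v
    simp only [e2] at s2
    simp only [e1, zero_smul, Finset.sum_const_zero] at s1
    rw [s1, s2]
    simp only [Finset.smul_sum, MulZeroClass.mul_zero, Int.negOnePow_zero, one_smul, zero_add, sub_smul,
      smul_sub, Finset.sum_sub_distrib]
    have c1 : ∀ (A : I → I → ℂ) (Y : I → PowerSeries ℂ),
        ∑ j, A j v • (N : ℂ) • Y j = ∑ j, (N : ℂ) • A j v • Y j :=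
      fun A Y => Finset.sum_congr rfl fun j _ => smul_comm _ _ _
    rw [c1, c1]
    abel

end BVTheory

/-! ### Convergence and inversion of 1 - X for operators X that raise the filtration -/

namespace SuperSeries

section Resolvent

variable {V W : Type*} {g : V → ℤ}

theorem hasSum_of_coeff {ι : Type*} {u : ι → SuperSeries (PowerSeries ℂ) V}
    {s : SuperSeries (PowerSeries ℂ) V}
    (h : ∀ L k, HasSum (fun n => PowerSeries.coeff k (u n L)) (PowerSeries.coeff k (s L))) :
    HasSum u s := by
  rw [Pi.hasSum]
  intro L
  rw [PowerSeries.WithPiTopology.hasSum_iff_hasSum_coeff]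
  exact fun k => h L k

/-- Each coefficient receives contributions from finitely many terms only, so convergence is a
matter of finite sums. -/
theorem hasSum_of_fil {u : ℕ → SuperSeries (PowerSeries ℂ) V}
    {s : SuperSeries (PowerSeries ℂ) V} (hu : ∀ n, u n ∈ Fil V n)
    (hs : ∀ M, s - ∑ n ∈ Finset.range M, u n ∈ Fil V M) : HasSum u s := by
  refine hasSum_of_coeff fun L k => ?_
  have h1 := hs (3 * k + L.length + 1) L k (by omega)
  rw [Pi.sub_apply, map_sub, sub_eq_zero, Finset.sum_apply, map_sum] at h1
  rw [h1]
  refine hasSum_sum_of_ne_finset_zero fun n hn => ?_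
  rw [Finset.mem_range, not_lt] at hn
  exact hu n L k (by omega)

theorem exists_sum_of_fil {u : ℕ → SuperSeries (PowerSeries ℂ) V} (hu : ∀ n, u n ∈ Fil V n) :
    ∃ s, ∀ M, s - ∑ n ∈ Finset.range M, u n ∈ Fil V M := by
  refine ⟨fun L => PowerSeries.mk fun k =>
    ∑ n ∈ Finset.range (3 * k + L.length + 1), PowerSeries.coeff k (u n L), fun M L k hk => ?_⟩
  rw [Pi.sub_apply, map_sub, PowerSeries.coeff_mk, Finset.sum_apply, map_sum, sub_eq_zero]
  refine Finset.sum_subset (Finset.range_mono (by omega)) fun n _ hn => ?_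
  rw [Finset.mem_range, not_lt] at hn
  exact hu n L k (by omega)

theorem summable_of_fil {u : ℕ → SuperSeries (PowerSeries ℂ) V} (hu : ∀ n, u n ∈ Fil V n) :
    Summable u :=
  let ⟨_, hs⟩ := exists_sum_of_fil hu
  (hasSum_of_fil hu hs).summable

theorem tsum_sub_mem_fil {u : ℕ → SuperSeries (PowerSeries ℂ) V} (hu : ∀ n, u n ∈ Fil V n)
    (M : ℕ) : (∑' n, u n) - ∑ n ∈ Finset.range M, u n ∈ Fil V M := by
  obtain ⟨s, hs⟩ := exists_sum_of_fil hu
  rw [(hasSum_of_fil hu hs).tsum_eq]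
  exact hs M

/-- A symmetry relation compares two coefficients on lists of equal length, hence of equal
filtration degree; it is inherited from any sufficiently close approximation. -/
theorem gradedSymm_of_fil {s : SuperSeries (PowerSeries ℂ) V}
    (h : ∀ M, ∃ f, GradedSymm g f ∧ s - f ∈ Fil V M) : GradedSymm g s := by
  intro L₁ v w L₂
  ext k
  obtain ⟨f, hf, hs⟩ := h (3 * k + (L₁ ++ v :: w :: L₂).length + 1)
  have h1 := hs (L₁ ++ v :: w :: L₂) k (by omega)
  have h2 := hs (L₁ ++ w :: v :: L₂) k (by
    simp only [List.length_append, List.length_cons]; omega)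
  rw [Pi.sub_apply, map_sub, sub_eq_zero] at h1 h2
  rw [h1, Units.smul_def, map_zsmul, h2, ← map_zsmul, ← Units.smul_def, hf L₁ v w L₂]

theorem gradedSymm_tsum {u : ℕ → SuperSeries (PowerSeries ℂ) V} (hu : ∀ n, u n ∈ Fil V n)
    (hg : ∀ n, GradedSymm g (u n)) : GradedSymm g (∑' n, u n) :=
  gradedSymm_of_fil fun M => ⟨_, GradedSymm.sum fun n _ => hg n, tsum_sub_mem_fil hu M⟩

/-- The operator `X` raises the filtration by `r`. -/
def Raises (r : ℕ) (X : SuperSeries (PowerSeries ℂ) V →ₗ[ℂ] SuperSeries (PowerSeries ℂ) W) :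
    Prop := ∀ m f, f ∈ Fil V m → X f ∈ Fil W (m + r)

theorem Raises.iterate {X : SuperSeries (PowerSeries ℂ) V →ₗ[ℂ] SuperSeries (PowerSeries ℂ) V}
    (hX : Raises 1 X) (f : SuperSeries (PowerSeries ℂ) V) (n : ℕ) : X^[n] f ∈ Fil V n := by
  induction n with
  | zero => exact mem_fil_zero _
  | succ n ih => rw [Function.iterate_succ_apply']; exact hX n _ ih

/-- The difference of two solutions is a fixed point of X, hence lies in every step of the
filtration. This uniqueness replaces all rearrangements of perturbation series. -/
theorem Raises.eq_of_eq {X : SuperSeries (PowerSeries ℂ) V →ₗ[ℂ] SuperSeries (PowerSeries ℂ) V}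
    (hX : Raises 1 X) {f r s : SuperSeries (PowerSeries ℂ) V} (hr : r = f + X r)
    (hs : s = f + X s) : r = s := by
  refine eq_of_sub_mem_fil fun m => ?_
  induction m with
  | zero => exact mem_fil_zero _
  | succ m ih =>
    have : r - s = X (r - s) := by
      rw [map_sub]
      nth_rewrite 1 [hr, hs]
      abel
    rw [this]
    exact hX m _ ih

theorem Raises.tsum_eq {X : SuperSeries (PowerSeries ℂ) V →ₗ[ℂ] SuperSeries (PowerSeries ℂ) V}
    (hX : Raises 1 X) (f : SuperSeries (PowerSeries ℂ) V) :
    ∑' n, X^[n] f = f + X (∑' n, X^[n] f) := by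
  refine eq_of_sub_mem_fil fun m => ?_
  refine fil_anti (Nat.le_succ m) ?_
  have h1 := tsum_sub_mem_fil (hX.iterate f) (m + 1)
  have h2 := hX m _ (tsum_sub_mem_fil (hX.iterate f) m)
  rw [Finset.sum_range_succ'] at h1
  simp only [Function.iterate_succ_apply', Function.iterate_zero, id] at h1
  rw [map_sub, map_sum] at h2
  convert (Fil V (m + 1)).sub_mem h1 h2 using 1
  abel

/-- The inverse of `1 - X`. -/
def resolvent (X : SuperSeries (PowerSeries ℂ) V →ₗ[ℂ] SuperSeries (PowerSeries ℂ) V)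
    (hX : Raises 1 X) : SuperSeries (PowerSeries ℂ) V →ₗ[ℂ] SuperSeries (PowerSeries ℂ) V where
  toFun f := ∑' n, X^[n] f
  -- Linearity follows from uniqueness of the solution of r = f + X r rather than from manipulating
  -- the series.
  map_add' f h := by
    refine hX.eq_of_eq (hX.tsum_eq _) ?_
    nth_rewrite 1 [hX.tsum_eq f, hX.tsum_eq h]
    rw [map_add]; abel
  map_smul' c f := by
    refine hX.eq_of_eq (hX.tsum_eq _) ?_
    rw [RingHom.id_apply, map_smul, ← smul_add, ← hX.tsum_eq f]

theorem resolvent_apply {X : SuperSeries (PowerSeries ℂ) V →ₗ[ℂ] SuperSeries (PowerSeries ℂ) V}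
    (hX : Raises 1 X) (f : SuperSeries (PowerSeries ℂ) V) :
    resolvent X hX f = ∑' n, X^[n] f := rfl

theorem resolvent_eq {X : SuperSeries (PowerSeries ℂ) V →ₗ[ℂ] SuperSeries (PowerSeries ℂ) V}
    (hX : Raises 1 X) (f : SuperSeries (PowerSeries ℂ) V) :
    resolvent X hX f = f + X (resolvent X hX f) := hX.tsum_eq f

/-- The equation r = f + X r lifts r by one step at a time, as long as f allows it. -/
theorem raises_resolvent {X : SuperSeries (PowerSeries ℂ) V →ₗ[ℂ] SuperSeries (PowerSeries ℂ) V}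
    (hX : Raises 1 X) : Raises 0 (resolvent X hX) := by
  intro m f hf
  have : ∀ j ≤ m, resolvent X hX f ∈ Fil V j := by
    intro j
    induction j with
    | zero => exact fun _ => mem_fil_zero _
    | succ j ih =>
      intro hj
      rw [resolvent_eq]
      exact (Fil V (j + 1)).add_mem (fil_anti hj hf) (hX j _ (ih (by omega)))
  exact this m le_rfl

theorem gradedSymm_resolvent
    {X : SuperSeries (PowerSeries ℂ) V →ₗ[ℂ] SuperSeries (PowerSeries ℂ) V}
    (hX : Raises 1 X) (hg : ∀ f, GradedSymm g f → GradedSymm g (X f))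
    {f : SuperSeries (PowerSeries ℂ) V} (hf : GradedSymm g f) :
    GradedSymm g (resolvent X hX f) := by
  refine gradedSymm_tsum (hX.iterate f) fun n => ?_
  induction n with
  | zero => exact hf
  | succ n ih => rw [Function.iterate_succ_apply']; exact hg _ ih

theorem Raises.comp {U : Type*} {r s t : ℕ}
    {X : SuperSeries (PowerSeries ℂ) W →ₗ[ℂ] SuperSeries (PowerSeries ℂ) U}
    {Y : SuperSeries (PowerSeries ℂ) V →ₗ[ℂ] SuperSeries (PowerSeries ℂ) W}
    (hX : Raises r X) (hY : Raises s Y) (h : s + r = t) : Raises t (X ∘ₗ Y) := by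
  intro m f hf
  have := hX _ _ (hY m f hf)
  rwa [add_assoc, h] at this

theorem Raises.neg {r : ℕ}
    {X : SuperSeries (PowerSeries ℂ) V →ₗ[ℂ] SuperSeries (PowerSeries ℂ) W} (hX : Raises r X) :
    Raises r (-X) := fun m f hf => (Fil W _).neg_mem (hX m f hf)

theorem Raises.add {r : ℕ}
    {X Y : SuperSeries (PowerSeries ℂ) V →ₗ[ℂ] SuperSeries (PowerSeries ℂ) W} (hX : Raises r X)
    (hY : Raises r Y) : Raises r (X + Y) := fun m f hf => (Fil W _).add_mem (hX m f hf) (hY m f hf)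

/-! Homological perturbation series of filtered operators -/

variable {K δ : SuperSeries (PowerSeries ℂ) V →ₗ[ℂ] SuperSeries (PowerSeries ℂ) V}
  (hK : Raises 0 K) (hδ : Raises 1 δ)

include hK hδ

theorem raises_neg_comp : Raises 1 (-(K ∘ₗ δ)) := (hK.comp hδ rfl).neg

theorem raises_neg_comp' : Raises 1 (-(δ ∘ₗ K)) := (hδ.comp hK rfl).neg

theorem summable_hplITerm {U : Type*} (i : U → SuperSeries (PowerSeries ℂ) V) (f : U) :
    Summable (hplITerm K δ i f) :=
  summable_of_fil ((raises_neg_comp hK hδ).iterate (i f))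

theorem hplPTerm_mem_fil {p : SuperSeries (PowerSeries ℂ) V →ₗ[ℂ] SuperSeries (PowerSeries ℂ) W}
    (hp : Raises 0 p) (f : SuperSeries (PowerSeries ℂ) V) (k : ℕ) :
    hplPTerm K δ p f k ∈ Fil W k := hp _ _ ((raises_neg_comp' hK hδ).iterate f k)

theorem summable_hplPTerm {p : SuperSeries (PowerSeries ℂ) V →ₗ[ℂ] SuperSeries (PowerSeries ℂ) W}
    (hp : Raises 0 p) (f : SuperSeries (PowerSeries ℂ) V) : Summable (hplPTerm K δ p f) :=
  summable_of_fil (hplPTerm_mem_fil hK hδ hp f)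

/-- No continuity of p is needed to pull it out of the sum: it respects the filtration, so it
matches the tails on both sides. -/
theorem tsum_hplPTerm {p : SuperSeries (PowerSeries ℂ) V →ₗ[ℂ] SuperSeries (PowerSeries ℂ) W}
    (hp : Raises 0 p) (f : SuperSeries (PowerSeries ℂ) V) :
    ∑' k, hplPTerm K δ p f k = p (resolvent _ (raises_neg_comp' hK hδ) f) := by
  refine eq_of_sub_mem_fil fun m => ?_
  have h1 := tsum_sub_mem_fil (hplPTerm_mem_fil hK hδ hp f) m
  have h2 := hp m _ (tsum_sub_mem_fil ((raises_neg_comp' hK hδ).iterate f) m)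
  rw [map_sub, map_sum] at h2
  convert (Fil W m).sub_mem h1 h2 using 1
  have : ∀ n, hplPTerm K δ p f n = p ((⇑(-(δ ∘ₗ K)))^[n] f) := fun n => rfl
  simp only [this, resolvent_apply]
  abel

end Resolvent

end SuperSeries

/-! ### The free action, the bracket and the BV Laplacian -/

namespace SuperSeries

section Bracket

variable {R V : Type*} [CommRing R] [Algebra ℂ R] [Fintype V] {g : V → ℤ} {w : V → V → ℂ}

theorem pderiv_freeAction [DecidableEq V] (ω d : Matrix V V ℂ) (m : V) :
    pderiv m (freeAction g ω d) = (1 / 2 : ℂ) • ∑ i, ((ω * d) i m • coord i +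
      (g m * g i).negOnePow • (ω * d) m i • coord i) := by
  have h : freeAction g ω d = (1 / 2 : ℂ) • ∑ i, ∑ k, (ω * d) i k • mul g (coord k) (coord i) := by
    simp only [freeAction, Matrix.mul_apply, Finset.sum_smul]
    congr 1
    exact Finset.sum_congr rfl fun i _ => Finset.sum_comm
  have h1 : ∀ i k, pderiv m (mul g (coord k) (coord i)) =
      mul g (pderiv m (coord k)) (coord i) +
        (g m * g k).negOnePow • mul g (coord k) (pderiv m (coord i : SuperSeries ℂ V)) := by
    intro i k
    rw [pderiv_mul, (homog_coord k).twist, smul_mul]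
  rw [h, pderiv_smul, pderiv_sum]
  simp only [pderiv_sum, pderiv_smul, h1, smul_add, Finset.sum_add_distrib]
  have e1 : ∀ i, ∑ k, (ω * d) i k • mul g (pderiv m (coord k)) (coord i : SuperSeries ℂ V) =
      (ω * d) i m • coord i := by
    intro i
    refine (Finset.sum_eq_single m (fun k _ hk => ?_) (fun h => absurd (Finset.mem_univ _) h)).trans
      ?_
    · rw [pderiv_coord_ne hk.symm, zero_mul, smul_zero]
    · rw [pderiv_coord_self, one_mul]
  have e2 : ∀ k, ∑ i, (ω * d) i k • (g m * g k).negOnePow •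
      mul g (coord k) (pderiv m (coord i : SuperSeries ℂ V)) =
      (g m * g k).negOnePow • (ω * d) m k • coord k := by
    intro k
    refine (Finset.sum_eq_single m (fun i _ hi => ?_) (fun h => absurd (Finset.mem_univ _) h)).trans
      ?_
    · rw [pderiv_coord_ne hi.symm, mul_zero, smul_zero, smul_zero]
    · rw [pderiv_coord_self, mul_one, smul_comm]
  refine congrArg₂ (fun x y : SuperSeries ℂ V => (1 / 2 : ℂ) • x + (1 / 2 : ℂ) • y) ?_ ?_
  · exact Finset.sum_congr rfl fun i _ => e1 i
  · rw [Finset.sum_comm]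
    exact Finset.sum_congr rfl fun i _ => e2 i

theorem bracket_add_right (f h k : SuperSeries R V) :
    bracket g w f (h + k) = bracket g w f h + bracket g w f k := by
  simp only [bracket, pderiv_add, mul_add, smul_add, Finset.sum_add_distrib]

theorem rpderiv_add (v : V) (f h : SuperSeries R V) :
    rpderiv g v (f + h) = rpderiv g v f + rpderiv g v h := by
  simp only [rpderiv, pderiv_add, twist_add]

theorem bracket_add_left (f h k : SuperSeries R V) :
    bracket g w (f + h) k = bracket g w f k + bracket g w h k := by
  simp only [bracket, rpderiv_add, add_mul, smul_add, Finset.sum_add_distrib]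

theorem bracket_smul_right (c : ℂ) (f h : SuperSeries R V) :
    bracket g w f (c • h) = c • bracket g w f h := by
  unfold bracket
  rw [Finset.smul_sum]
  refine Finset.sum_congr rfl fun k _ => ?_
  rw [Finset.smul_sum]
  refine Finset.sum_congr rfl fun j _ => ?_
  rw [pderiv_smul, mul_smul, smul_comm]

theorem GradedSymm.bracket {f h : SuperSeries R V} (hf : GradedSymm g f) (hh : GradedSymm g h) :
    GradedSymm g (bracket g w f h) :=
  GradedSymm.sum fun i _ => GradedSymm.sum fun j _ =>
    (GradedSymm.mul (hf.rpderiv i) (hh.pderiv j)).smul (w i j)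

theorem laplacian_add (f h : SuperSeries R V) :
    laplacian g w (f + h) = laplacian g w f + laplacian g w h := by
  simp only [laplacian, pderiv_add, smul_add, Finset.sum_add_distrib]

theorem laplacian_smul (c : ℂ) (f : SuperSeries R V) :
    laplacian g w (c • f) = c • laplacian g w f := by
  unfold laplacian
  rw [smul_comm c]
  refine congrArg (fun x => (1 / 2 : ℂ) • x) ?_
  rw [Finset.smul_sum]
  refine Finset.sum_congr rfl fun k _ => ?_
  rw [Finset.smul_sum]
  refine Finset.sum_congr rfl fun j _ => ?_
  rw [pderiv_smul, pderiv_smul, smul_comm c, smul_comm c]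

theorem GradedSymm.laplacian {f : SuperSeries R V} (hf : GradedSymm g f) :
    GradedSymm g (laplacian g w f) :=
  GradedSymm.smul (GradedSymm.sum fun i _ => GradedSymm.sum fun j _ =>
    (((hf.pderiv j).pderiv i).smul (w i j)).smul ((g i).negOnePow)) _

end Bracket

end SuperSeries

namespace BVTheory

variable {I I' : Type*} [Fintype I] [DecidableEq I] [Fintype I'] [DecidableEq I']
variable (τ : BVTheory I I')

theorem ωd_deg (i k : I) (h : (τ.ω * τ.d) i k ≠ 0) : τ.gh i + τ.gh k = 0 := by
  rw [Matrix.mul_apply] at h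
  obtain ⟨j, -, hj⟩ := Finset.exists_ne_zero_of_sum_ne_zero h
  have h1 := τ.ω_deg _ _ (left_ne_zero_of_mul hj)
  have h2 := τ.d_deg _ _ (right_ne_zero_of_mul hj)
  omega

/-- Compatibility of d with ω makes the two terms of the product rule equal, which cancels the
factor ½; the remaining sign is undone by passing to the right derivative. -/
theorem rpderiv_freeAction (m : I) :
    rpderiv τ.gh m (freeAction τ.gh τ.ω τ.d) = ∑ i, (τ.ω * τ.d) m i • coord i := by
  have h : ∀ i, (τ.ω * τ.d) i m • (coord i : SuperSeries ℂ I) +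
      (τ.gh m * τ.gh i).negOnePow • (τ.ω * τ.d) m i • coord i =
      (2 : ℂ) • (τ.gh m * τ.gh i).negOnePow • (τ.ω * τ.d) m i • coord i := by
    intro i
    rw [two_smul]
    congr 1
    by_cases h0 : (τ.ω * τ.d) m i = 0
    · rw [τ.d_ω i m, h0]; simp
    · have h1 := τ.ωd_deg _ _ h0
      -- Nonzero entries of ωd pair opposite degrees, for which the sign of `d_ω` is the Koszul
      -- sign.
      rw [τ.d_ω i m, smul_assoc]
      congr 1
      apply negOnePow_congr
      have : τ.gh m = - τ.gh i := by omega
      rw [this]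
      simp only [Int.even_sub, Int.even_mul, even_neg]; tauto
  rw [rpderiv, pderiv_freeAction, twist_smul]
  simp only [h, twist_sum, twist_smul, (homog_coord _).twist, smul_smul, ← Finset.smul_sum]
  rw [show (1 / 2 : ℂ) * 2 = 1 by norm_num, one_smul]
  refine Finset.sum_congr rfl fun i _ => ?_
  rw [smul_comm _ ((τ.ω * τ.d) m i), smul_smul, Int.units_mul_self, one_smul]

theorem sum_w_ωd (j k : I) : ∑ i, τ.w i j * (τ.ω * τ.d) i k = τ.d j k := by
  have : τ.ω⁻¹ * (τ.ω * τ.d) = τ.d := by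
    rw [← Matrix.mul_assoc, Matrix.nonsing_inv_mul _ τ.ω_nondeg, Matrix.one_mul]
  have := congrFun (congrFun this j) k
  rwa [Matrix.mul_apply] at this

/-- The inverse pairing in the bracket undoes the ω in the derivative of S₀, so {S₀, -} is the
derivation extending the transpose of d. -/
theorem bracket_freeAction {R : Type*} [CommRing R] [Algebra ℂ R] (f : SuperSeries R I) :
    bracket τ.gh τ.w (lift R (freeAction τ.gh τ.ω τ.d)) f = linDer τ.gh τ.d f := by
  simp only [bracket, ← lift_rpderiv, rpderiv_freeAction, lift_sum, lift_smul, lift_coord,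
    sum_mul, smul_mul, Finset.smul_sum, smul_smul]
  unfold linDer
  rw [Finset.sum_comm' (t' := Finset.univ) (s' := fun _ => Finset.univ) (by simp)]
  calc _ = ∑ j, ∑ k, ∑ i, (τ.w i j * (τ.ω * τ.d) i k) • mul τ.gh (coord k) (pderiv j f) :=
        Finset.sum_congr rfl fun j _ => Finset.sum_comm
    _ = _ := by
        simp only [← Finset.sum_smul, sum_w_ωd]
        exact Finset.sum_comm

/-! The operators as linear maps -/

/-- `κ̂` as a linear map. -/
def κₗ : τ.Fun →ₗ[ℂ] τ.Fun := linDerₗ τ.gh τ.κ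

/-- The free classical differential as a linear map. -/
def dₗ : τ.Fun →ₗ[ℂ] τ.Fun := linDerₗ τ.gh τ.d

/-- The counting operator of `F''` as a linear map. -/
def Nₗ : τ.Fun →ₗ[ℂ] τ.Fun := linDerₗ τ.gh τ.P''

/-- `Q_int` as a linear map. -/
def Qintₗ : τ.Fun →ₗ[ℂ] τ.Fun where
  toFun := τ.Qint
  map_add' := bracket_add_right _
  map_smul' := fun c f => bracket_smul_right c _ f

/-- `-iħΔ` as a linear map. -/
def quantumₗ : τ.Fun →ₗ[ℂ] τ.Fun where
  toFun := τ.quantumPart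
  map_add' f h := by simp only [quantumPart, Δ, laplacian_add, smul_add]
  map_smul' c f := by
    simp only [quantumPart, Δ, laplacian_smul, RingHom.id_apply]
    rw [smul_comm]

/-- `π^*` as a linear map. -/
def iₗ : τ.Fun' →ₗ[ℂ] τ.Fun where
  toFun := τ.i
  map_add' := pullback_add _
  map_smul' := pullback_smul _

/-- `ι^*` as a linear map. -/
def pₗ : τ.Fun →ₗ[ℂ] τ.Fun' where
  toFun := τ.p
  map_add' := pullback_add _
  map_smul' := pullback_smul _

/-- `ν` as a linear map. -/
def νₗ : τ.Fun →ₗ[ℂ] τ.Fun where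
  toFun := τ.ν
  map_add' f h := by
    funext L
    have := fun N => congrFun (τ.uv_add N f h) L
    simp only [uv, Pi.add_apply] at this
    simp only [ν, Pi.add_apply, this, smul_add, Finset.sum_add_distrib]
  map_smul' c f := by
    funext L
    have := fun N => congrFun (τ.uv_smul N c f) L
    simp only [uv, Pi.smul_apply] at this
    simp only [ν, Pi.smul_apply, this, RingHom.id_apply, Finset.smul_sum]
    exact Finset.sum_congr rfl fun _ _ => smul_comm _ _ _

/-- `K` as a linear map. -/
def Kₗ : τ.Fun →ₗ[ℂ] τ.Fun := τ.νₗ ∘ₗ τ.κₗ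

/-- The perturbation `Q_int - iħΔ` of the free classical differential. -/
def δₗ : τ.Fun →ₗ[ℂ] τ.Fun := τ.Qintₗ + τ.quantumₗ

/-- `H` as a linear map. -/
def Hₗ : τ.Fun →ₗ[ℂ] τ.Fun := (τ.dₗ + τ.δₗ) ∘ₗ τ.κₗ + τ.κₗ ∘ₗ (τ.dₗ + τ.δₗ)

theorem Qħ_eq (f : τ.Fun) : τ.Qħ f = τ.dₗ f + τ.δₗ f := by
  rw [Qħ, S, lift_add, bracket_add_left, bracket_freeAction, add_assoc]
  rfl

theorem H_eq (f : τ.Fun) : τ.H f = τ.Hₗ f := by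
  rw [H, Qħ_eq, Qħ_eq]; rfl

/-! Filtration -/

theorem raises_κ : Raises 0 τ.κₗ := fun m f hf => linDer_mem_fil hf _
theorem raises_d : Raises 0 τ.dₗ := fun m f hf => linDer_mem_fil hf _
theorem raises_N : Raises 0 τ.Nₗ := fun m f hf => linDer_mem_fil hf _
theorem raises_i : Raises 0 τ.iₗ := fun m f hf => pullback_mem_fil hf _
theorem raises_p : Raises 0 τ.pₗ := fun m f hf => pullback_mem_fil hf _

theorem raises_ν : Raises 0 τ.νₗ := by
  intro m f hf L k hk
  change PowerSeries.coeff k (∑ N ∈ Finset.Icc 1 L.length, ((N : ℂ)⁻¹) • τ.uv N f L) = 0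
  rw [map_sum]
  refine Finset.sum_eq_zero fun N _ => ?_
  rw [map_smul, τ.uv_mem_fil hf N L k hk, smul_zero]

theorem raises_K : Raises 0 τ.Kₗ := τ.raises_ν.comp τ.raises_κ rfl

/-- The derivative of S_int starts in order 2 and the derivative of f costs 1, a net gain of 1. -/
theorem raises_Qint : Raises 1 τ.Qintₗ := fun m f hf =>
  Submodule.sum_mem _ fun i _ => Submodule.sum_mem _ fun j _ => Submodule.smul_mem _ _
    (mul_mem_fil (rpderiv_mem_fil (lift_mem_fil τ.Sint_order) (m' := 2) (by omega) i)
      (pderiv_mem_fil hf (m' := m - 1) (by omega) j) (by omega))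

/-- Two derivatives lose 2 and ħ gains 3. The truncated subtraction m - 2 is harmless, as m + 1 ≤ (m
- 2) + 3 always. -/
theorem raises_quantum : Raises 1 τ.quantumₗ := fun m f hf =>
  negIHbar_smul_mem_fil (m := m - 2) (Submodule.smul_mem _ _ (Submodule.sum_mem _ fun i _ =>
    Submodule.sum_mem _ fun j _ => units_smul_mem_fil _ (Submodule.smul_mem _ _
      (pderiv_mem_fil (pderiv_mem_fil hf (m' := m - 1) (by omega) j) (by omega) i)))) (by omega)

theorem raises_δ : Raises 1 τ.δₗ := τ.raises_Qint.add τ.raises_quantum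

/-! Graded symmetry -/

section Symm

variable {τ} {f : τ.Fun} (hf : GradedSymm τ.gh f)

include hf

theorem symm_κ : GradedSymm τ.gh (τ.κₗ f) := hf.linDer _
theorem symm_d : GradedSymm τ.gh (τ.dₗ f) := hf.linDer _
theorem symm_N : GradedSymm τ.gh (τ.Nₗ f) := hf.linDer _

theorem symm_Qint : GradedSymm τ.gh (τ.Qintₗ f) := (τ.Sint_symm.lift).bracket hf

theorem symm_quantum : GradedSymm τ.gh (τ.quantumₗ f) := hf.laplacian.smul negIHbar

theorem symm_δ : GradedSymm τ.gh (τ.δₗ f) := (symm_Qint hf).add (symm_quantum hf)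

theorem symm_ν : GradedSymm τ.gh (τ.νₗ f) := by
  intro L₁ v w L₂
  have h := fun N => τ.gradedSymm_uv hf N L₁ v w L₂
  change (∑ N ∈ Finset.Icc (1 : ℕ) _, ((N : ℂ)⁻¹) • τ.uv N f _) =
    _ • (∑ N ∈ Finset.Icc (1 : ℕ) _, ((N : ℂ)⁻¹) • τ.uv N f _)
  simp only [h, Finset.smul_sum, List.length_append, List.length_cons]
  exact Finset.sum_congr rfl fun N _ => smul_comm _ _ _

theorem symm_K : GradedSymm τ.gh (τ.Kₗ f) := symm_ν (symm_κ hf)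

theorem symm_H : GradedSymm τ.gh (τ.Hₗ f) :=
  ((symm_d (symm_κ hf)).add (symm_δ (symm_κ hf))).add
    (symm_κ ((symm_d hf).add (symm_δ hf)))

theorem symm_p : GradedSymm τ.gh' (τ.pₗ f) :=
  hf.pullback fun i a h => τ.ι_deg i a h

end Symm

theorem symm_i {f : τ.Fun'} (hf : GradedSymm τ.gh' f) : GradedSymm τ.gh (τ.iₗ f) :=
  hf.pullback fun a i h => τ.π_deg a i h

/-! Relations of the free theory -/

theorem κ_deg' (j k : I) (h : τ.κ j k ≠ 0) : τ.gh j = τ.gh k + 1 := τ.κ_deg j k h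

theorem linDer_zero_matrix (f : τ.Fun) : linDer τ.gh (fun _ _ => 0) f = 0 := by
  simp [linDer]

/-- Twice κ̂² is the derivation of the matrix 2κ² = 0. -/
theorem κ_κ {f : τ.Fun} (hf : GradedSymm τ.gh f) : τ.κₗ (τ.κₗ f) = 0 := by
  have h := linDer_anticomm (A := fun i j => τ.κ i j) (B := fun i j => τ.κ i j) τ.κ_deg' τ.κ_deg'
    odd_one odd_one hf
  have h2 : (fun i k => ∑ j, (τ.κ i j * τ.κ j k + τ.κ i j * τ.κ j k)) =
      (fun _ _ => (0 : ℂ)) := by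
    funext i k
    have := congrFun (congrFun τ.κ_sq i) k
    rw [Matrix.mul_apply] at this
    rw [Finset.sum_add_distrib, this]; simp
  rw [h2, linDer_zero_matrix, ← two_smul ℂ] at h
  exact (smul_eq_zero.1 h).resolve_left two_ne_zero

/-- Transports dκ + κd = 1 - ιπ to functions; it identifies the classical free part of H with the
counting operator of F''. -/
theorem d_κ_add {f : τ.Fun} (hf : GradedSymm τ.gh f) :
    τ.dₗ (τ.κₗ f) + τ.κₗ (τ.dₗ f) = τ.Nₗ f := by
  have h := linDer_anticomm (A := fun i j => τ.d i j) (B := fun i j => τ.κ i j)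
    (fun j k h => by simpa [sub_eq_add_neg] using τ.d_deg j k h) τ.κ_deg'
    (a := -1) (by decide) odd_one hf
  have h2 : (fun i k => ∑ j, (τ.κ i j * τ.d j k + τ.d i j * τ.κ j k)) = τ.P'' := by
    funext i k
    have := congrFun (congrFun τ.homotopy i) k
    rw [Matrix.add_apply, Matrix.mul_apply, Matrix.mul_apply] at this
    rw [Finset.sum_add_distrib, add_comm, this]
  rw [h2] at h
  exact h

theorem κ_uv {f : τ.Fun} (hf : GradedSymm τ.gh f) (N : ℕ) :
    τ.κₗ (τ.uv N f) = τ.uv N (τ.κₗ f) := by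
  have h1 : τ.κ * (τ.ι * τ.π) = 0 := by rw [← Matrix.mul_assoc, τ.κ_ι, Matrix.zero_mul]
  have h2 : (τ.ι * τ.π) * τ.κ = 0 := by rw [Matrix.mul_assoc, τ.π_κ, Matrix.mul_zero]
  have e1 : (1 - τ.ι * τ.π) * τ.κ = τ.κ := by rw [Matrix.sub_mul, h2, Matrix.one_mul, sub_zero]
  have e2 : τ.κ * (1 - τ.ι * τ.π) = τ.κ := by rw [Matrix.mul_sub, h1, Matrix.mul_one, sub_zero]
  refine τ.linDer_uv (B := fun i j => τ.κ i j) τ.κ_deg' ?_ ?_ ?_ ?_ hf N <;> intro i v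
  · have := congrFun (congrFun h1 i) v
    rwa [Matrix.mul_apply] at this
  · have := congrFun (congrFun h2 i) v
    rwa [Matrix.mul_apply] at this
  · have := congrFun (congrFun e2 i) v
    rwa [Matrix.mul_apply] at this
  · have := congrFun (congrFun e1 i) v
    rwa [Matrix.mul_apply] at this

theorem P''_mul_P' (i v : I) : ∑ j, τ.P'' i j * τ.P' j v = 0 := by
  have : (1 - τ.ι * τ.π) * (τ.ι * τ.π) = 0 := by
    rw [Matrix.sub_mul, ιπ_sq, Matrix.one_mul, sub_self]
  have := congrFun (congrFun this i) v
  rwa [Matrix.mul_apply] at this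

theorem N_uv {f : τ.Fun} (hf : GradedSymm τ.gh f) (N : ℕ) :
    τ.Nₗ (τ.uv N f) = (N : ℂ) • τ.uv N f := τ.linDer_P''_uv hf N

theorem uv_N {f : τ.Fun} (hf : GradedSymm τ.gh f) (N : ℕ) :
    τ.uv N (τ.Nₗ f) = (N : ℂ) • τ.uv N f := by
  rw [← τ.N_uv hf]
  exact (τ.linDer_uv τ.P''_deg τ.P''_mul_P' τ.P'_mul_P'' τ.P''_mul_P'' τ.P''_mul_P'' hf N).symm

/-- The truncation of `ν` to a fixed degree. -/
theorem ν_sub_mem_fil (f : τ.Fun) (M : ℕ) :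
    τ.νₗ f - ∑ N ∈ Finset.Icc 1 M, ((N : ℂ)⁻¹) • τ.uv N f ∈ Fil I (M + 1) := by
  intro L k hk
  -- The components of degree up to N and those of degree up to N - 1 both sum to f on such a short
  -- list, so the N-th one vanishes there.
  have : ∀ N, L.length < N → τ.uv N f L = 0 := by
    intro N hN
    have h1 := τ.sum_uv f L N (by omega)
    have h2 := τ.sum_uv f L (N - 1) (by omega)
    obtain ⟨n, rfl⟩ : ∃ n, N = n + 1 := ⟨N - 1, by omega⟩
    rw [Finset.sum_range_succ] at h1
    rw [Nat.add_sub_cancel] at h2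
    rw [h2] at h1
    simpa using h1
  rw [Pi.sub_apply, Finset.sum_apply]
  change PowerSeries.coeff k ((∑ N ∈ Finset.Icc 1 L.length, ((N : ℂ)⁻¹) • τ.uv N f L) - _) = 0
  rw [Finset.sum_subset (Finset.Icc_subset_Icc_right (show L.length ≤ M by omega))]
  · simp
  · intro N hN hN'
    rw [Finset.mem_Icc] at hN hN'
    rw [this N (by omega), smul_zero]

theorem sum_uv_sub_mem_fil (f : τ.Fun) (M : ℕ) :
    f - ∑ N ∈ Finset.range (M + 1), τ.uv N f ∈ Fil I (M + 1) := by
  intro L k hk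
  rw [Pi.sub_apply, Finset.sum_apply, τ.sum_uv f L M (by omega)]
  simp

theorem sum_Icc_uv (f : τ.Fun) (M : ℕ) :
    ∑ N ∈ Finset.Icc 1 M, τ.uv N f = ∑ N ∈ Finset.range (M + 1), τ.uv N f - τ.iₗ (τ.pₗ f) := by
  rw [Finset.range_eq_Ico, Finset.sum_eq_sum_Ico_succ_bot (by omega), uv_zero_eq]
  have : Finset.Icc 1 M = Finset.Ico (0 + 1) (M + 1) := by ext; simp
  rw [this]
  exact (add_sub_cancel_left _ _).symm

/-- On the component of degree N ≥ 1 the two operators multiply by N and 1/N; the component of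
degree 0, which is π^*ι^*f, is lost. The infinite sum in ν is handled modulo each step of the
filtration. -/
theorem N_ν {f : τ.Fun} (hf : GradedSymm τ.gh f) : τ.Nₗ (τ.νₗ f) = f - τ.iₗ (τ.pₗ f) := by
  refine eq_of_sub_mem_fil fun m => fil_anti (Nat.le_succ m) ?_
  have h1 := τ.raises_N _ _ (τ.ν_sub_mem_fil f m)
  have h2 := τ.sum_uv_sub_mem_fil f m
  have e : τ.Nₗ (∑ N ∈ Finset.Icc 1 m, ((N : ℂ)⁻¹) • τ.uv N f) =
      ∑ N ∈ Finset.Icc 1 m, τ.uv N f := by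
    rw [map_sum]
    refine Finset.sum_congr rfl fun N hN => ?_
    rw [Finset.mem_Icc] at hN
    rw [map_smul, τ.N_uv hf, smul_smul, inv_mul_cancel₀ (by exact_mod_cast (by omega)), one_smul]
  rw [map_sub, e, sum_Icc_uv] at h1
  convert (Fil I (m + 1)).sub_mem h1 h2 using 1
  abel

theorem ν_N {f : τ.Fun} (hf : GradedSymm τ.gh f) : τ.νₗ (τ.Nₗ f) = f - τ.iₗ (τ.pₗ f) := by
  refine eq_of_sub_mem_fil fun m => fil_anti (Nat.le_succ m) ?_
  have h1 := τ.ν_sub_mem_fil (τ.Nₗ f) m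
  have h2 := τ.sum_uv_sub_mem_fil f m
  have e : ∑ N ∈ Finset.Icc 1 m, ((N : ℂ)⁻¹) • τ.uv N (τ.Nₗ f) =
      ∑ N ∈ Finset.Icc 1 m, τ.uv N f := by
    refine Finset.sum_congr rfl fun N hN => ?_
    rw [Finset.mem_Icc] at hN
    rw [τ.uv_N hf, smul_smul, inv_mul_cancel₀ (by exact_mod_cast (by omega)), one_smul]
  rw [e, sum_Icc_uv] at h1
  convert (Fil I (m + 1)).sub_mem h1 h2 using 1
  abel

theorem κ_ν {f : τ.Fun} (hf : GradedSymm τ.gh f) : τ.κₗ (τ.νₗ f) = τ.νₗ (τ.κₗ f) := by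
  refine eq_of_sub_mem_fil fun m => fil_anti (Nat.le_succ m) ?_
  have h1 := τ.raises_κ _ _ (τ.ν_sub_mem_fil f m)
  have h2 := τ.ν_sub_mem_fil (τ.κₗ f) m
  rw [map_sub, map_sum] at h1
  simp only [map_smul, τ.κ_uv hf] at h1
  convert (Fil I (m + 1)).sub_mem h1 h2 using 1
  abel

theorem pullback_ι_cons (f : τ.Fun) (a : I') (L : List I') :
    τ.pₗ f (a :: L) = ∑ j, τ.ι j a • τ.pₗ (pderiv j f) L := rfl

/-- A function with an argument in F'' vanishes on the image of ι, because (1 - ιπ)ι = 0. -/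
theorem p_uv_succ (f : τ.Fun) (N : ℕ) : τ.pₗ (τ.uv (N + 1) f) = 0 := by
  have hι : ∀ a j, ∑ v, τ.P'' j v * τ.ι v a = 0 := by
    intro a j
    have : (1 - τ.ι * τ.π) * τ.ι = 0 := by
      rw [Matrix.sub_mul, Matrix.mul_assoc, τ.π_ι, Matrix.mul_one, Matrix.one_mul, sub_self]
    have := congrFun (congrFun this j) a
    rwa [Matrix.mul_apply] at this
  funext L
  induction L generalizing f N with
  | nil => rfl
  | cons a L ih =>
    rw [pullback_ι_cons]
    simp only [pderiv_uv, map_add, map_sum, map_smul, Pi.add_apply, Finset.sum_apply,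
      Pi.smul_apply, ih, Pi.zero_apply, smul_zero, Finset.sum_const_zero, zero_add, uvPred]
    simp only [Finset.smul_sum, smul_smul]
    rw [Finset.sum_comm]
    refine Finset.sum_eq_zero fun j _ => ?_
    rw [← Finset.sum_smul]
    simp only [mul_comm (τ.ι _ a), hι, zero_smul]

theorem p_ν (f : τ.Fun) : τ.pₗ (τ.νₗ f) = 0 := by
  refine eq_zero_of_mem_fil fun m => fil_anti (Nat.le_succ m) ?_
  have h1 := τ.raises_p _ _ (τ.ν_sub_mem_fil f m)
  have e : τ.pₗ (∑ N ∈ Finset.Icc 1 m, ((N : ℂ)⁻¹) • τ.uv N f) = 0 := by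
    rw [map_sum]
    refine Finset.sum_eq_zero fun N hN => ?_
    rw [Finset.mem_Icc] at hN
    obtain ⟨n, rfl⟩ : ∃ n, N = n + 1 := ⟨N - 1, by omega⟩
    rw [map_smul, p_uv_succ, smul_zero]
  rwa [map_sub, e, sub_zero] at h1

theorem p_i (f : τ.Fun') : τ.pₗ (τ.iₗ f) = f := by
  refine (pullback_comp (fun a j => τ.π a j) (fun a j => τ.ι a j) f).trans ?_
  refine pullback_of_one (fun w v => ?_) f
  have := congrFun (congrFun τ.π_ι w) v
  rwa [Matrix.mul_apply, Matrix.one_apply] at this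

/-- Each derivative of the composite produces the matrix κι = 0 or is covered by induction; `κ_i` is
the same with πκ = 0. -/
theorem p_κ {f : τ.Fun} (hf : GradedSymm τ.gh f) : τ.pₗ (τ.κₗ f) = 0 := by
  funext L
  induction L generalizing f with
  | nil => exact linDer_nil _ _
  | cons a L ih =>
    rw [pullback_ι_cons]
    have e : ∀ j, pderiv j (τ.κₗ f) = ∑ i, τ.κ i j • pderiv i f +
        (τ.gh j * 1).negOnePow • τ.κₗ (pderiv j f) := fun j =>
      pderiv_linDer (A := fun i j => τ.κ i j) τ.κ_deg' hf j
    simp only [e, map_add, map_sum, map_smul, Units.smul_def, map_zsmul,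
      Pi.add_apply, Finset.sum_apply, Pi.smul_apply, ih (hf.pderiv _)]
    simp only [Pi.zero_apply, smul_zero, add_zero, Finset.smul_sum, smul_smul]
    rw [Finset.sum_comm]
    refine Finset.sum_eq_zero fun j _ => ?_
    rw [← Finset.sum_smul]
    have := congrFun (congrFun τ.κ_ι j) a
    rw [Matrix.mul_apply] at this
    simp only [mul_comm (τ.ι _ a), this, Matrix.zero_apply, zero_smul]

theorem κ_i {f : τ.Fun'} (hf : GradedSymm τ.gh' f) : τ.κₗ (τ.iₗ f) = 0 := by
  funext L
  induction L generalizing f with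
  | nil => exact linDer_nil _ _
  | cons v L ih =>
    have e : ∀ j, pderiv j (τ.iₗ f) = ∑ a, τ.π a j • τ.iₗ (pderiv a f) := fun j =>
      pderiv_pullback (fun a j => τ.π a j) f j
    have e2 : pderiv v (τ.κₗ (τ.iₗ f)) = ∑ j, τ.κ j v • pderiv j (τ.iₗ f) +
        (τ.gh v * 1).negOnePow • τ.κₗ (pderiv v (τ.iₗ f)) :=
      pderiv_linDer (A := fun i j => τ.κ i j) τ.κ_deg' (τ.symm_i hf) v
    change pderiv v (τ.κₗ (τ.iₗ f)) L = 0
    rw [e2]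
    simp only [e, map_sum, map_smul, Pi.add_apply, Finset.sum_apply, Pi.smul_apply,
      ih (hf.pderiv _)]
    simp only [Pi.zero_apply, smul_zero, Finset.sum_const_zero, add_zero, Finset.smul_sum,
      smul_smul]
    rw [Finset.sum_comm]
    refine Finset.sum_eq_zero fun a _ => ?_
    rw [← Finset.sum_smul]
    have := congrFun (congrFun τ.π_κ a) v
    rw [Matrix.mul_apply] at this
    simp only [mul_comm (τ.κ _ v), this, Matrix.zero_apply, zero_smul]

end BVTheory

namespace BVTheory

variable {I I' : Type*} [Fintype I] [DecidableEq I] [Fintype I'] [DecidableEq I']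
variable (τ : BVTheory I I')

/-! The perturbation series as resolvents -/

/-- `(1 - iħΔ K)⁻¹`. -/
def resħ : τ.Fun →ₗ[ℂ] τ.Fun := resolvent _ (raises_neg_comp' τ.raises_K τ.raises_quantum)

/-- `K_ħ` as a linear map. -/
def Kħₗ : τ.Fun →ₗ[ℂ] τ.Fun := τ.Kₗ ∘ₗ τ.resħ

theorem raises_resħ : Raises 0 τ.resħ := raises_resolvent _

theorem raises_Kħ : Raises 0 τ.Kħₗ := τ.raises_K.comp τ.raises_resħ rfl

theorem Kħ_eq : τ.Kħ = τ.Kħₗ := by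
  funext f
  exact tsum_hplPTerm τ.raises_K τ.raises_quantum τ.raises_K f

theorem pħ_eq : τ.pħ = τ.pₗ ∘ₗ τ.resħ := by
  funext f
  exact tsum_hplPTerm τ.raises_K τ.raises_quantum τ.raises_p f

theorem raises_pħ : Raises 0 (τ.pₗ ∘ₗ τ.resħ) := τ.raises_p.comp τ.raises_resħ rfl

/-- `(1 + Q_int K_ħ)⁻¹`. -/
def resInt : τ.Fun →ₗ[ℂ] τ.Fun := resolvent _ (raises_neg_comp' τ.raises_Kħ τ.raises_Qint)

/-- The inverse of `1 + δ K` for the full perturbation `δ`. -/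
def res : τ.Fun →ₗ[ℂ] τ.Fun := τ.resħ ∘ₗ τ.resInt

theorem raises_res : Raises 0 τ.res := τ.raises_resħ.comp (raises_resolvent _) rfl

theorem hplConverges : τ.HPLConverges := by
  refine ⟨fun f _ => ⟨summable_hplITerm τ.raises_K τ.raises_quantum _ _, ?_⟩, fun f _ =>
    ⟨summable_hplPTerm τ.raises_K τ.raises_quantum τ.raises_p f, ?_,
      summable_hplPTerm τ.raises_K τ.raises_quantum τ.raises_K f, ?_⟩⟩
  · rw [Kħ_eq]
    exact summable_hplITerm τ.raises_Kħ τ.raises_Qint _ _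
  · rw [Kħ_eq, pħ_eq]
    exact summable_hplPTerm τ.raises_Kħ τ.raises_Qint τ.raises_pħ f
  · rw [Kħ_eq]
    exact summable_hplPTerm τ.raises_Kħ τ.raises_Qint τ.raises_Kħ f

theorem pInt_eq (f : τ.Fun) : τ.pInt f = τ.pₗ (τ.res f) := by
  rw [pInt, Kħ_eq, pħ_eq]
  exact tsum_hplPTerm τ.raises_Kħ τ.raises_Qint τ.raises_pħ f

theorem Kint_eq (f : τ.Fun) : τ.Kint f = τ.Kₗ (τ.res f) := by
  rw [Kint, Kħ_eq]
  exact tsum_hplPTerm τ.raises_Kħ τ.raises_Qint τ.raises_Kħ f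

theorem raises_δK : Raises 1 (-(τ.δₗ ∘ₗ τ.Kₗ)) := raises_neg_comp' τ.raises_K τ.raises_δ

theorem raises_Kδ : Raises 1 (-(τ.Kₗ ∘ₗ τ.δₗ)) := raises_neg_comp τ.raises_K τ.raises_δ

/-- Perturbing in two stages amounts to the factorization 1 + δK = (1 + Q_int K_ħ)(1 - iħΔK), so
`res` inverts 1 + δK for the full perturbation. -/
theorem res_eq (f : τ.Fun) : τ.res f = f + (-(τ.δₗ ∘ₗ τ.Kₗ)) (τ.res f) := by
  have h1 := resolvent_eq (raises_neg_comp' τ.raises_K τ.raises_quantum) (τ.resInt f)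
  have h2 := resolvent_eq (raises_neg_comp' τ.raises_Kħ τ.raises_Qint) f
  have e1 : τ.res f = τ.resInt f - τ.quantumₗ (τ.Kₗ (τ.res f)) := by
    rw [sub_eq_add_neg]; exact h1
  have e2 : τ.resInt f = f - τ.Qintₗ (τ.Kₗ (τ.res f)) := by
    rw [sub_eq_add_neg]; exact h2
  have e3 : (-(τ.δₗ ∘ₗ τ.Kₗ)) (τ.res f) =
      - (τ.Qintₗ (τ.Kₗ (τ.res f)) + τ.quantumₗ (τ.Kₗ (τ.res f))) := rfl
  rw [e3]
  nth_rewrite 1 [e1, e2]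
  abel

theorem res_add_δK (f : τ.Fun) : τ.res f + τ.δₗ (τ.Kₗ (τ.res f)) = f := by
  have h := τ.res_eq f
  nth_rewrite 1 [h]
  simp

theorem res_of_eq {f r : τ.Fun} (h : r + τ.δₗ (τ.Kₗ r) = f) : τ.res f = r := by
  refine τ.raises_δK.eq_of_eq (τ.res_eq f) ?_
  rw [← h]
  simp

/-- The counterpart of `res_eq` for the inclusion: substituting the equations for i_ħ and K_ħ into
that for i_int merges both stages into one equation with δ. -/
theorem iInt_eq (f : τ.Fun') : τ.iInt f + τ.Kₗ (τ.δₗ (τ.iInt f)) = τ.iₗ f := by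
  have h1 : τ.iInt f = τ.iħ f - τ.Kħₗ (τ.Qintₗ (τ.iInt f)) := by
    have := resolvent_eq (raises_neg_comp τ.raises_Kħ τ.raises_Qint) (τ.iħ f)
    rw [sub_eq_add_neg]
    rw [iInt, Kħ_eq]
    exact this
  have h2 : τ.iħ f = τ.iₗ f - τ.Kₗ (τ.quantumₗ (τ.iħ f)) := by
    rw [sub_eq_add_neg]
    exact resolvent_eq (raises_neg_comp τ.raises_K τ.raises_quantum) (τ.i f)
  have h3 : ∀ g, τ.Kħₗ g = τ.Kₗ g - τ.Kₗ (τ.quantumₗ (τ.Kħₗ g)) := by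
    intro g
    have : τ.resħ g = g - τ.quantumₗ (τ.Kₗ (τ.resħ g)) := by
      rw [sub_eq_add_neg]
      exact resolvent_eq (raises_neg_comp' τ.raises_K τ.raises_quantum) g
    calc τ.Kħₗ g = τ.Kₗ (τ.resħ g) := rfl
      _ = τ.Kₗ (g - τ.quantumₗ (τ.Kₗ (τ.resħ g))) := by rw [← this]
      _ = _ := map_sub _ _ _
  have h4 : τ.δₗ (τ.iInt f) = τ.Qintₗ (τ.iInt f) + τ.quantumₗ (τ.iInt f) := rfl
  have h5 : τ.quantumₗ (τ.iInt f) =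
      τ.quantumₗ (τ.iħ f) - τ.quantumₗ (τ.Kħₗ (τ.Qintₗ (τ.iInt f))) := by
    rw [← map_sub, ← h1]
  have h6 := h3 (τ.Qintₗ (τ.iInt f))
  rw [h4, h5, map_add, map_sub]
  nth_rewrite 1 [h1]
  nth_rewrite 1 [h2]
  nth_rewrite 1 [h6]
  abel

/-- Exhibits i_int as one geometric series in Kδ, whose terms are visibly graded symmetric. -/
theorem iInt_resolvent (f : τ.Fun') : τ.iInt f = resolvent _ τ.raises_Kδ (τ.iₗ f) := by
  refine τ.raises_Kδ.eq_of_eq (f := τ.iₗ f) ?_ (resolvent_eq _ _)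
  rw [← τ.iInt_eq f]
  simp

theorem symm_iInt {f : τ.Fun'} (hf : GradedSymm τ.gh' f) : GradedSymm τ.gh (τ.iInt f) := by
  rw [iInt_resolvent]
  exact gradedSymm_resolvent _ (fun f hf => (symm_K (symm_δ hf)).neg) (τ.symm_i hf)

theorem symm_res {f : τ.Fun} (hf : GradedSymm τ.gh f) : GradedSymm τ.gh (τ.res f) := by
  have : τ.res f = resolvent _ τ.raises_δK f :=
    τ.raises_δK.eq_of_eq (τ.res_eq f) (resolvent_eq _ _)
  rw [this]
  exact gradedSymm_resolvent _ (fun f hf => (symm_δ (symm_K hf)).neg) hf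

theorem symm_Kint {f : τ.Fun} (hf : GradedSymm τ.gh f) : GradedSymm τ.gh (τ.Kint f) := by
  rw [Kint_eq]
  exact symm_K (τ.symm_res hf)

theorem symm_pInt {f : τ.Fun} (hf : GradedSymm τ.gh f) : GradedSymm τ.gh' (τ.pInt f) := by
  rw [pInt_eq]
  exact symm_p (τ.symm_res hf)

/-! The homological perturbation lemma -/

theorem p_K (f : τ.Fun) : τ.pₗ (τ.Kₗ f) = 0 := τ.p_ν _

theorem κ_K {f : τ.Fun} (hf : GradedSymm τ.gh f) : τ.κₗ (τ.Kₗ f) = 0 := by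
  change τ.κₗ (τ.νₗ (τ.κₗ f)) = 0
  rw [τ.κ_ν (symm_κ hf), τ.κ_κ hf, map_zero]

theorem K_κ {f : τ.Fun} (hf : GradedSymm τ.gh f) : τ.Kₗ (τ.κₗ f) = 0 := by
  change τ.νₗ (τ.κₗ (τ.κₗ f)) = 0
  rw [τ.κ_κ hf, map_zero]

theorem K_K {f : τ.Fun} (hf : GradedSymm τ.gh f) : τ.Kₗ (τ.Kₗ f) = 0 := by
  change τ.νₗ (τ.κₗ (τ.Kₗ f)) = 0
  rw [τ.κ_K hf, map_zero]

theorem K_i {f : τ.Fun'} (hf : GradedSymm τ.gh' f) : τ.Kₗ (τ.iₗ f) = 0 := by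
  change τ.νₗ (τ.κₗ (τ.iₗ f)) = 0
  rw [τ.κ_i hf, map_zero]

theorem N_K {f : τ.Fun} (hf : GradedSymm τ.gh f) : τ.Nₗ (τ.Kₗ f) = τ.κₗ f := by
  change τ.Nₗ (τ.νₗ (τ.κₗ f)) = _
  rw [τ.N_ν (symm_κ hf), τ.p_κ hf, map_zero, sub_zero]

/-- N is the anticommutator of d and κ̂, and κ̂² = 0, so N commutes with κ̂; then ν cancels N
because ι^*κ̂ = 0. -/
theorem K_N {f : τ.Fun} (hf : GradedSymm τ.gh f) : τ.Kₗ (τ.Nₗ f) = τ.κₗ f := by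
  have : τ.κₗ (τ.Nₗ f) = τ.Nₗ (τ.κₗ f) := by
    rw [← τ.d_κ_add hf, ← τ.d_κ_add (symm_κ hf), map_add, τ.κ_κ (symm_d hf), τ.κ_κ hf, map_zero]
    abel
  change τ.νₗ (τ.κₗ (τ.Nₗ f)) = _
  rw [this, τ.ν_N (symm_κ hf), τ.p_κ hf, map_zero, sub_zero]

theorem H_of_κ_eq_zero {s : τ.Fun} (hκ : τ.κₗ s = 0) :
    τ.Hₗ s = τ.κₗ (τ.dₗ s + τ.δₗ s) := by
  change (τ.dₗ + τ.δₗ) (τ.κₗ s) + τ.κₗ ((τ.dₗ + τ.δₗ) s) = _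
  rw [hκ, map_zero, zero_add]; rfl

/-- If `κ̂ s = 0` then `K Q s = s - i p s + K δ s`. -/
theorem K_Q_of_κ_eq_zero {s : τ.Fun} (hs : GradedSymm τ.gh s) (hκ : τ.κₗ s = 0) :
    τ.Kₗ (τ.dₗ s + τ.δₗ s) = s - τ.iₗ (τ.pₗ s) + τ.Kₗ (τ.δₗ s) := by
  have h := τ.d_κ_add hs
  rw [hκ, map_zero, zero_add] at h
  rw [map_add, ← τ.ν_N hs, ← h]; rfl

theorem p_iInt (f : τ.Fun') : τ.pₗ (τ.iInt f) = f := by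
  have h := congrArg τ.pₗ (τ.iInt_eq f)
  rwa [map_add, τ.p_K, add_zero, τ.p_i] at h

theorem κ_iInt {f : τ.Fun'} (hf : GradedSymm τ.gh' f) : τ.κₗ (τ.iInt f) = 0 := by
  have h := congrArg τ.κₗ (τ.iInt_eq f)
  rwa [map_add, τ.κ_K (symm_δ (τ.symm_iInt hf)), add_zero, τ.κ_i hf] at h

/-- For s = i_int f one has κ̂s = 0, so Hs = κ̂Qs = N(KQs). Here KQs = (s + Kδs) - π^*ι^*s, and both
terms equal π^*f. -/
theorem H_iInt {f : τ.Fun'} (hf : GradedSymm τ.gh' f) : τ.Hₗ (τ.iInt f) = 0 := by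
  have hs := τ.symm_iInt hf
  have hκ := τ.κ_iInt hf
  have h := τ.K_Q_of_κ_eq_zero hs hκ
  have h2 := τ.iInt_eq f
  rw [τ.p_iInt, ← h2] at h
  rw [τ.H_of_κ_eq_zero hκ, ← τ.N_K ((symm_d hs).add (symm_δ hs)), h]
  convert map_zero τ.Nₗ using 2
  abel

theorem κ_Kint {f : τ.Fun} (hf : GradedSymm τ.gh f) : τ.κₗ (τ.Kint f) = 0 := by
  rw [Kint_eq, τ.κ_K (τ.symm_res hf)]

/-- As for i_int, but now ι^*s = 0 for s = K_int f, and s + Kδs = K(1 + δK)(1 + δK)⁻¹f = Kf; finally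
NKf = κ̂f. -/
theorem H_Kint {f : τ.Fun} (hf : GradedSymm τ.gh f) : τ.Hₗ (τ.Kint f) = τ.κₗ f := by
  have hs := τ.symm_Kint hf
  have hκ := τ.κ_Kint hf
  have h := τ.K_Q_of_κ_eq_zero hs hκ
  have h2 := congrArg τ.Kₗ (τ.res_add_δK f)
  rw [map_add, ← Kint_eq] at h2
  have h3 : τ.pₗ (τ.Kint f) = 0 := by rw [Kint_eq, p_K]
  rw [h3, map_zero, sub_zero, h2] at h
  rw [τ.H_of_κ_eq_zero hκ, ← τ.N_K ((symm_d hs).add (symm_δ hs)), h, τ.N_K hf]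

theorem pInt_add (f h : τ.Fun) : τ.pInt (f + h) = τ.pInt f + τ.pInt h := by
  simp only [pInt_eq, map_add]

theorem pInt_sub (f h : τ.Fun) : τ.pInt (f - h) = τ.pInt f - τ.pInt h := by
  simp only [pInt_eq, map_sub]

theorem pInt_smul (c : ℂ) (f : τ.Fun) : τ.pInt (c • f) = c • τ.pInt f := by
  simp only [pInt_eq, map_smul]

/-- Since Kκ̂ = 0, the operator (1 + δK)⁻¹ fixes κ̂f, and ι^*κ̂ = 0. The next two lemmas use KK = 0
and Kπ^* = 0 in the same way. -/
theorem pInt_κ {f : τ.Fun} (hf : GradedSymm τ.gh f) : τ.pInt (τ.κₗ f) = 0 := by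
  rw [pInt_eq, τ.res_of_eq (r := τ.κₗ f), τ.p_κ hf]
  rw [τ.K_κ hf, map_zero, add_zero]

theorem pInt_K {f : τ.Fun} (hf : GradedSymm τ.gh f) : τ.pInt (τ.Kₗ f) = 0 := by
  rw [pInt_eq, τ.res_of_eq (r := τ.Kₗ f), τ.p_K]
  rw [τ.K_K hf, map_zero, add_zero]

theorem pInt_i {f : τ.Fun'} (hf : GradedSymm τ.gh' f) : τ.pInt (τ.iₗ f) = f := by
  rw [pInt_eq, τ.res_of_eq (r := τ.iₗ f), τ.p_i]
  rw [τ.K_i hf, map_zero, add_zero]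

theorem pInt_iInt {f : τ.Fun'} (hf : GradedSymm τ.gh' f) : τ.pInt (τ.iInt f) = f := by
  have h := congrArg τ.pInt (τ.iInt_eq f)
  rwa [pInt_add, τ.pInt_K (symm_δ (τ.symm_iInt hf)), add_zero, τ.pInt_i hf] at h

theorem pInt_Kint {f : τ.Fun} (hf : GradedSymm τ.gh f) : τ.pInt (τ.Kint f) = 0 := by
  rw [Kint_eq, τ.pInt_K (τ.symm_res hf)]

theorem pInt_add_δK (f : τ.Fun) : τ.pInt (f + τ.δₗ (τ.Kₗ f)) = τ.pₗ f := by
  rw [pInt_eq, τ.res_of_eq rfl]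

/-- H f is the sum of dκ̂f, δκ̂f and κ̂Qf; p_int kills the last. As δκ̂f = δK(Nf), its image is
ι^*Nf - p_int Nf. Applying dκ̂ + κ̂d = N to νNf shows that dκ̂f has the opposite image. -/
theorem pInt_H {f : τ.Fun} (hf : GradedSymm τ.gh f) : τ.pInt (τ.Hₗ f) = 0 := by
  have hN := symm_N hf
  have e : τ.Hₗ f = τ.dₗ (τ.κₗ f) + τ.δₗ (τ.κₗ f) + τ.κₗ (τ.dₗ f + τ.δₗ f) := rfl
  have h1 := τ.pInt_add_δK (τ.Nₗ f)
  rw [τ.K_N hf, pInt_add] at h1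
  have h2 := congrArg τ.pInt (τ.d_κ_add (symm_ν hN))
  rw [τ.κ_ν hN, pInt_add, τ.pInt_κ (symm_d (symm_ν hN)), add_zero, τ.N_ν hN, pInt_sub,
    τ.pInt_i (symm_p hN)] at h2
  have h3 : τ.νₗ (τ.κₗ (τ.Nₗ f)) = τ.κₗ f := τ.K_N hf
  rw [h3] at h2
  rw [e, pInt_add, pInt_add, τ.pInt_κ ((symm_d hf).add (symm_δ hf)), add_zero, h2, ← h1]
  abel

/-- Apply ι^* to f = r + δKr with r = (1 + δK)⁻¹f: the first term gives p_int f = 0 and the second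
contains δ. To leading order an element of ker p_int thus has no component of degree 0 in F''. -/
theorem p_mem_fil_of_pInt_eq_zero {m : ℕ} {f : τ.Fun} (hf : f ∈ Fil I m) (h : τ.pInt f = 0) :
    τ.pₗ f ∈ Fil I' (m + 1) := by
  have h1 := congrArg τ.pₗ (τ.res_add_δK f)
  rw [map_add, ← pInt_eq, h, zero_add] at h1
  rw [← h1]
  exact τ.raises_p _ _ (τ.raises_δ _ _ (τ.raises_K _ _ (τ.raises_res _ _ hf)))

/-! Roots of `H` on the kernel of `p_int` -/

theorem raises_H : Raises 0 τ.Hₗ := by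
  have h : Raises 0 (τ.dₗ + τ.δₗ) :=
    τ.raises_d.add fun m f hf => fil_anti (Nat.le_succ m) (τ.raises_δ m f hf)
  exact (h.comp τ.raises_κ rfl).add (τ.raises_κ.comp h rfl)

/-- The difference is the anticommutator of δ with κ̂. -/
theorem H_sub_N_mem_fil {m : ℕ} {f : τ.Fun} (hs : GradedSymm τ.gh f) (hf : f ∈ Fil I m) :
    τ.Hₗ f - τ.Nₗ f ∈ Fil I (m + 1) := by
  have h1 := τ.raises_δ _ _ (τ.raises_κ _ _ hf)
  have h2 := τ.raises_κ _ _ (τ.raises_δ _ _ hf)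
  have e : τ.Hₗ f - τ.Nₗ f = τ.δₗ (τ.κₗ f) + τ.κₗ (τ.δₗ f) := by
    rw [← τ.d_κ_add hs]
    change (τ.dₗ (τ.κₗ f) + τ.δₗ (τ.κₗ f)) + τ.κₗ (τ.dₗ f + τ.δₗ f) - _ = _
    rw [map_add]; abel
  rw [e]
  exact (Fil I (m + 1)).add_mem h1 h2

/-- The operator `∏ (H - a)` over a list of numbers `a`. -/
def prodH : List ℕ → τ.Fun → τ.Fun
  | [], f => f
  | a :: l, f => prodH l (τ.Hₗ f - (a : ℂ) • f)

theorem prodH_append (l l' : List ℕ) (f : τ.Fun) :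
    τ.prodH (l ++ l') f = τ.prodH l' (τ.prodH l f) := by
  induction l generalizing f with
  | nil => rfl
  | cons a l ih => exact ih _

theorem prodH_spec (l : List ℕ) {m : ℕ} {f : τ.Fun} (hs : GradedSymm τ.gh f) (hf : f ∈ Fil I m)
    (h0 : τ.pInt f = 0) : GradedSymm τ.gh (τ.prodH l f) ∧ τ.prodH l f ∈ Fil I m ∧
      τ.pInt (τ.prodH l f) = 0 := by
  induction l generalizing f with
  | nil => exact ⟨hs, hf, h0⟩
  | cons a l ih =>
    refine ih ?_ ?_ ?_
    · rw [sub_eq_add_neg]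
      exact (symm_H hs).add (hs.smul _).neg
    · exact (Fil I m).sub_mem (τ.raises_H _ _ hf) ((Fil I m).smul_mem _ hf)
    · rw [pInt_sub, pInt_smul, τ.pInt_H hs, h0, smul_zero, sub_zero]

/-- Modulo the next filtration step H is N, and f has components of degrees 1, …, m in F'' only; so
(H - 1)⋯(H - m) annihilates it there. -/
theorem exists_prodH_step {m : ℕ} {f : τ.Fun} (hs : GradedSymm τ.gh f) (hf : f ∈ Fil I m)
    (h0 : τ.pInt f = 0) : ∃ l : List ℕ, (∀ a ∈ l, 1 ≤ a) ∧ τ.prodH l f ∈ Fil I (m + 1) := by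
  -- After the factors 1, …, j the component of degree N carries the coefficient ∏_{a ≤ j}(N - a)
  -- for N ≥ 1, which vanishes for N ≤ j; for N = 0 it is zero from the start.
  have key : ∀ j : ℕ, ∃ c : ℕ → ℂ, (∀ N ≤ j, c N = 0) ∧ τ.prodH (List.range' 1 j) f -
      ∑ N ∈ Finset.range (m + 1), c N • τ.uv N f ∈ Fil I (m + 1) := by
    intro j
    induction j with
    | zero =>
      refine ⟨fun N => if N = 0 then 0 else 1, fun N hN => if_pos (by omega), ?_⟩
      have h1 := τ.sum_uv_sub_mem_fil f m
      -- The only use of p_int f = 0: it lets the component of degree 0 be discarded, so that no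
      -- factor a = 0 is needed.
      have h2 : τ.uv 0 f ∈ Fil I (m + 1) := by
        rw [uv_zero_eq]
        exact τ.raises_i _ _ (τ.p_mem_fil_of_pInt_eq_zero hf h0)
      rw [Finset.sum_range_succ'] at h1 ⊢
      simp only [Nat.succ_ne_zero, if_false, if_true, one_smul, zero_smul, add_zero]
      convert (Fil I (m + 1)).add_mem h1 h2 using 1
      change f - _ = _
      abel
    | succ j ih =>
      obtain ⟨c, hc, h⟩ := ih
      refine ⟨fun N => ((N : ℂ) - (j + 1 : ℕ)) * c N, fun N hN => ?_, ?_⟩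
      · rcases Nat.lt_or_ge j N with h1 | h1
        · have : N = j + 1 := by omega
          subst this; simp
        · simp [hc N h1]
      · obtain ⟨g1, g2, g3⟩ := τ.prodH_spec (List.range' 1 j) hs hf h0
        rw [List.range'_concat, prodH_append]
        set g := τ.prodH (List.range' 1 j) f with hg
        change τ.Hₗ g - ((1 + 1 * j : ℕ) : ℂ) • g - _ ∈ _
        have k1 := τ.H_sub_N_mem_fil g1 g2
        have k2 := τ.raises_N _ _ h
        have k3 := (Fil I (m + 1)).smul_mem ((1 + 1 * j : ℕ) : ℂ) h
        rw [map_sub, map_sum] at k2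
        simp only [map_smul, τ.N_uv hs] at k2
        convert (Fil I (m + 1)).sub_mem ((Fil I (m + 1)).add_mem k1 k2) k3 using 1
        have e : ∑ N ∈ Finset.range (m + 1), (((N : ℂ) - (j + 1 : ℕ)) * c N) • τ.uv N f =
            ∑ N ∈ Finset.range (m + 1), c N • (N : ℂ) • τ.uv N f -
            ((1 + 1 * j : ℕ) : ℂ) • ∑ N ∈ Finset.range (m + 1), c N • τ.uv N f := by
          rw [Finset.smul_sum, ← Finset.sum_sub_distrib]
          refine Finset.sum_congr rfl fun N _ => ?_
          rw [smul_smul, smul_smul, ← sub_smul]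
          congr 1
          push_cast; ring
        rw [e, smul_sub]
        abel
  obtain ⟨c, hc, h⟩ := key m
  refine ⟨List.range' 1 m, fun a ha => ?_, ?_⟩
  · rw [List.mem_range'] at ha
    omega
  · rwa [Finset.sum_eq_zero, sub_zero] at h
    intro N hN
    rw [hc N (by simpa [Nat.lt_succ_iff] using hN), zero_smul]

theorem exists_prodH {f : τ.Fun} (hs : GradedSymm τ.gh f) (h0 : τ.pInt f = 0) (m : ℕ) :
    ∃ l : List ℕ, (∀ a ∈ l, 1 ≤ a) ∧ τ.prodH l f ∈ Fil I m := by
  induction m with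
  | zero => exact ⟨[], by simp, mem_fil_zero _⟩
  | succ m ih =>
    obtain ⟨l, hl, h⟩ := ih
    obtain ⟨g1, g2, g3⟩ := τ.prodH_spec l hs (mem_fil_zero _) h0
    obtain ⟨l', hl', h'⟩ := τ.exists_prodH_step g1 h g3
    refine ⟨l ++ l', fun a ha => ?_, ?_⟩
    · rcases List.mem_append.1 ha with h | h
      · exact hl a h
      · exact hl' a h
    · rwa [prodH_append]

end BVTheory

/-! ## Exponential decay of linear flows -/

section Flow

variable {E : Type*} [NormedAddCommGroup E] [NormedSpace ℂ E] [CompleteSpace E]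

/-- The linear flow `exp (-t A) v`. -/
def expFlow (A : E →L[ℂ] E) (t : ℝ) (v : E) : E := NormedSpace.exp (((-t : ℝ) : ℂ) • A) v

theorem hasSum_expFlow (A : E →L[ℂ] E) (t : ℝ) (v : E) :
    HasSum (fun n : ℕ => (((-t : ℝ) : ℂ) ^ n / (n.factorial : ℂ)) • (A ^ n) v) (expFlow A t v) := by
  have h := NormedSpace.exp_series_hasSum_exp' (𝕂 := ℂ) (((-t : ℝ) : ℂ) • A)
  have h2 := h.mapL (ContinuousLinearMap.apply ℂ E v)
  have e : (fun n : ℕ => (((-t : ℝ) : ℂ) ^ n / (n.factorial : ℂ)) • (A ^ n) v) =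
      fun n : ℕ => ContinuousLinearMap.apply ℂ E v
        (((n.factorial : ℂ)⁻¹) • (((-t : ℝ) : ℂ) • A) ^ n) := by
    funext n
    rw [smul_pow, smul_smul, div_eq_inv_mul]
    rfl
  rw [e]
  exact h2

theorem expFlow_zero (A : E →L[ℂ] E) (v : E) : expFlow A 0 v = v := by
  simp [expFlow]

theorem hasDerivAt_expFlow (A : E →L[ℂ] E) (v : E) (t : ℝ) :
    HasDerivAt (fun t => expFlow A t v) (-(expFlow A t (A v))) t := by
  have h := hasDerivAt_exp_smul_const (𝕂 := ℂ) A (((-t : ℝ) : ℂ))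
  have h1 : HasDerivAt (fun s : ℝ => (((-s : ℝ) : ℂ))) (-1) t := by
    have := (hasDerivAt_id t).neg.ofReal_comp
    simpa using this
  have h2 := h.scomp t h1
  have h3 := (ContinuousLinearMap.apply ℂ E v).hasFDerivAt.restrictScalars ℝ |>.comp_hasDerivAt t h2
  have e : (ContinuousLinearMap.restrictScalars ℝ (ContinuousLinearMap.apply ℂ E v))
      ((-1 : ℂ) • (NormedSpace.exp (((-t : ℝ) : ℂ) • A) * A)) = -(expFlow A t (A v)) := by
    rw [neg_one_smul]; rfl
  rw [← e]
  exact h3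

/-- Iterated application of `A - a` for `a` in a list. -/
def prodSub (A : E →L[ℂ] E) : List ℕ → E → E
  | [], v => v
  | a :: l, v => prodSub A l (A v - (a : ℂ) • v)

theorem expFlow_sub (A : E →L[ℂ] E) (t : ℝ) (v w : E) :
    expFlow A t (v - w) = expFlow A t v - expFlow A t w := map_sub _ _ _

theorem expFlow_smul (A : E →L[ℂ] E) (t : ℝ) (c : ℂ) (v : E) :
    expFlow A t (c • v) = c • expFlow A t v := map_smul _ _ _

/-- Remove one factor at a time: if u = (A - a)v decays, then e^{at}e^{-tA}v has derivative
-e^{at}e^{-tA}u, and integrating its norm bounds e^{-tA}v. The rate ½, strictly below every a ≥ 1,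
absorbs the polynomial factors caused by repeated roots. -/
theorem exists_expFlow_bound (A : E →L[ℂ] E) {l : List ℕ} (hl : ∀ a ∈ l, 1 ≤ a) {v : E}
    (hv : prodSub A l v = 0) : ∃ C, ∀ t : ℝ, 0 ≤ t → ‖expFlow A t v‖ ≤ C * Real.exp (-t / 2) := by
  induction l generalizing v with
  | nil =>
    have : v = 0 := hv
    refine ⟨0, fun t _ => ?_⟩
    simp [this, expFlow]
  | cons a l ih =>
    obtain ⟨C, hC⟩ := ih (fun b hb => hl b (List.mem_cons_of_mem _ hb)) hv
    have ha : (1 : ℝ) ≤ a := by exact_mod_cast hl a List.mem_cons_self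
    have hC0 : 0 ≤ C := by
      have := (norm_nonneg _).trans (hC 0 le_rfl)
      simpa using this
    set u := A v - (a : ℂ) • v with hu
    let φ : ℝ → E := fun t => Real.exp (a * t) • expFlow A t v
    have hφ : ∀ t, HasDerivAt φ (-(Real.exp (a * t) • expFlow A t u)) t := by
      intro t
      have h1 : HasDerivAt (fun t : ℝ => Real.exp (a * t)) (Real.exp (a * t) * a) t := by
        have := ((hasDerivAt_id t).const_mul (a : ℝ)).exp
        simpa using this
      have h2 := h1.smul (hasDerivAt_expFlow A v t)
      have h3 : (a : ℂ) • expFlow A t v = (a : ℝ) • expFlow A t v := by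
        rw [← Complex.coe_smul]; simp
      have h4 : -(Real.exp (a * t) • expFlow A t u) = Real.exp (a * t) • -expFlow A t (A v) +
          (Real.exp (a * t) * a) • expFlow A t v := by
        rw [hu, expFlow_sub, expFlow_smul, smul_sub, h3, smul_neg, SemigroupAction.mul_smul]
        abel
      rw [h4]
      exact h2
    let b : ℝ := a - 1 / 2
    have hb : 1 / 2 ≤ b := by simp only [b]; linarith
    -- A majorant of the norm of φ: its derivative 2Cb e^{bt} dominates the bound C e^{bt} for the
    -- derivative of φ because 2b ≥ 1.
    let B : ℝ → ℝ := fun t => ‖v‖ + 2 * C * Real.exp (b * t)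
    have hB : ∀ t, HasDerivAt B (2 * C * (Real.exp (b * t) * b)) t := by
      intro t
      have := (((hasDerivAt_id t).const_mul b).exp.const_mul (2 * C)).const_add ‖v‖
      simp only [id, _root_.mul_one] at this
      exact this
    have bound : ∀ t : ℝ, 0 ≤ t → ‖φ t‖ ≤ B t := by
      intro t ht
      refine image_norm_le_of_norm_deriv_right_le_deriv_boundary (a := 0) (b := t)
        (f' := fun t => -(Real.exp (a * t) • expFlow A t u))
        (fun s _ => (hφ s).continuousAt.continuousWithinAt)
        (fun s _ => (hφ s).hasDerivWithinAt) ?_ hB (fun s hs => ?_) ⟨ht, le_rfl⟩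
      · simp only [φ, B, MulZeroClass.mul_zero, Real.exp_zero, one_smul, expFlow_zero]
        linarith
      · rw [norm_neg, norm_smul, Real.norm_eq_abs, abs_of_pos (Real.exp_pos _)]
        have e : Real.exp (b * s) = Real.exp (a * s) * Real.exp (-s / 2) := by
          rw [← Real.exp_add]; congr 1; simp only [b]; ring
        have h1 := mul_le_mul_of_nonneg_left (hC s hs.1) (Real.exp_pos (a * s)).le
        have h2 : 0 ≤ C * Real.exp (b * s) := mul_nonneg hC0 (Real.exp_pos _).le
        have h3 : C * Real.exp (b * s) * 1 ≤ C * Real.exp (b * s) * (2 * b) :=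
          mul_le_mul_of_nonneg_left (by linarith) h2
        rw [e] at h3 ⊢
        linarith
    refine ⟨‖v‖ + 2 * C, fun t ht => ?_⟩
    have h1 := bound t ht
    rw [show φ t = Real.exp (a * t) • expFlow A t v from rfl, norm_smul, Real.norm_eq_abs,
      abs_of_pos (Real.exp_pos _)] at h1
    have e1 : Real.exp (-(a * t)) * Real.exp (a * t) = 1 := by
      rw [← Real.exp_add]; simp
    have e2 : Real.exp (-(a * t)) * Real.exp (b * t) = Real.exp (-t / 2) := by
      rw [← Real.exp_add]; congr 1; simp only [b]; ring
    have e3 : Real.exp (-(a * t)) ≤ Real.exp (-t / 2) := Real.exp_le_exp.2 (by nlinarith)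
    calc ‖expFlow A t v‖ = Real.exp (-(a * t)) * (Real.exp (a * t) * ‖expFlow A t v‖) := by
          rw [← _root_.mul_assoc, e1, _root_.one_mul]
      _ ≤ Real.exp (-(a * t)) * (‖v‖ + 2 * C * Real.exp (b * t)) :=
          mul_le_mul_of_nonneg_left h1 (Real.exp_pos _).le
      _ = Real.exp (-(a * t)) * ‖v‖ + 2 * C * Real.exp (-t / 2) := by
          rw [← e2]; ring
      _ ≤ Real.exp (-t / 2) * ‖v‖ + 2 * C * Real.exp (-t / 2) := by
          gcongr
      _ = _ := by ring

end Flow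

/-! ## Truncation of formal functions -/

section Truncation

variable {V : Type*}

/-- The Taylor coefficients of filtration degree less than `m`. -/
abbrev TruncIndex (V : Type*) (m : ℕ) := {x : List V × ℕ // 3 * x.2 + x.1.length < m}

instance [Fintype V] (m : ℕ) : Finite (TruncIndex V m) := by
  have h1 : {L : List V | L.length ≤ m}.Finite := List.finite_length_le V m
  have h2 := h1.prod (Set.finite_le_nat m)
  have h3 : {x : List V × ℕ | 3 * x.2 + x.1.length < m}.Finite := by
    refine h2.subset fun x hx => ?_
    have hx' : 3 * x.2 + x.1.length < m := hx
    exact ⟨show x.1.length ≤ m by omega, show x.2 ≤ m by omega⟩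
  exact h3.to_subtype

instance [Fintype V] (m : ℕ) : Fintype (TruncIndex V m) := Fintype.ofFinite _

/-- Restriction to the Taylor coefficients of filtration degree less than `m`. -/
def truncₗ (V : Type*) (m : ℕ) : SuperSeries (PowerSeries ℂ) V →ₗ[ℂ] (TruncIndex V m → ℂ) where
  toFun f := fun x => PowerSeries.coeff x.1.2 (f x.1.1)
  map_add' f h := by funext x; simp
  map_smul' c f := by funext x; simp

/-- Extension of finitely many Taylor coefficients by zero. -/
def extₗ (V : Type*) (m : ℕ) : (TruncIndex V m → ℂ) →ₗ[ℂ] SuperSeries (PowerSeries ℂ) V where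
  toFun e := fun L => PowerSeries.mk fun k =>
    if h : 3 * k + L.length < m then e ⟨(L, k), h⟩ else 0
  map_add' e e' := by
    funext L; ext k
    by_cases h : 3 * k + L.length < m <;> simp [h]
  map_smul' c e := by
    funext L; ext k
    by_cases h : 3 * k + L.length < m <;> simp [h]

theorem truncₗ_eq_zero_iff {m : ℕ} {f : SuperSeries (PowerSeries ℂ) V} :
    truncₗ V m f = 0 ↔ f ∈ Fil V m :=
  ⟨fun h L k hk => congrFun h ⟨(L, k), hk⟩, fun h => funext fun x => h x.1.1 x.1.2 x.2⟩

theorem sub_ext_trunc_mem_fil (m : ℕ) (f : SuperSeries (PowerSeries ℂ) V) :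
    f - extₗ V m (truncₗ V m f) ∈ Fil V m := by
  intro L k hk
  simp [extₗ, truncₗ, hk]

end Truncation

/-! ### The flow e^{-TH}: convergence, decay on ker p_int and limits -/

namespace BVTheory

variable {I I' : Type*} [Fintype I] [DecidableEq I] [Fintype I'] [DecidableEq I']
variable (τ : BVTheory I I')

/-- The Hamiltonian on truncated functions. -/
def Htrunc (m : ℕ) : (TruncIndex I m → ℂ) →L[ℂ] (TruncIndex I m → ℂ) :=
  LinearMap.toContinuousLinearMap (truncₗ I m ∘ₗ τ.Hₗ ∘ₗ extₗ I m)

/-- H preserves the filtration, so it descends to the finite-dimensional quotient by its m-th step,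
whatever linear section is used to define it there. -/
theorem trunc_H (m : ℕ) (f : τ.Fun) : truncₗ I m (τ.Hₗ f) = τ.Htrunc m (truncₗ I m f) := by
  have h := τ.raises_H _ _ (sub_ext_trunc_mem_fil m f)
  rw [add_zero, ← truncₗ_eq_zero_iff, map_sub, map_sub, sub_eq_zero] at h
  exact h

theorem trunc_H_iterate (m n : ℕ) (f : τ.Fun) :
    truncₗ I m (τ.H^[n] f) = (τ.Htrunc m ^ n) (truncₗ I m f) := by
  induction n with
  | zero => simp
  | succ n ih =>
    rw [Function.iterate_succ_apply', H_eq, trunc_H, ih, pow_succ', mul_apply_eq_comp]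

theorem hasSum_expTerm_coeff (T : ℝ) (O : τ.Fun) (L : List I) (k : ℕ) (m : ℕ)
    (hm : 3 * k + L.length < m) :
    HasSum (fun n => PowerSeries.coeff k (τ.expTerm T O n L))
      (expFlow (τ.Htrunc m) T (truncₗ I m O) ⟨(L, k), hm⟩) := by
  have h := hasSum_expFlow (τ.Htrunc m) T (truncₗ I m O)
  rw [Pi.hasSum] at h
  convert h ⟨(L, k), hm⟩ using 1
  funext n
  rw [← trunc_H_iterate, ← map_smul]
  rfl

theorem summable_expTerm (T : ℝ) (O : τ.Fun) : Summable (τ.expTerm T O) := by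
  refine HasSum.summable (a := fun L => PowerSeries.mk fun k =>
    expFlow (τ.Htrunc (3 * k + L.length + 1)) T (truncₗ I _ O) ⟨(L, k), by simp⟩)
    (hasSum_of_coeff fun L k => ?_)
  rw [PowerSeries.coeff_mk]
  exact τ.hasSum_expTerm_coeff T O L k _ _

theorem coeff_expNegTH (T : ℝ) (O : τ.Fun) (L : List I) (k : ℕ) :
    HasSum (fun n => PowerSeries.coeff k (τ.expTerm T O n L))
      (PowerSeries.coeff k (τ.expNegTH T O L)) := by
  have h := (τ.summable_expTerm T O).hasSum
  rw [Pi.hasSum] at h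
  exact (PowerSeries.WithPiTopology.hasSum_iff_hasSum_coeff ℂ).1 (h L) k

theorem trunc_expNegTH (T : ℝ) (O : τ.Fun) (m : ℕ) :
    truncₗ I m (τ.expNegTH T O) = expFlow (τ.Htrunc m) T (truncₗ I m O) := by
  funext x
  exact (τ.coeff_expNegTH T O x.1.1 x.1.2).unique (τ.hasSum_expTerm_coeff T O x.1.1 x.1.2 m x.2)

theorem coeff_expNegTH_eq (T : ℝ) (O : τ.Fun) (L : List I) (k : ℕ) :
    PowerSeries.coeff k (τ.expNegTH T O L) =
      expFlow (τ.Htrunc (3 * k + L.length + 1)) T (truncₗ I _ O) ⟨(L, k), by simp⟩ := by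
  rw [← trunc_expNegTH]; rfl

theorem expNegTH_sub (T : ℝ) (f h : τ.Fun) :
    τ.expNegTH T (f - h) = τ.expNegTH T f - τ.expNegTH T h := by
  funext L; ext k
  rw [Pi.sub_apply, map_sub, coeff_expNegTH_eq, coeff_expNegTH_eq, coeff_expNegTH_eq, map_sub,
    expFlow_sub]; rfl

theorem expNegTH_zero (f : τ.Fun) : τ.expNegTH 0 f = f := by
  funext L; ext k
  rw [coeff_expNegTH_eq, expFlow_zero]; rfl

theorem expNegTH_of_H_eq_zero (T : ℝ) {f : τ.Fun} (h : τ.Hₗ f = 0) : τ.expNegTH T f = f := by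
  funext L; ext k
  refine (τ.coeff_expNegTH T f L k).unique ?_
  have : ∀ n, n ≠ 0 → PowerSeries.coeff k (τ.expTerm T f n L) = 0 := by
    intro n hn
    obtain ⟨n, rfl⟩ := Nat.exists_eq_succ_of_ne_zero hn
    have h0 : ∀ n, τ.H^[n] (0 : τ.Fun) = 0 := by
      intro n
      induction n with
      | zero => rfl
      | succ n ih => rw [Function.iterate_succ_apply', ih, H_eq, map_zero]
    rw [expTerm, Function.iterate_succ_apply, H_eq, h, h0]
    simp
  convert hasSum_single 0 this using 1
  simp [expTerm]

theorem hasDerivAt_expNegTH (T : ℝ) (f : τ.Fun) (L : List I) (k : ℕ) :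
    HasDerivAt (fun T => PowerSeries.coeff k (τ.expNegTH T f L))
      (-(PowerSeries.coeff k (τ.expNegTH T (τ.Hₗ f) L))) T := by
  simp only [coeff_expNegTH_eq]
  have h := hasDerivAt_expFlow (τ.Htrunc (3 * k + L.length + 1)) (truncₗ I _ f) T
  rw [← trunc_H] at h
  exact hasDerivAt_pi.1 h _

theorem trunc_prodH (m : ℕ) (l : List ℕ) (f : τ.Fun) :
    truncₗ I m (τ.prodH l f) = prodSub (τ.Htrunc m) l (truncₗ I m f) := by
  induction l generalizing f with
  | nil => rfl
  | cons a l ih =>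
    rw [prodH, ih, map_sub, map_smul, trunc_H]; rfl

/-- A product of factors H - a with a ≥ 1 pushes f beyond the filtration degree of the given
coefficient, hence annihilates its truncation, and the bound for matrix flows applies. -/
theorem exists_expNegTH_bound {f : τ.Fun} (hs : GradedSymm τ.gh f) (h0 : τ.pInt f = 0)
    (L : List I) (k : ℕ) : ∃ C, ∀ T : ℝ, 0 ≤ T →
      ‖PowerSeries.coeff k (τ.expNegTH T f L)‖ ≤ C * Real.exp (-T / 2) := by
  obtain ⟨l, hl, h⟩ := τ.exists_prodH hs h0 (3 * k + L.length + 1)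
  rw [← truncₗ_eq_zero_iff, trunc_prodH] at h
  obtain ⟨C, hC⟩ := exists_expFlow_bound _ hl h
  refine ⟨C, fun T hT => ?_⟩
  rw [coeff_expNegTH_eq]
  exact (norm_le_pi_norm _ _).trans (hC T hT)

theorem tendsto_coeff_expNegTH {f : τ.Fun} (hs : GradedSymm τ.gh f) (h0 : τ.pInt f = 0)
    (L : List I) (k : ℕ) : Filter.Tendsto (fun T => PowerSeries.coeff k (τ.expNegTH T f L))
      Filter.atTop (nhds 0) := by
  obtain ⟨C, hC⟩ := τ.exists_expNegTH_bound hs h0 L k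
  refine squeeze_zero_norm' (a := fun T => C * Real.exp (-T / 2)) ?_ ?_
  · filter_upwards [Filter.eventually_ge_atTop 0] with T hT using hC T hT
  · rw [← MulZeroClass.mul_zero C]
    refine Filter.Tendsto.const_mul C (Real.tendsto_exp_atBot.comp ?_)
    have : (fun T : ℝ => -T / 2) = fun T => -(T / 2) := by funext T; ring
    rw [this]
    exact Filter.tendsto_neg_atTop_atBot.comp (Filter.tendsto_id.atTop_div_const two_pos)

theorem tendsto_of_coeff {V : Type*} {u : ℝ → SuperSeries (PowerSeries ℂ) V}
    {s : SuperSeries (PowerSeries ℂ) V} {F : Filter ℝ}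
    (h : ∀ L k, Filter.Tendsto (fun T => PowerSeries.coeff k (u T L)) F
      (nhds (PowerSeries.coeff k (s L)))) : Filter.Tendsto u F (nhds s) := by
  rw [tendsto_pi_nhds]
  intro L
  rw [PowerSeries.WithPiTopology.tendsto_iff_coeff_tendsto]
  exact h L

theorem tendsto_coeff_pullback {V W : Type*} [Fintype W] (M : W → V → ℂ)
    {u : ℝ → SuperSeries (PowerSeries ℂ) W} {s : SuperSeries (PowerSeries ℂ) W} {F : Filter ℝ}
    (h : ∀ L k, Filter.Tendsto (fun T => PowerSeries.coeff k (u T L)) F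
      (nhds (PowerSeries.coeff k (s L)))) (L : List V) (k : ℕ) :
    Filter.Tendsto (fun T => PowerSeries.coeff k (pullback M (u T) L)) F
      (nhds (PowerSeries.coeff k (pullback M s L))) := by
  induction L generalizing u s with
  | nil => exact h [] k
  | cons v L ih =>
    simp only [pullback_cons, map_sum, map_smul]
    exact tendsto_finsetSum _ fun w _ => (ih fun L k => h (w :: L) k).const_smul _

/-- Here h is the stationary part and f - h the decaying part. It is used with h = i_int O' and with
h = i_int p_int O. -/
theorem tendsto_coeff_expNegTH_sub {f h : τ.Fun} (hf : GradedSymm τ.gh (f - h))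
    (h0 : τ.pInt (f - h) = 0) (hH : τ.Hₗ h = 0) (L : List I) (k : ℕ) :
    Filter.Tendsto (fun T => PowerSeries.coeff k (τ.expNegTH T f L))
      Filter.atTop (nhds (PowerSeries.coeff k (h L))) := by
  have h1 := (τ.tendsto_coeff_expNegTH hf h0 L k).add_const (PowerSeries.coeff k (h L))
  rw [zero_add] at h1
  refine h1.congr fun T => ?_
  rw [expNegTH_sub, τ.expNegTH_of_H_eq_zero T hH, Pi.sub_apply, map_sub, sub_add_cancel]

theorem tendsto_expNegTH_i {f : τ.Fun'} (hf : GradedSymm τ.gh' f) :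
    Filter.Tendsto (fun T => τ.expNegTH T (τ.iₗ f)) Filter.atTop (nhds (τ.iInt f)) := by
  refine tendsto_of_coeff (τ.tendsto_coeff_expNegTH_sub ?_ ?_ (τ.H_iInt hf))
  · rw [sub_eq_add_neg]
    exact (τ.symm_i hf).add (τ.symm_iInt hf).neg
  · rw [pInt_sub, τ.pInt_i hf, τ.pInt_iInt hf, sub_self]

theorem tendsto_p_expNegTH {f : τ.Fun} (hf : GradedSymm τ.gh f) :
    Filter.Tendsto (fun T => pullback τ.ι (τ.expNegTH T f)) Filter.atTop (nhds (τ.pInt f)) := by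
  have hp := τ.symm_pInt hf
  have h := τ.tendsto_coeff_expNegTH_sub (f := f) (h := τ.iInt (τ.pInt f)) ?_ ?_ (τ.H_iInt hp)
  · have e : τ.pInt f = pullback (fun i a => τ.ι i a) (τ.iInt (τ.pInt f)) :=
      (τ.p_iInt (τ.pInt f)).symm
    rw [e]
    exact tendsto_of_coeff (tendsto_coeff_pullback (fun i a => τ.ι i a) h)
  · rw [sub_eq_add_neg]
    exact hf.add (τ.symm_iInt hp).neg
  · rw [pInt_sub, τ.pInt_iInt hp, sub_self]

/-- Since κ̂f = H K_int f, the integrand is the derivative of -e^{-TH}K_int f. The boundary term at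
infinity vanishes because K_int f lies in ker p_int; the one at 0 is K_int f. -/
theorem integral_expNegTH_κ {f : τ.Fun} (hf : GradedSymm τ.gh f) (L : List I) (k : ℕ) :
    MeasureTheory.IntegrableOn
      (fun T : ℝ => PowerSeries.coeff k (τ.expNegTH T (τ.κₗ f) L)) (Set.Ioi 0) ∧
    ∫ T in Set.Ioi (0 : ℝ), PowerSeries.coeff k (τ.expNegTH T (τ.κₗ f) L) =
      PowerSeries.coeff k (τ.Kint f L) := by
  have hint : MeasureTheory.IntegrableOn
      (fun T : ℝ => PowerSeries.coeff k (τ.expNegTH T (τ.κₗ f) L)) (Set.Ioi 0) := by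
    obtain ⟨C, hC⟩ := τ.exists_expNegTH_bound (symm_κ hf) (τ.pInt_κ hf) L k
    have hexp : MeasureTheory.IntegrableOn (fun T : ℝ => C * Real.exp (-T / 2)) (Set.Ioi 0) := by
      have := (integrableOn_exp_mul_Ioi (a := -(1 / 2)) (by norm_num) 0).const_mul C
      refine this.congr (Filter.Eventually.of_forall fun T => ?_)
      simp only
      congr 2; ring
    refine hexp.mono' ?_ ?_
    · refine Continuous.aestronglyMeasurable ?_
      rw [continuous_iff_continuousAt]
      exact fun T => (τ.hasDerivAt_expNegTH T _ L k).continuousAt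
    · rw [MeasureTheory.ae_restrict_iff' measurableSet_Ioi]
      exact Filter.Eventually.of_forall fun T hT => hC T (le_of_lt hT)
  refine ⟨hint, ?_⟩
  have hd : ∀ T ∈ Set.Ici (0 : ℝ), HasDerivAt
      (fun T => -(PowerSeries.coeff k (τ.expNegTH T (τ.Kint f) L)))
      (PowerSeries.coeff k (τ.expNegTH T (τ.κₗ f) L)) T := by
    intro T _
    have := (τ.hasDerivAt_expNegTH T (τ.Kint f) L k).neg
    rw [τ.H_Kint hf, neg_neg] at this
    exact this
  have ht := (τ.tendsto_coeff_expNegTH (τ.symm_Kint hf) (τ.pInt_Kint hf) L k).neg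
  rw [MeasureTheory.integral_Ioi_of_hasDerivAt_of_tendsto' hd hint ht, expNegTH_zero]
  simp

end BVTheory

/-! ### Weights of variables and the exponential series -/

namespace SuperSeries

section Weights

variable {R V W : Type*} [CommRing R] {g : V → ℤ} {wt : V → ℤ}

/-- The series without Taylor coefficients of weight greater than `c`. -/
def WtLE (R : Type*) [CommRing R] (wt : V → ℤ) (c : ℤ) : Submodule R (SuperSeries R V) where
  carrier := {f | ∀ L, c < deg wt L → f L = 0}
  add_mem' := fun {f h} hf hh L hL => by simp [hf L hL, hh L hL]
  zero_mem' := fun L _ => rfl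
  smul_mem' := fun c f hf L hL => by simp [hf L hL]

theorem pderiv_mem_wtLE {c c' : ℤ} {f : SuperSeries R V} (hf : f ∈ WtLE R wt c) (v : V)
    (h : c ≤ c' + wt v) : pderiv v f ∈ WtLE R wt c' :=
  fun L hL => hf (v :: L) (by rw [deg_cons]; omega)

theorem twist_mem_wtLE {c : ℤ} {f : SuperSeries R V} (hf : f ∈ WtLE R wt c) (v : V) :
    twist g v f ∈ WtLE R wt c := fun L hL => by simp [twist, hf L hL]

theorem mul_mem_wtLE {a b c : ℤ} {f h : SuperSeries R V} (hf : f ∈ WtLE R wt a)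
    (hh : h ∈ WtLE R wt b) (hc : a + b = c) : mul g f h ∈ WtLE R wt c := by
  intro L
  induction L generalizing f h a b c with
  | nil =>
    intro hL
    rw [deg_nil] at hL
    rw [mul_nil]
    by_cases h1 : a < 0
    · rw [hf [] (by rwa [deg_nil]), MulZeroClass.zero_mul]
    · rw [hh [] (by rw [deg_nil]; omega), MulZeroClass.mul_zero]
  | cons v L ih =>
    intro hL
    rw [deg_cons] at hL
    rw [mul_cons, ih (pderiv_mem_wtLE hf v (c' := a - wt v) (by omega)) hh rfl (by omega),
      ih (twist_mem_wtLE hf v) (pderiv_mem_wtLE hh v (c' := b - wt v) (by omega)) rfl (by omega),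
      add_zero]

theorem one_mem_wtLE : (one : SuperSeries R V) ∈ WtLE R wt 0 := by
  intro L hL
  have : L ≠ [] := by rintro rfl; rw [deg_nil] at hL; omega
  simp [one, this]

theorem coord_mem_wtLE (v : V) : (coord v : SuperSeries R V) ∈ WtLE R wt (wt v) := by
  intro L hL
  have : L ≠ [v] := by rintro rfl; simp [deg] at hL
  simp [coord, this]

theorem pow_mem_wtLE {c : ℤ} {f : SuperSeries R V} (hf : f ∈ WtLE R wt c) (b : ℕ) :
    pow g f b ∈ WtLE R wt (b * c) := by
  induction b with
  | zero => rw [Nat.cast_zero, MulZeroClass.zero_mul]; exact one_mem_wtLE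
  | succ b ih => exact mul_mem_wtLE hf ih (by push_cast; ring)

theorem rename_mem_wtLE [Algebra ℂ R] [Fintype W] {φ : W → V} (hφ : Function.Injective φ)
    (hw : ∀ w, wt (φ w) = 0) (f : SuperSeries R W) : rename φ f ∈ WtLE R wt 0 := by
  intro L
  induction L generalizing f with
  | nil => intro hL; rw [deg_nil] at hL; omega
  | cons v L ih =>
    intro hL
    rw [deg_cons] at hL
    change pderiv v (rename φ f) L = 0
    by_cases hv : ∃ a, φ a = v
    · obtain ⟨a, rfl⟩ := hv
      rw [pderiv_rename hφ]
      exact ih _ (by rwa [hw, zero_add] at hL)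
    · push Not at hv
      rw [pderiv_rename_of_notMem _ hv]; rfl

end Weights

section Exp

variable {R V : Type*} [CommRing R] [Algebra ℂ R] {g : V → ℤ} {f : SuperSeries R V}

theorem Homog.pow (hf : Homog g 0 f) (b : ℕ) : Homog g 0 (pow g f b) := by
  induction b with
  | zero => exact homog_one
  | succ b ih => exact hf.mul' ih (add_zero 0)

theorem GradedSymm.pow (hf : GradedSymm g f) (b : ℕ) : GradedSymm g (pow g f b) := by
  induction b with
  | zero => exact gradedSymm_one
  | succ b ih => exact GradedSymm.mul hf ih

theorem Homog.twist_even (hf : Homog g 0 f) (v : V) : SuperSeries.twist g v f = f := by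
  rw [hf.twist]; simp

theorem mul_left_comm_even (hf : Homog g 0 f) (h k : SuperSeries R V) :
    mul g f (mul g h k) = mul g h (mul g f k) := by
  rw [← mul_assoc, mul_comm_even hf, mul_assoc]

theorem pderiv_pow (hf : Homog g 0 f) (v : V) (b : ℕ) :
    pderiv v (pow g f (b + 1)) = ((b + 1 : ℕ) : ℂ) • mul g (pderiv v f) (pow g f b) := by
  induction b with
  | zero =>
    change pderiv v (mul g f one) = ((0 + 1 : ℕ) : ℂ) • mul g (pderiv v f) one
    rw [pderiv_mul, pderiv_one, mul_zero, add_zero]; simp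
  | succ b ih =>
    rw [pow, pderiv_mul, ih, hf.twist_even, mul_smul, mul_left_comm_even hf,
      ← show pow g f (b + 1) = mul g f (pow g f b) from rfl]
    rw [show ((b + 1 + 1 : ℕ) : ℂ) = ((b + 1 : ℕ) : ℂ) + 1 by push_cast; ring, add_smul, one_smul,
      add_comm]

theorem deg_neg_one (L : List V) : deg (fun _ => (-1 : ℤ)) L = -(L.length : ℤ) := by
  induction L with
  | nil => rfl
  | cons v L ih => rw [deg_cons, ih, List.length_cons]; push_cast; ring

/-- With weight -1 on every variable an upper bound on weights is a lower bound on the order of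
vanishing, so the lemmas on weights also control powers of a series without constant term. -/
theorem mem_wtLE_neg_one (h0 : f [] = 0) : f ∈ WtLE R (fun _ : V => (-1 : ℤ)) (-1) := by
  intro L hL
  rw [deg_neg_one] at hL
  have : L = [] := List.length_eq_zero_iff.1 (by omega)
  rw [this, h0]

theorem pow_eq_zero_of_length_lt (h0 : f [] = 0) {b : ℕ} {L : List V} (hL : L.length < b) :
    pow g f b L = 0 := by
  refine pow_mem_wtLE (mem_wtLE_neg_one h0) b L ?_
  rw [deg_neg_one]; omega

theorem exp_apply_of_le (h0 : f [] = 0) {L : List V} {M : ℕ} (hM : L.length < M) :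
    exp g f L = (∑ b ∈ Finset.range M, ((b.factorial : ℂ)⁻¹) • pow g f b) L := by
  rw [Finset.sum_apply]
  refine Finset.sum_subset (Finset.range_mono hM) fun b _ hb => ?_
  rw [Finset.mem_range, not_lt] at hb
  rw [pow_eq_zero_of_length_lt h0 (by omega), smul_zero]

theorem exp_sub_mem_wtLE (h0 : f [] = 0) (M : ℕ) :
    exp g f - ∑ b ∈ Finset.range M, ((b.factorial : ℂ)⁻¹) • pow g f b ∈
      WtLE R (fun _ : V => (-1 : ℤ)) (-M) := by
  intro L hL
  rw [deg_neg_one] at hL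
  rw [Pi.sub_apply, exp_apply_of_le h0 (show L.length < M by omega), sub_self]

/-- The cutoff in `exp` depends on the length of the list, which the derivative changes. Both sides
are first rewritten with fixed cutoffs differing by one; then the factor b + 1 from the power rule
cancels against the factorial. -/
theorem pderiv_exp (hf : Homog g 0 f) (h0 : f [] = 0) (v : V) :
    pderiv v (exp g f) = mul g (pderiv v f) (exp g f) := by
  funext L
  have h1 : pderiv v (exp g f) L =
      (∑ b ∈ Finset.range (L.length + 2), ((b.factorial : ℂ)⁻¹) • pow g f b) (v :: L) :=
    exp_apply_of_le h0 (by simp)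
  have h2 : mul g (pderiv v f) (exp g f) L = mul g (pderiv v f)
      (∑ b ∈ Finset.range (L.length + 1), ((b.factorial : ℂ)⁻¹) • pow g f b) L := by
    have h3 : pderiv v f ∈ WtLE R (fun _ : V => (-1 : ℤ)) 0 := by
      intro L hL; rw [deg_neg_one] at hL; omega
    have h4 := mul_mem_wtLE (g := g) h3 (exp_sub_mem_wtLE (g := g) h0 (L.length + 1)) rfl L (by
      rw [deg_neg_one]; push_cast; omega)
    rwa [sub_eq_add_neg, mul_add, Pi.add_apply, ← neg_one_smul ℂ, mul_smul, neg_one_smul,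
      Pi.neg_apply, ← sub_eq_add_neg, sub_eq_zero] at h4
  rw [h1, h2, Finset.sum_range_succ', mul_sum, Pi.add_apply, Finset.sum_apply, Finset.sum_apply]
  have h5 : (((Nat.factorial 0 : ℕ) : ℂ)⁻¹ • pow g f 0) (v :: L) = 0 := by
    simp [pow, one]
  rw [h5, add_zero]
  refine Finset.sum_congr rfl fun b _ => ?_
  have h6 : pow g f (b + 1) (v :: L) = pderiv v (pow g f (b + 1)) L := rfl
  rw [Pi.smul_apply, h6, pderiv_pow hf, mul_smul, Pi.smul_apply, Pi.smul_apply, smul_smul,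
    Nat.factorial_succ]
  congr 1
  have : ((b : ℂ) + 1) ≠ 0 := by exact_mod_cast Nat.succ_ne_zero b
  push_cast
  field_simp

theorem exp_nil : exp g f [] = 1 := by
  simp [exp, pow, one]

theorem Homog.exp (hf : Homog g 0 f) : Homog g 0 (exp g f) := by
  intro L hL
  obtain ⟨b, -, hb⟩ := Finset.exists_ne_zero_of_sum_ne_zero hL
  exact hf.pow b L fun h => hb (by rw [h, smul_zero])

theorem GradedSymm.exp (hf : GradedSymm g f) : GradedSymm g (exp g f) := by
  intro L₁ v w L₂
  simp only [SuperSeries.exp, List.length_append, List.length_cons, Finset.smul_sum]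
  refine Finset.sum_congr rfl fun b _ => ?_
  rw [hf.pow b L₁ v w L₂, smul_comm]

theorem exp_mem_wtLE {wt : V → ℤ} (hf : f ∈ WtLE R wt 0) : exp g f ∈ WtLE R wt 0 := by
  intro L hL
  refine Finset.sum_eq_zero fun b _ => ?_
  rw [pow_mem_wtLE hf b L (by simpa using hL), smul_zero]

theorem foldr_mul (l : List (SuperSeries R V)) (f : SuperSeries R V) :
    l.foldr (mul g) f = mul g (l.foldr (mul g) one) f := by
  induction l with
  | nil => exact (one_mul f).symm
  | cons a l ih => rw [List.foldr_cons, ih, List.foldr_cons, mul_assoc]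

theorem rename_rename {U W : Type*} [Fintype U] [Fintype W] {φ : W → V} (hφ : Function.Injective φ)
    {ψ : U → W} (hψ : Function.Injective ψ) (f : SuperSeries R U) :
    rename φ (rename ψ f) = rename (φ ∘ ψ) f := by
  funext L
  induction L generalizing f with
  | nil => rfl
  | cons v L ih =>
    change pderiv v (rename φ (rename ψ f)) L = pderiv v (rename (φ ∘ ψ) f) L
    by_cases hv : ∃ a, φ a = v
    · obtain ⟨a, rfl⟩ := hv
      rw [pderiv_rename hφ]
      by_cases ha : ∃ u, ψ u = a
      · obtain ⟨u, rfl⟩ := ha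
        rw [pderiv_rename hψ, ih]
        have := pderiv_rename (R := R) (hφ.comp hψ) f u
        rw [Function.comp_apply] at this
        rw [this]
      · push Not at ha
        have := pderiv_rename_of_notMem (φ := φ ∘ ψ) f (v := φ a) fun u h => ha u (hφ h)
        rw [pderiv_rename_of_notMem _ ha, rename_zero, this]
    · push Not at hv
      have := pderiv_rename_of_notMem (φ := φ ∘ ψ) f (v := v) fun u => hv _
      rw [pderiv_rename_of_notMem _ hv, this]

end Exp

end SuperSeries

/-! ### Wick's theorem for a general step propagator -/

namespace BVTheory

section Wick

variable {I I' J : Type*} [Fintype I] [DecidableEq I] [Fintype I'] [DecidableEq I'] [Fintype J]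
variable {R : Type*} [CommRing R] [Algebra ℂ R]
variable (τ : BVTheory I I') {n : ℕ} {ħ : R} {θ : Option (Fin n) → Option (Fin n) → R} {gJ : J → ℤ}

/-- The number of momenta minus the number of boundary coordinates. -/
def pathWt : PathVar I J n → ℤ
  | .out _ => -1
  | .x _ _ => 0
  | .p _ _ => 1

theorem algebra_smul {R V : Type*} [CommRing R] [Algebra ℂ R] (z : ℂ) (F : SuperSeries R V) :
    z • F = algebraMap ℂ R z • F := (algebraMap_smul R z F).symm

/-- The contraction of `p_i(s)` with a function of `x`. -/
def leg (ħ : R) (θ : Option (Fin n) → Option (Fin n) → R) (s : Option (Fin n)) (i : I) :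
    SuperSeries R (PathVar I J n) →ₗ[R] SuperSeries R (PathVar I J n) where
  toFun F := ħ • ∑ s', θ s s' • pderiv (PathVar.x s' i) F
  map_add' F G := by simp only [pderiv_add, smul_add, Finset.sum_add_distrib]
  map_smul' c F := by
    simp only [pderiv_smul, RingHom.id_apply, Finset.smul_sum]
    refine Finset.sum_congr rfl fun s' _ => ?_
    rw [smul_comm (θ s s') c, smul_comm c (ħ)]

theorem leg_apply (s : Option (Fin n)) (i : I) (F : SuperSeries R (PathVar I J n)) :
    leg ħ θ s i F = ħ • ∑ s', θ s s' • pderiv (PathVar.x s' i) F := rfl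

/-- The sum of all single contractions. -/
def contractₗ (ħ : R) (θ : Option (Fin n) → Option (Fin n) → R) :
    SuperSeries R (PathVar I J n) →ₗ[R] SuperSeries R (PathVar I J n) where
  toFun F := ∑ s, ∑ i, leg ħ θ s i (pderiv (PathVar.p s i) F)
  map_add' F G := by simp only [pderiv_add, map_add, Finset.sum_add_distrib]
  map_smul' c F := by simp only [pderiv_smul, map_smul, RingHom.id_apply, Finset.smul_sum]

theorem contractₗ_apply (F : SuperSeries R (PathVar I J n)) :
    contractₗ ħ θ F = ∑ s, ∑ i, leg ħ θ s i (pderiv (PathVar.p s i) F) := rfl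

theorem map_units_smul {A B : Type*} [AddCommGroup A] [AddCommGroup B] {R : Type*} [Ring R]
    [Module R A] [Module R B] (f : A →ₗ[R] B) (c : ℤˣ) (a : A) : f (c • a) = c • f a := by
  rw [Units.smul_def, Units.smul_def, map_zsmul]

theorem gradedSymm_leg {F : SuperSeries R (PathVar I J n)} (hF : GradedSymm (τ.ghPath gJ) F) (s : Option (Fin n))
    (i : I) : GradedSymm (τ.ghPath gJ) (leg ħ θ s i F) := by
  rw [leg_apply]
  exact (GradedSymm.sum fun _ _ => (hF.pderiv _).smul _).smul _

theorem pderiv_leg {F : SuperSeries R (PathVar I J n)} (hF : GradedSymm (τ.ghPath gJ) F) (s : Option (Fin n))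
    (i : I) (v : PathVar I J n) :
    pderiv v (leg ħ θ s i F) = (τ.ghPath gJ v * τ.gh i).negOnePow • leg ħ θ s i (pderiv v F) := by
  rw [leg_apply, leg_apply, pderiv_smul, pderiv_sum, smul_comm,
    Finset.smul_sum (r := (τ.ghPath gJ v * τ.gh i).negOnePow)]
  refine congrArg (fun F : SuperSeries R (PathVar I J n) => ħ • F) (Finset.sum_congr rfl fun s' _ => ?_)
  rw [pderiv_smul, hF.pderiv_comm v, smul_comm]; rfl

theorem gradedSymm_contractₗ {F : SuperSeries R (PathVar I J n)} (hF : GradedSymm (τ.ghPath gJ) F) :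
    GradedSymm (τ.ghPath gJ) (contractₗ ħ θ F) := by
  rw [contractₗ_apply]
  exact GradedSymm.sum fun s _ => GradedSymm.sum fun i _ => τ.gradedSymm_leg (hF.pderiv _) s i

theorem negOnePow_cancel {a b : ℤ} (h : Even (a + b)) {A : Type*} [AddCommGroup A] (x : A) :
    a.negOnePow • b.negOnePow • x = x := by
  rw [smul_smul, ← Int.negOnePow_add, Int.negOnePow_even _ h, one_smul]

/-- Contraction is an even operator: x^i and p_i have opposite degrees, so the two Koszul signs
cancel. -/
theorem pderiv_contractₗ {F : SuperSeries R (PathVar I J n)} (hF : GradedSymm (τ.ghPath gJ) F)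
    (v : PathVar I J n) :
    pderiv v (contractₗ ħ θ F) = contractₗ ħ θ (pderiv v F) := by
  rw [contractₗ_apply, contractₗ_apply, pderiv_sum]
  refine Finset.sum_congr rfl fun s _ => ?_
  rw [pderiv_sum]
  refine Finset.sum_congr rfl fun i _ => ?_
  rw [τ.pderiv_leg (hF.pderiv _), hF.pderiv_comm v, map_units_smul]
  refine negOnePow_cancel ?_ _
  simp [ghPath]

theorem leg_contractₗ {F : SuperSeries R (PathVar I J n)} (hF : GradedSymm (τ.ghPath gJ) F) (s : Option (Fin n))
    (i : I) : leg ħ θ s i (contractₗ ħ θ F) = contractₗ ħ θ (leg ħ θ s i F) := by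
  rw [leg_apply, leg_apply, map_smul, map_sum]
  refine congrArg (fun F : SuperSeries R (PathVar I J n) => ħ • F) (Finset.sum_congr rfl fun s' _ => ?_)
  rw [τ.pderiv_contractₗ hF, map_smul]

theorem leg_coord_p_mul (s s' : Option (Fin n)) (i j : I) (F : SuperSeries R (PathVar I J n)) :
    leg ħ θ s i (mul (τ.ghPath gJ) (coord (PathVar.p s' j)) F) =
      (τ.gh i * τ.gh j).negOnePow •
        mul (τ.ghPath gJ) (coord (PathVar.p s' j)) (leg ħ θ s i F) := by
  rw [leg_apply, leg_apply, SuperSeries.mul_smul, mul_sum, smul_comm,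
    Finset.smul_sum (r := (τ.gh i * τ.gh j).negOnePow)]
  refine congrArg (fun F : SuperSeries R (PathVar I J n) => ħ • F) (Finset.sum_congr rfl fun r _ => ?_)
  rw [pderiv_mul, pderiv_coord_ne (by simp), SuperSeries.zero_mul, zero_add,
    (homog_coord _).twist, smul_mul, SuperSeries.mul_smul, smul_comm]
  refine congrArg (· • _) ?_
  apply negOnePow_congr
  simp only [ghPath]
  exact ⟨-(τ.gh i * τ.gh j), by ring⟩

/-- The commutator of the contraction with multiplication by a momentum is the contraction of that
momentum with the other factor. -/
theorem contractₗ_coord_p_mul (s : Option (Fin n)) (i : I) (F : SuperSeries R (PathVar I J n)) :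
    contractₗ ħ θ (mul (τ.ghPath gJ) (coord (PathVar.p s i)) F) =
      mul (τ.ghPath gJ) (coord (PathVar.p s i)) (contractₗ ħ θ F) + leg ħ θ s i F := by
  classical
  have key : ∀ s' j, leg ħ θ s' j (pderiv (PathVar.p s' j)
      (mul (τ.ghPath gJ) (coord (PathVar.p s i)) F)) =
      mul (τ.ghPath gJ) (coord (PathVar.p s i)) (leg ħ θ s' j (pderiv (PathVar.p s' j) F)) +
        if s' = s then if j = i then leg ħ θ s i F else 0 else 0 := by
    intro s' j
    rw [pderiv_mul, (homog_coord _).twist, smul_mul, map_add, map_units_smul, leg_coord_p_mul,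
      negOnePow_cancel (by simp [ghPath, ← _root_.two_mul]), add_comm]
    congr 1
    split_ifs with h1 h2
    · subst h1 h2; rw [pderiv_coord_self, SuperSeries.one_mul]
    · rw [pderiv_coord_ne (by simp [h2]), SuperSeries.zero_mul, map_zero]
    · rw [pderiv_coord_ne (by simp [h1]), SuperSeries.zero_mul, map_zero]
  rw [contractₗ_apply, contractₗ_apply, mul_sum]
  simp only [key, Finset.sum_add_distrib, mul_sum]
  congr 1
  rw [Finset.sum_comm]
  simp

theorem gradedSymm_contractₗ_pow {F : SuperSeries R (PathVar I J n)} (hF : GradedSymm (τ.ghPath gJ) F) (N : ℕ) :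
    GradedSymm (τ.ghPath gJ) ((contractₗ ħ θ ^ N) F) := by
  induction N with
  | zero => exact hF
  | succ N ih => rw [pow_succ', Module.End.mul_apply]; exact τ.gradedSymm_contractₗ ih

/-- The commutator with one contraction, `leg`, itself commutes with contractions; powers therefore
behave as under a derivation and give the factor N + 1. -/
theorem contractₗ_pow_coord_p_mul {F : SuperSeries R (PathVar I J n)} (hF : GradedSymm (τ.ghPath gJ) F)
    (s : Option (Fin n)) (i : I) (N : ℕ) :
    (contractₗ ħ θ ^ (N + 1)) (mul (τ.ghPath gJ) (coord (PathVar.p s i)) F) =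
      mul (τ.ghPath gJ) (coord (PathVar.p s i)) ((contractₗ ħ θ ^ (N + 1)) F) +
        ((N + 1 : ℕ) : R) • (contractₗ ħ θ ^ N) (leg ħ θ s i F) := by
  have hleg : ∀ N, leg ħ θ s i ((contractₗ ħ θ ^ N) F) =
      (contractₗ ħ θ ^ N) (leg ħ θ s i F) := by
    intro N
    induction N with
    | zero => rfl
    | succ N ih =>
      rw [pow_succ', Module.End.mul_apply, Module.End.mul_apply,
        τ.leg_contractₗ (τ.gradedSymm_contractₗ_pow hF N), ih]
  induction N with
  | zero => simp [contractₗ_coord_p_mul]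
  | succ N ih =>
    have hs : ∀ (M : ℕ) (G : SuperSeries R (PathVar I J n)), contractₗ ħ θ ((contractₗ ħ θ ^ M) G) = (contractₗ ħ θ ^ (M + 1)) G :=
      fun M G => by rw [pow_succ', Module.End.mul_apply]
    rw [← hs (N + 1), ih, map_add, contractₗ_coord_p_mul, map_smul, hleg, hs, hs, add_assoc]
    congr 1
    rw [Nat.cast_succ (N + 1), add_smul, one_smul, add_comm]

/-! Functions whose expectation value is a finite sum -/

theorem wtLE_mono {V : Type*} {wt : V → ℤ} {c c' : ℤ} (h : c ≤ c') {f : SuperSeries R V}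
    (hf : f ∈ WtLE R wt c) : f ∈ WtLE R wt c' := fun L hL => hf L (by omega)

variable (I J R n) in
/-- Functions with bounded powers of the momenta, relative to the boundary coordinates. -/
def Bdd : Submodule R (SuperSeries R (PathVar I J n)) where
  carrier := {F | ∃ c, F ∈ WtLE R pathWt c}
  zero_mem' := ⟨0, Submodule.zero_mem _⟩
  add_mem' := fun ⟨c, hc⟩ ⟨c', hc'⟩ =>
    ⟨max c c', Submodule.add_mem _ (wtLE_mono (le_max_left _ _) hc)
      (wtLE_mono (le_max_right _ _) hc')⟩
  smul_mem' := fun r _ ⟨c, hc⟩ => ⟨c, Submodule.smul_mem _ r hc⟩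

theorem bdd_mul {F G : SuperSeries R (PathVar I J n)} (hF : F ∈ Bdd I J R n) (hG : G ∈ Bdd I J R n) :
    mul (τ.ghPath gJ) F G ∈ Bdd I J R n :=
  let ⟨_, hc⟩ := hF; let ⟨_, hc'⟩ := hG; ⟨_, mul_mem_wtLE hc hc' rfl⟩

theorem leg_mem_wtLE {c : ℤ} {F : SuperSeries R (PathVar I J n)} (hF : F ∈ WtLE R pathWt c)
    (s : Option (Fin n)) (i : I) : leg ħ θ s i F ∈ WtLE R pathWt c :=
  Submodule.smul_mem _ _ (Submodule.sum_mem _ fun s' _ =>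
    Submodule.smul_mem _ _ (pderiv_mem_wtLE hF _ (by simp [pathWt])))

theorem bdd_leg {F : SuperSeries R (PathVar I J n)} (hF : F ∈ Bdd I J R n) (s : Option (Fin n)) (i : I) :
    leg ħ θ s i F ∈ Bdd I J R n := hF.imp fun _ h => leg_mem_wtLE h s i

theorem bdd_coord (v : PathVar I J n) : coord v ∈ Bdd I J R n := ⟨_, coord_mem_wtLE v⟩

theorem contractₗ_mem_wtLE {c : ℤ} {F : SuperSeries R (PathVar I J n)} (hF : F ∈ WtLE R pathWt c) :
    contractₗ ħ θ F ∈ WtLE R pathWt (c - 1) := by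
  rw [contractₗ_apply]
  exact Submodule.sum_mem _ fun s _ => Submodule.sum_mem _ fun i _ =>
    leg_mem_wtLE (pderiv_mem_wtLE hF _ (by simp [pathWt])) s i

theorem contractₗ_pow_mem_wtLE {c : ℤ} {F : SuperSeries R (PathVar I J n)} (hF : F ∈ WtLE R pathWt c)
    (N : ℕ) : (contractₗ ħ θ ^ N) F ∈ WtLE R pathWt (c - N) := by
  induction N with
  | zero => simpa using hF
  | succ N ih =>
    rw [pow_succ', Module.End.mul_apply]
    have := contractₗ_mem_wtLE (ħ := ħ) (θ := θ) ih
    rwa [show c - (N : ℤ) - 1 = c - ((N + 1 : ℕ) : ℤ) by push_cast; ring] at this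

theorem deg_pathWt_map_out (L : List J) :
    deg pathWt (L.map (PathVar.out : J → PathVar I J n)) = -(L.length : ℤ) := by
  induction L with
  | nil => rfl
  | cons v L ih => rw [List.map_cons, deg_cons, ih, List.length_cons]; simp [pathWt]

/-- The first `M` terms of Wick's theorem. -/
def wickTrunc (ħ : R) (θ : Option (Fin n) → Option (Fin n) → R) (M : ℕ) (L : List J) :
    SuperSeries R (PathVar I J n) →ₗ[R] R :=
  ∑ N ∈ Finset.range M, algebraMap ℂ R (N.factorial : ℂ)⁻¹ •
    LinearMap.proj (L.map PathVar.out) ∘ₗ (contractₗ ħ θ ^ N)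

theorem wickTrunc_apply (M : ℕ) (L : List J) (F : SuperSeries R (PathVar I J n)) :
    wickTrunc ħ θ M L F = ∑ N ∈ Finset.range M, algebraMap ℂ R (N.factorial : ℂ)⁻¹ *
      ((contractₗ ħ θ ^ N) F) (L.map PathVar.out) := by
  simp only [wickTrunc, LinearMap.sum_apply, LinearMap.smul_apply]; rfl

/-- Wick's theorem: the exponential of the contraction, at vanishing positions and momenta. -/
def wickSum (ħ : R) (θ : Option (Fin n) → Option (Fin n) → R) (F : SuperSeries R (PathVar I J n)) :
    SuperSeries R J :=
  fun L => ∑ᶠ N : ℕ, algebraMap ℂ R (N.factorial : ℂ)⁻¹ *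
    ((contractₗ ħ θ ^ N) F) (L.map PathVar.out)

/-- Each contraction removes a momentum and lowers the weight by one, while evaluation on boundary
variables sees only the weight minus their number. The boundary exponential has unboundedly many
momenta, but each comes with a boundary variable; this is why the weight is relative. -/
theorem wick_eq_wickTrunc {c : ℤ} {F : SuperSeries R (PathVar I J n)} (hF : F ∈ WtLE R pathWt c)
    {L : List J} {M : ℕ} (hM : c + L.length < M) : wickSum ħ θ F L = wickTrunc ħ θ M L F := by
  rw [wickTrunc_apply, wickSum]
  refine finsum_eq_sum_of_support_subset _ fun N hN => ?_
  rw [Finset.coe_range, Set.mem_Iio]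
  by_contra h
  refine hN ?_
  change algebraMap ℂ R (N.factorial : ℂ)⁻¹ *
    ((contractₗ ħ θ ^ N) F) (L.map PathVar.out) = 0
  rw [contractₗ_pow_mem_wtLE hF N _ (by rw [deg_pathWt_map_out]; omega), MulZeroClass.mul_zero]

/-- A common cutoff for all series involved: linearity of the expectation value can be read off from
the linear map `wickTrunc`. -/
theorem exists_wickTrunc {F G : SuperSeries R (PathVar I J n)} (hF : F ∈ Bdd I J R n) (hG : G ∈ Bdd I J R n)
    (L : List J) : ∃ M : ℕ, ∀ r : R, ∀ H ∈ ({F, G, F + G, r • F} : Set (SuperSeries R (PathVar I J n))),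
      wickSum ħ θ H L = wickTrunc ħ θ M L H := by
  obtain ⟨c, hc⟩ := hF
  obtain ⟨c', hc'⟩ := hG
  have h1 := wtLE_mono (le_max_left c c') hc
  have h2 := wtLE_mono (le_max_right c c') hc'
  refine ⟨(max c c' + L.length + 1).toNat, fun r H hH => ?_⟩
  refine wick_eq_wickTrunc (c := max c c') ?_ (by omega)
  rcases hH with rfl | rfl | rfl | rfl
  exacts [h1, h2, Submodule.add_mem _ h1 h2, Submodule.smul_mem _ _ h1]

theorem wick_add {F G : SuperSeries R (PathVar I J n)} (hF : F ∈ Bdd I J R n) (hG : G ∈ Bdd I J R n) :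
    wickSum ħ θ (F + G) = wickSum ħ θ F + wickSum ħ θ G := by
  funext L
  obtain ⟨M, hM⟩ := exists_wickTrunc (ħ := ħ) (θ := θ) hF hG L
  rw [Pi.add_apply, hM 0 F (by simp), hM 0 G (by simp), hM 0 (F + G) (by simp), map_add]

theorem wick_smul {F : SuperSeries R (PathVar I J n)} (hF : F ∈ Bdd I J R n) (r : R) :
    wickSum ħ θ (r • F) = r • wickSum ħ θ F := by
  funext L
  obtain ⟨M, hM⟩ := exists_wickTrunc (ħ := ħ) (θ := θ) hF hF L
  rw [Pi.smul_apply, hM r F (by simp), hM r (r • F) (by simp), map_smul]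

theorem wick_units_smul {F : SuperSeries R (PathVar I J n)} (hF : F ∈ Bdd I J R n) (c : ℤˣ) :
    wickSum ħ θ (c • F) = c • wickSum ħ θ F := by
  have h : c • F = ((c : ℤ) : R) • F := by rw [Units.smul_def, Int.cast_smul_eq_zsmul]
  rw [h, wick_smul hF, Int.cast_smul_eq_zsmul, ← Units.smul_def]

theorem wick_zero : wickSum ħ θ (0 : SuperSeries R (PathVar I J n)) = 0 := by
  have := wick_smul (ħ := ħ) (θ := θ) (Submodule.zero_mem (Bdd I J R n)) 0
  simpa using this

theorem wick_sum {α : Type*} (S : Finset α) {F : α → SuperSeries R (PathVar I J n)} (hF : ∀ a, F a ∈ Bdd I J R n) :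
    wickSum ħ θ (∑ a ∈ S, F a) = ∑ a ∈ S, wickSum ħ θ (F a) := by
  classical
  induction S using Finset.induction_on with
  | empty => simp [wick_zero]
  | insert a S ha ih =>
    rw [Finset.sum_insert ha, Finset.sum_insert ha,
      wick_add (hF a) (Submodule.sum_mem _ fun b _ => hF b), ih]

theorem wick_nil {F : SuperSeries R (PathVar I J n)} (hF : F ∈ WtLE R pathWt 0) :
    wickSum ħ θ F [] = F [] := by
  rw [wick_eq_wickTrunc hF (M := 1) (by simp), wickTrunc_apply]
  simp

theorem wick_cons {F : SuperSeries R (PathVar I J n)} (hF : GradedSymm (τ.ghPath gJ) F) (a : J) (L : List J) :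
    wickSum ħ θ F (a :: L) = wickSum ħ θ (pderiv (PathVar.out a) F) L := by
  have h : ∀ N, pderiv (PathVar.out a) ((contractₗ ħ θ ^ N) F) =
      (contractₗ ħ θ ^ N) (pderiv (PathVar.out a) F) := by
    intro N
    induction N with
    | zero => rfl
    | succ N ih =>
      rw [pow_succ', Module.End.mul_apply, Module.End.mul_apply,
        τ.pderiv_contractₗ (τ.gradedSymm_contractₗ_pow hF N), ih]
  simp only [wickSum, ← h]
  rfl

theorem coord_p_mul_map_out (s : Option (Fin n)) (i : I) (F : SuperSeries R (PathVar I J n)) (L : List J) :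
    mul (τ.ghPath gJ) (coord (PathVar.p s i)) F (L.map PathVar.out) = 0 := by
  induction L generalizing F with
  | nil => rw [List.map_nil, mul_nil, coord_nil, MulZeroClass.zero_mul]
  | cons a L ih =>
    rw [List.map_cons, mul_cons, pderiv_coord_ne (by simp), SuperSeries.zero_mul,
      (homog_coord _).twist, smul_mul, Pi.smul_apply, ih, smul_zero]; simp

/-- The recursive form of Wick's theorem. Summed with 1/N!, the commutators say that exp(C)p = p
exp(C) + exp(C) leg for the contraction C, and the term with p on the left vanishes at zero
momentum. -/
theorem wick_coord_p_mul {F : SuperSeries R (PathVar I J n)} (hF : GradedSymm (τ.ghPath gJ) F)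
    (hF' : F ∈ Bdd I J R n) (s : Option (Fin n)) (i : I) :
    wickSum ħ θ (mul (τ.ghPath gJ) (coord (PathVar.p s i)) F) = wickSum ħ θ (leg ħ θ s i F) := by
  obtain ⟨c, hc⟩ := hF'
  funext L
  set M := (c + L.length + 1).toNat with hM
  rw [wick_eq_wickTrunc (M := M + 1) (mul_mem_wtLE (coord_mem_wtLE _) hc rfl)
      (by simp only [pathWt]; omega),
    wick_eq_wickTrunc (M := M) (leg_mem_wtLE hc s i) (by omega), wickTrunc_apply,
    wickTrunc_apply, Finset.sum_range_succ']
  rw [pow_zero, Module.End.one_apply, coord_p_mul_map_out, MulZeroClass.mul_zero, add_zero]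
  refine Finset.sum_congr rfl fun N _ => ?_
  rw [τ.contractₗ_pow_coord_p_mul hF, Pi.add_apply, coord_p_mul_map_out, zero_add, Pi.smul_apply,
    smul_eq_mul, ← _root_.mul_assoc, ← map_natCast (algebraMap ℂ R), ← _root_.map_mul,
    Nat.factorial_succ]
  have : ((N : ℂ) + 1) ≠ 0 := by exact_mod_cast Nat.succ_ne_zero N
  congr 2
  push_cast
  field_simp

/-! Moving momenta past functions of later positions -/

/-- Independence of the positions before the time `s`. -/
def IndepBefore (θ : Option (Fin n) → Option (Fin n) → R) (s : Option (Fin n)) (F : SuperSeries R (PathVar I J n)) : Prop :=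
  ∀ s' j, θ s s' ≠ 0 → pderiv (PathVar.x s' j) F = 0

theorem pderiv_mul_eq_zero {V R : Type*} [CommRing R] {g : V → ℤ} {F G : SuperSeries R V} {v : V}
    (hF : pderiv v F = 0) (hG : pderiv v G = 0) : pderiv v (mul g F G) = 0 := by
  rw [pderiv_mul, hF, hG, SuperSeries.zero_mul, SuperSeries.mul_zero, add_zero]

theorem IndepBefore.mul {s : Option (Fin n)} {F G : SuperSeries R (PathVar I J n)} (hF : IndepBefore θ s F)
    (hG : IndepBefore θ s G) : IndepBefore θ s (SuperSeries.mul (τ.ghPath gJ) F G) :=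
  fun s' j h => pderiv_mul_eq_zero (hF s' j h) (hG s' j h)

theorem leg_mul {s : Option (Fin n)} {A : SuperSeries R (PathVar I J n)} (hA : IndepBefore θ s A) {e : ℤ}
    (hA' : Homog (τ.ghPath gJ) e A) (F : SuperSeries R (PathVar I J n)) (i : I) :
    leg ħ θ s i (mul (τ.ghPath gJ) A F) =
      (τ.gh i * e).negOnePow • mul (τ.ghPath gJ) A (leg ħ θ s i F) := by
  rw [leg_apply, leg_apply, SuperSeries.mul_smul, mul_sum, smul_comm,
    Finset.smul_sum (r := (τ.gh i * e).negOnePow)]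
  refine congrArg (fun F : SuperSeries R (PathVar I J n) => ħ • F) (Finset.sum_congr rfl fun s' _ => ?_)
  by_cases h : θ s s' = 0
  · simp [h]
  · rw [pderiv_mul, hA s' i h, SuperSeries.zero_mul, zero_add, hA'.twist, smul_mul,
      SuperSeries.mul_smul, smul_comm]
    rfl

/-- Move the momentum to the far left, contract it, and move the contraction back past A, on which
it acts trivially; the two signs cancel. -/
theorem wick_mul_coord_p_mul {s : Option (Fin n)} {A F : SuperSeries R (PathVar I J n)}
    (hA : IndepBefore θ s A) {e : ℤ} (hA' : Homog (τ.ghPath gJ) e A)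
    (hAs : GradedSymm (τ.ghPath gJ) A) (hFs : GradedSymm (τ.ghPath gJ) F)
    (hAb : A ∈ Bdd I J R n) (hFb : F ∈ Bdd I J R n) (i : I) :
    wickSum ħ θ (mul (τ.ghPath gJ) A (mul (τ.ghPath gJ) (coord (PathVar.p s i)) F)) =
      wickSum ħ θ (mul (τ.ghPath gJ) A (leg ħ θ s i F)) := by
  rw [mul_left_comm_homog hA' (homog_coord _),
    wick_units_smul (τ.bdd_mul (bdd_coord _) (τ.bdd_mul hAb hFb)),
    τ.wick_coord_p_mul (hAs.mul hFs) (τ.bdd_mul hAb hFb), τ.leg_mul hA hA',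
    wick_units_smul (τ.bdd_mul hAb (bdd_leg hFb s i)), negOnePow_cancel]
  simp only [ghPath]
  exact ⟨0, by ring⟩

end Wick

end BVTheory

/-! ### Time-ordered chains of vertices -/

namespace BVTheory

section Chain

variable {I I' J : Type*} [Fintype I] [DecidableEq I] [Fintype I'] [DecidableEq I'] [Fintype J]
variable {R : Type*} [CommRing R] [Algebra ℂ R]
variable (τ : BVTheory I I') {n : ℕ} {ħ : R} {θ : Option (Fin n) → Option (Fin n) → R} {gJ : J → ℤ}

/-! Restriction to coinciding positions -/

/-- Taylor coefficients of the restriction to coinciding positions. -/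
def diagCoeff : List I → SuperSeries R (PathVar I J n) → R
  | [], F => F []
  | i :: L, F => diagCoeff L (∑ s, pderiv (PathVar.x s i) F)

theorem diagCoeff_add (L : List I) (F G : SuperSeries R (PathVar I J n)) :
    diagCoeff L (F + G) = diagCoeff L F + diagCoeff L G := by
  induction L generalizing F G with
  | nil => rfl
  | cons i L ih => simp only [diagCoeff, pderiv_add, Finset.sum_add_distrib, ih]

theorem diagCoeff_smul (L : List I) (c : R) (F : SuperSeries R (PathVar I J n)) :
    diagCoeff L (c • F) = c * diagCoeff L F := by
  induction L generalizing F with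
  | nil => rfl
  | cons i L ih => simp only [diagCoeff, pderiv_smul, ← Finset.smul_sum, ih]

/-- Restriction to coinciding positions and vanishing momenta and boundary value. -/
def diag : SuperSeries R (PathVar I J n) →ₗ[R] SuperSeries R I where
  toFun F := fun L => diagCoeff L F
  map_add' F G := funext fun L => diagCoeff_add L F G
  map_smul' c F := funext fun L => diagCoeff_smul L c F

theorem diag_nil (F : SuperSeries R (PathVar I J n)) : diag F [] = F [] := rfl

theorem pderiv_diag (i : I) (F : SuperSeries R (PathVar I J n)) :
    pderiv i (diag F) = diag (∑ s, pderiv (PathVar.x s i) F) := rfl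

theorem diag_twist {v : PathVar I J n} {i : I} (hv : τ.ghPath gJ v = τ.gh i)
    (F : SuperSeries R (PathVar I J n)) :
    diag (twist (τ.ghPath gJ) v F) = twist τ.gh i (diag F) := by
  funext L
  induction L generalizing F with
  | nil => simp [diag_nil, twist_apply, deg_nil]
  | cons j L ih =>
    change pderiv j (diag (twist (τ.ghPath gJ) v F)) L = pderiv j (twist τ.gh i (diag F)) L
    rw [pderiv_diag, pderiv_twist, pderiv_diag]
    have : ∑ s, pderiv (PathVar.x s j) (twist (τ.ghPath gJ) v F) = (τ.gh i * τ.gh j).negOnePow •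
        twist (τ.ghPath gJ) v (∑ s, pderiv (PathVar.x s j) F) := by
      rw [twist_sum, Finset.smul_sum]
      refine Finset.sum_congr rfl fun s _ => ?_
      rw [pderiv_twist, hv]; rfl
    rw [this, map_units_smul, Pi.smul_apply, Pi.smul_apply, ih]

theorem diag_mul (F G : SuperSeries R (PathVar I J n)) :
    diag (mul (τ.ghPath gJ) F G) = mul τ.gh (diag F) (diag G) := by
  funext L
  induction L generalizing F G with
  | nil => rfl
  | cons j L ih =>
    change pderiv j (diag (mul (τ.ghPath gJ) F G)) L = pderiv j (mul τ.gh (diag F) (diag G)) L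
    simp only [pderiv_diag, pderiv_mul, Finset.sum_add_distrib, map_add, map_sum, Pi.add_apply,
      sum_mul, mul_sum, Finset.sum_apply, ih]
    refine congrArg (_ + ·) (Finset.sum_congr rfl fun s _ => ?_)
    rw [τ.diag_twist (i := j) rfl]

theorem x_injective (s : Option (Fin n)) :
    Function.Injective (PathVar.x s : I → PathVar I J n) := fun a b h => by simpa using h

theorem pderiv_x_rename_ne {s s' : Option (Fin n)} (h : s ≠ s') (i : I) (f : SuperSeries R I) :
    pderiv (PathVar.x s' i : PathVar I J n) (rename (PathVar.x s) f) = 0 :=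
  pderiv_rename_of_notMem _ fun j hj => h (by simp at hj; exact hj.1)

theorem diag_rename (s : Option (Fin n)) (f : SuperSeries R I) :
    diag (rename (PathVar.x s) f : SuperSeries R (PathVar I J n)) = f := by
  funext L
  induction L generalizing f with
  | nil => rfl
  | cons j L ih =>
    change pderiv j (diag (rename (PathVar.x s) f : SuperSeries R (PathVar I J n))) L = _
    rw [pderiv_diag, Finset.sum_eq_single s]
    · rw [pderiv_rename (x_injective s), ih]; rfl
    · intro s' _ hs'; exact pderiv_x_rename_ne hs'.symm j f
    · simp

/-! Functions of the positions -/

/-- Formal functions of the positions. -/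
structure IsPosition (gJ : J → ℤ) (F : SuperSeries R (PathVar I J n)) : Prop where
  symm : GradedSymm (τ.ghPath gJ) F
  wt : F ∈ WtLE R pathWt 0
  out : ∀ a, pderiv (PathVar.out a) F = 0

theorem gradedSymm_rename_x {f : SuperSeries R I} (hf : GradedSymm τ.gh f)
    (s : Option (Fin n)) : GradedSymm (τ.ghPath gJ) (rename (PathVar.x s) f) :=
  hf.rename (g := τ.ghPath gJ) fun _ => rfl

theorem homog_rename_x {f : SuperSeries R I} {e : ℤ} (hf : Homog τ.gh e f)
    (s : Option (Fin n)) : Homog (τ.ghPath gJ) e (rename (PathVar.x s) f) :=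
  hf.rename (g := τ.ghPath gJ) (x_injective s) fun _ => rfl

variable {τ} {F G : SuperSeries R (PathVar I J n)}

theorem IsPosition.add (hF : τ.IsPosition gJ F) (hG : τ.IsPosition gJ G) :
    τ.IsPosition gJ (F + G) :=
  ⟨hF.symm.add hG.symm, Submodule.add_mem _ hF.wt hG.wt, fun a => by
    rw [pderiv_add, hF.out, hG.out, add_zero]⟩

theorem IsPosition.zero : τ.IsPosition gJ (0 : SuperSeries R (PathVar I J n)) :=
  ⟨GradedSymm.zero, Submodule.zero_mem _, fun _ => rfl⟩

theorem IsPosition.smul (hF : τ.IsPosition gJ F) (c : R) : τ.IsPosition gJ (c • F) :=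
  ⟨hF.symm.smul c, Submodule.smul_mem _ _ hF.wt, fun a => by
    rw [pderiv_smul, hF.out, smul_zero]⟩

theorem IsPosition.sum {α : Type*} {S : Finset α} {F : α → SuperSeries R (PathVar I J n)}
    (hF : ∀ a ∈ S, τ.IsPosition gJ (F a)) : τ.IsPosition gJ (∑ a ∈ S, F a) :=
  Finset.sum_induction F (τ.IsPosition gJ) (fun _ _ => IsPosition.add) IsPosition.zero hF

theorem IsPosition.mul (hF : τ.IsPosition gJ F) (hG : τ.IsPosition gJ G) :
    τ.IsPosition gJ (SuperSeries.mul (τ.ghPath gJ) F G) :=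
  ⟨hF.symm.mul hG.symm, mul_mem_wtLE hF.wt hG.wt (add_zero 0), fun a =>
    pderiv_mul_eq_zero (hF.out a) (hG.out a)⟩

theorem IsPosition.pderiv_x (hF : τ.IsPosition gJ F) (s : Option (Fin n)) (i : I) :
    τ.IsPosition gJ (pderiv (PathVar.x s i) F) :=
  ⟨hF.symm.pderiv _, pderiv_mem_wtLE hF.wt _ (by simp [pathWt]), fun a => by
    rw [hF.symm.pderiv_comm, hF.out, pderiv_zero, smul_zero]⟩

theorem IsPosition.leg (hF : τ.IsPosition gJ F) (s : Option (Fin n)) (i : I) :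
    τ.IsPosition gJ (leg ħ θ s i F) := by
  rw [leg_apply]
  exact (IsPosition.sum fun s' _ => (hF.pderiv_x s' i).smul _).smul _

theorem IsPosition.rename {f : SuperSeries R I} (hf : GradedSymm τ.gh f) (s : Option (Fin n)) :
    τ.IsPosition gJ (SuperSeries.rename (PathVar.x s) f) :=
  ⟨τ.gradedSymm_rename_x hf s, rename_mem_wtLE (x_injective s) (fun _ => rfl) f, fun a =>
    pderiv_rename_of_notMem _ fun _ => by simp⟩

theorem IsPosition.bdd (hF : τ.IsPosition gJ F) : F ∈ Bdd I J R n := ⟨0, hF.wt⟩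

/-- The function depends on the positions at times before `s` only. -/
def DependsBefore (θ : Option (Fin n) → Option (Fin n) → R) (s : Option (Fin n))
    (F : SuperSeries R (PathVar I J n)) : Prop :=
  ∀ s', θ s s' = 1 ∨ ∀ i, pderiv (PathVar.x s' i) F = 0

theorem DependsBefore.leg_eq {s : Option (Fin n)} (hF : DependsBefore θ s F) (i : I) :
    leg ħ θ s i F = ħ • ∑ s', pderiv (PathVar.x s' i) F := by
  rw [leg_apply]
  refine congrArg (fun F : SuperSeries R (PathVar I J n) => ħ • F)
    (Finset.sum_congr rfl fun s' _ => ?_)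
  rcases hF s' with h | h
  · rw [h, one_smul]
  · rw [h, smul_zero]

/-- All step functions that matter equal 1, and the sum of the derivatives at all times is the
derivative of the restriction to the diagonal. -/
theorem DependsBefore.diag_leg {s : Option (Fin n)} (hF : DependsBefore θ s F) (i : I) :
    diag (leg ħ θ s i F) = ħ • pderiv i (diag F) := by
  rw [hF.leg_eq, map_smul, pderiv_diag]

theorem pderiv_leg_eq_zero (hF : τ.IsPosition gJ F) {v : PathVar I J n} (h : pderiv v F = 0)
    (s : Option (Fin n)) (i : I) : pderiv v (leg ħ θ s i F) = 0 := by
  rw [τ.pderiv_leg hF.symm, h, map_zero, smul_zero]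

variable (τ)

/-! The boundary term -/

/-- The boundary term, with `u` in place of `i/ħ`. -/
def boundaryTerm (gJ : J → ℤ) (b : I → J → ℂ) (n : ℕ) (u : R) : SuperSeries R (PathVar I J n) :=
  u • ∑ i, ∑ a, algebraMap ℂ R (b i a) •
    mul (τ.ghPath gJ) (coord (PathVar.out a)) (coord (PathVar.p none i))

variable {b : I → J → ℂ} {u : R}

theorem homog_boundaryTerm (hb : ∀ i a, b i a ≠ 0 → τ.gh i = gJ a) :
    Homog (τ.ghPath gJ) 0 (τ.boundaryTerm gJ b n u) := by
  refine (Homog.sum fun i _ => Homog.sum fun a _ => ?_).smul u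
  refine Homog.smul_of_ne fun h => (homog_coord _).mul' (homog_coord _) ?_
  have := hb i a fun h0 => h (by rw [h0, map_zero])
  simp [ghPath, this]

theorem gradedSymm_boundaryTerm : GradedSymm (τ.ghPath gJ) (τ.boundaryTerm gJ b n u) :=
  (GradedSymm.sum fun i _ => GradedSymm.sum fun a _ =>
    ((gradedSymm_coord _).mul (gradedSymm_coord _)).smul _).smul u

theorem boundaryTerm_mem_wtLE : τ.boundaryTerm gJ b n u ∈ WtLE R pathWt 0 :=
  Submodule.smul_mem _ _ (Submodule.sum_mem _ fun i _ => Submodule.sum_mem _ fun a _ =>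
    Submodule.smul_mem _ _ (mul_mem_wtLE (coord_mem_wtLE _) (coord_mem_wtLE _) (by simp [pathWt])))

theorem boundaryTerm_nil : τ.boundaryTerm gJ b n u [] = 0 := by
  simp [boundaryTerm, Finset.sum_apply, mul_nil, coord_nil]

theorem pderiv_x_boundaryTerm (s : Option (Fin n)) (i : I) :
    pderiv (PathVar.x s i) (τ.boundaryTerm gJ b n u) = 0 := by
  simp only [boundaryTerm, pderiv_smul, pderiv_sum]
  rw [Finset.sum_eq_zero, smul_zero]
  refine fun j _ => Finset.sum_eq_zero fun a _ => ?_
  rw [pderiv_mul_eq_zero (pderiv_coord_ne (by simp)) (pderiv_coord_ne (by simp)), smul_zero]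

theorem pderiv_out_boundaryTerm (a : J) :
    pderiv (PathVar.out a) (τ.boundaryTerm gJ b n u) =
      u • ∑ i, algebraMap ℂ R (b i a) • coord (PathVar.p none i) := by
  rw [boundaryTerm, pderiv_smul, pderiv_sum]
  refine congrArg (fun F : SuperSeries R (PathVar I J n) => u • F)
    (Finset.sum_congr rfl fun i _ => ?_)
  rw [pderiv_sum, Finset.sum_eq_single a]
  · rw [pderiv_smul, pderiv_mul, pderiv_coord_self, SuperSeries.one_mul,
      pderiv_coord_ne (v := PathVar.p none i) (by simp), SuperSeries.mul_zero, add_zero]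
  · intro c _ hc
    rw [pderiv_smul, pderiv_mul_eq_zero (pderiv_coord_ne (by simp [hc.symm]))
      (pderiv_coord_ne (by simp)), smul_zero]
  · simp

theorem indepBefore_exp (hb : ∀ i a, b i a ≠ 0 → τ.gh i = gJ a) (s : Option (Fin n)) :
    IndepBefore θ s (SuperSeries.exp (τ.ghPath gJ) (τ.boundaryTerm gJ b n u)) := fun s' j _ => by
  rw [pderiv_exp (τ.homog_boundaryTerm hb) τ.boundaryTerm_nil, pderiv_x_boundaryTerm,
    SuperSeries.zero_mul]

/-- A derivative in y^a brings down u ∑ b^i_a p_i(T); contracting p_i(T) with all earlier positions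
gives ħ∂_i, and uħ = 1. So the exponential is the translation from x = 0 to x = b(y). -/
theorem wickSum_exp_mul (hb : ∀ i a, b i a ≠ 0 → τ.gh i = gJ a) (hu : u * ħ = 1)
    (hθ : ∀ s, θ none s = 1) {X : SuperSeries R (PathVar I J n)} (hX : τ.IsPosition gJ X) :
    wickSum ħ θ (mul (τ.ghPath gJ) (SuperSeries.exp (τ.ghPath gJ) (τ.boundaryTerm gJ b n u)) X) =
      pullback b (diag X) := by
  have hE := τ.homog_boundaryTerm (n := n) (u := u) hb
  have hEs : GradedSymm (τ.ghPath gJ) (SuperSeries.exp (τ.ghPath gJ) (τ.boundaryTerm gJ b n u)) :=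
    τ.gradedSymm_boundaryTerm.exp
  have hEw := exp_mem_wtLE (g := τ.ghPath gJ) (τ.boundaryTerm_mem_wtLE (gJ := gJ) (b := b) (n := n)
    (u := u))
  funext L
  induction L generalizing X with
  | nil =>
    rw [wick_nil (mul_mem_wtLE hEw hX.wt (add_zero 0)), mul_nil, exp_nil, _root_.one_mul]; rfl
  | cons a L ih =>
    set E := SuperSeries.exp (τ.ghPath gJ) (τ.boundaryTerm gJ b n u) with hEdef
    have hEX : mul (τ.ghPath gJ) E X ∈ Bdd I J R n := τ.bdd_mul ⟨0, hEw⟩ hX.bdd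
    have h1 : ∀ i, wickSum ħ θ (mul (τ.ghPath gJ) (coord (PathVar.p none i))
        (mul (τ.ghPath gJ) E X)) L = ħ * pullback b (pderiv i (diag X)) L := by
      intro i
      have hX' : τ.IsPosition gJ (∑ s, pderiv (PathVar.x s i) X) :=
        IsPosition.sum fun s _ => hX.pderiv_x s i
      rw [τ.wick_coord_p_mul (hEs.mul hX.symm) hEX, τ.leg_mul (τ.indepBefore_exp hb none) hE.exp,
        DependsBefore.leg_eq fun s' => Or.inl (hθ s'), SuperSeries.mul_smul]
      simp only [MulZeroClass.mul_zero, Int.negOnePow_zero, one_smul]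
      rw [wick_smul (τ.bdd_mul ⟨0, hEw⟩ hX'.bdd), Pi.smul_apply, ih hX']
      rfl
    rw [τ.wick_cons (hEs.mul hX.symm), pderiv_mul, hX.out, SuperSeries.mul_zero, add_zero, hEdef,
      pderiv_exp hE τ.boundaryTerm_nil, ← hEdef, SuperSeries.mul_assoc, pderiv_out_boundaryTerm, smul_mul,
      sum_mul]
    have h2 : ∀ i, mul (τ.ghPath gJ) (algebraMap ℂ R (b i a) • coord (PathVar.p none i))
        (mul (τ.ghPath gJ) E X) ∈ Bdd I J R n := fun i =>
      τ.bdd_mul (Submodule.smul_mem _ _ (bdd_coord _)) hEX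
    rw [wick_smul (Submodule.sum_mem _ fun i _ => h2 i), wick_sum _ h2, Pi.smul_apply,
      Finset.sum_apply, pullback_cons, smul_eq_mul, Finset.mul_sum]
    refine Finset.sum_congr rfl fun i _ => ?_
    rw [smul_mul, wick_smul (τ.bdd_mul (bdd_coord _) hEX), Pi.smul_apply, h1, Algebra.smul_def (b i a),
      smul_eq_mul, mul_left_comm, ← _root_.mul_assoc u, hu, _root_.one_mul]

/-! The vertices -/

/-- A vertex quadratic in the momenta. -/
def vertexTerm (gJ : J → ℤ) (A : I → SuperSeries ℂ I) (B : I → I → ℂ) (e : R) (s : Fin n) :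
    SuperSeries R (PathVar I J n) :=
  e • (∑ j, mul (τ.ghPath gJ) (rename (PathVar.x (some s)) (lift R (A j)))
      (coord (PathVar.p (some s) j)) +
    ∑ i, ∑ j, algebraMap ℂ R (B i j) •
      mul (τ.ghPath gJ) (coord (PathVar.p (some s) i)) (coord (PathVar.p (some s) j)))

/-- The result of contracting the momenta of a vertex with a function of earlier positions. -/
def vertexAction (gJ : J → ℤ) (A : I → SuperSeries ℂ I) (B : I → I → ℂ) (e ħ : R)
    (θ : Option (Fin n) → Option (Fin n) → R) (s : Fin n) (X : SuperSeries R (PathVar I J n)) :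
    SuperSeries R (PathVar I J n) :=
  e • (∑ j, mul (τ.ghPath gJ) (rename (PathVar.x (some s)) (lift R (A j))) (leg ħ θ (some s) j X) +
    ∑ i, ∑ j, algebraMap ℂ R (B i j) • leg ħ θ (some s) i (leg ħ θ (some s) j X))

/-- The second order differential operator with symbol `∑ A_j p_j + ∑ B_ij p_i p_j`. -/
def symbolOp (A : I → SuperSeries ℂ I) (B : I → I → ℂ) (ħ : R) (f : SuperSeries R I) :
    SuperSeries R I :=
  ∑ j, mul τ.gh (lift R (A j)) (pderiv j f) +
    ħ • ∑ i, ∑ j, algebraMap ℂ R (B i j) • pderiv i (pderiv j f)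

theorem leg_leg_comm {X : SuperSeries R (PathVar I J n)} (hX : GradedSymm (τ.ghPath gJ) X)
    (s : Option (Fin n)) (i j : I) :
    leg ħ θ s j (leg ħ θ s i X) = (τ.gh i * τ.gh j).negOnePow • leg ħ θ s i (leg ħ θ s j X) := by
  rw [leg_apply (i := j), leg_apply (i := j), map_smul, map_sum, smul_comm,
    Finset.smul_sum (r := (τ.gh i * τ.gh j).negOnePow)]
  refine congrArg (fun F : SuperSeries R (PathVar I J n) => ħ • F)
    (Finset.sum_congr rfl fun s' _ => ?_)
  rw [τ.pderiv_leg hX, map_smul, smul_comm, _root_.mul_comm]; rfl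

variable {A : I → SuperSeries ℂ I} {B : I → I → ℂ} {e : R}

theorem homog_vertexTerm (hA : ∀ j, Homog τ.gh (τ.gh j) (A j))
    (hB : ∀ i j, B i j ≠ 0 → τ.gh i + τ.gh j = 0) (s : Fin n) :
    Homog (τ.ghPath gJ) 0 (τ.vertexTerm gJ A B e s) := by
  refine Homog.smul ((Homog.sum fun j _ => ?_).add
    (Homog.sum fun i _ => Homog.sum fun j _ => Homog.smul_of_ne fun h => ?_)) e
  · exact (τ.homog_rename_x (hA j).lift _).mul' (homog_coord _) (by simp [ghPath])
  · refine (homog_coord _).mul' (homog_coord _) ?_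
    have := hB i j fun h0 => h (by rw [h0, map_zero])
    simp only [ghPath]; omega

theorem gradedSymm_vertexTerm (hA : ∀ j, GradedSymm τ.gh (A j)) (s : Fin n) :
    GradedSymm (τ.ghPath gJ) (τ.vertexTerm gJ A B e s) :=
  ((GradedSymm.sum fun j _ => (τ.gradedSymm_rename_x (hA j).lift _).mul (gradedSymm_coord _)).add
    (GradedSymm.sum fun i _ => GradedSymm.sum fun j _ =>
      ((gradedSymm_coord _).mul (gradedSymm_coord _)).smul _)).smul e

theorem bdd_rename (s : Option (Fin n)) (f : SuperSeries R I) :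
    (rename (PathVar.x s) f : SuperSeries R (PathVar I J n)) ∈ Bdd I J R n :=
  ⟨0, rename_mem_wtLE (x_injective s) (fun _ => rfl) f⟩

theorem bdd_vertexTerm (s : Fin n) : τ.vertexTerm gJ A B e s ∈ Bdd I J R n :=
  Submodule.smul_mem _ _ (Submodule.add_mem _
    (Submodule.sum_mem _ fun j _ => τ.bdd_mul (bdd_rename _ _) (bdd_coord _))
    (Submodule.sum_mem _ fun i _ => Submodule.sum_mem _ fun j _ =>
      Submodule.smul_mem _ _ (τ.bdd_mul (bdd_coord _) (bdd_coord _))))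

theorem pderiv_x_vertexTerm {s : Fin n} {s' : Option (Fin n)} (h : some s ≠ s') (i : I) :
    pderiv (PathVar.x s' i) (τ.vertexTerm gJ A B e s) = 0 := by
  simp only [vertexTerm, pderiv_smul, pderiv_sum, pderiv_add]
  rw [Finset.sum_eq_zero, Finset.sum_eq_zero, add_zero, smul_zero]
  · refine fun j _ => Finset.sum_eq_zero fun a _ => ?_
    rw [pderiv_mul_eq_zero (pderiv_coord_ne (by simp)) (pderiv_coord_ne (by simp)), smul_zero]
  · exact fun j _ => pderiv_mul_eq_zero (pderiv_x_rename_ne h i _) (pderiv_coord_ne (by simp))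

theorem isPosition_vertexAction (hA : ∀ j, GradedSymm τ.gh (A j)) (s : Fin n)
    {X : SuperSeries R (PathVar I J n)} (hX : τ.IsPosition gJ X) :
    τ.IsPosition gJ (τ.vertexAction gJ A B e ħ θ s X) :=
  ((IsPosition.sum fun j _ => (IsPosition.rename (hA j).lift _).mul (hX.leg _ j)).add
    (IsPosition.sum fun i _ => IsPosition.sum fun j _ => ((hX.leg _ j).leg _ i).smul _)).smul e

theorem pderiv_x_vertexAction {s : Fin n} {s' : Option (Fin n)} (h : some s ≠ s')
    {X : SuperSeries R (PathVar I J n)} (hX : τ.IsPosition gJ X) {i : I}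
    (h0 : pderiv (PathVar.x s' i) X = 0) :
    pderiv (PathVar.x s' i) (τ.vertexAction gJ A B e ħ θ s X) = 0 := by
  simp only [vertexAction, pderiv_smul, pderiv_sum, pderiv_add]
  rw [Finset.sum_eq_zero, Finset.sum_eq_zero, add_zero, smul_zero]
  · refine fun j _ => Finset.sum_eq_zero fun a _ => ?_
    rw [pderiv_leg_eq_zero (hX.leg _ _) (pderiv_leg_eq_zero hX h0 _ _), smul_zero]
  · exact fun j _ => pderiv_mul_eq_zero (pderiv_x_rename_ne h i _) (pderiv_leg_eq_zero hX h0 _ _)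

/-- One factor ħ of the contractions is absorbed by e with eħ = -1; the term quadratic in momenta
keeps its second ħ. -/
theorem diag_vertexAction (he : e * ħ = -1) {s : Fin n} {X : SuperSeries R (PathVar I J n)}
    (hX : τ.IsPosition gJ X) (hs : DependsBefore θ (some s) X) :
    diag (τ.vertexAction gJ A B e ħ θ s X) = -τ.symbolOp A B ħ (diag X) := by
  have h2 : ∀ j, DependsBefore θ (some s) (leg ħ θ (some s) j X) := fun j s' =>
    (hs s').imp_right fun h i => pderiv_leg_eq_zero hX (h i) _ _
  simp only [vertexAction, map_smul, map_add, map_sum, diag_mul, diag_rename, hs.diag_leg,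
    (h2 _).diag_leg, pderiv_smul, SuperSeries.mul_smul]
  have h3 : ∀ (c : R) (f : SuperSeries R I), c • ħ • ħ • f = ħ • ħ • c • f := fun c f => by
    rw [smul_comm c, smul_comm c]
  simp only [h3, ← Finset.smul_sum, ← smul_add]
  rw [smul_smul, he, symbolOp, neg_smul, one_smul]

/-- The momenta of the vertex cannot contract with G, which does not depend on earlier positions,
nor with their own vertex, since θ(0) = 0. They all act on X. -/
theorem wickSum_mul_vertexTerm (hA : ∀ j, Homog τ.gh (τ.gh j) (A j))
    (hA' : ∀ j, GradedSymm τ.gh (A j)) {s : Fin n} (hs : θ (some s) (some s) = 0)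
    {G X : SuperSeries R (PathVar I J n)} (hG : IndepBefore θ (some s) G)
    (hG0 : Homog (τ.ghPath gJ) 0 G) (hGs : GradedSymm (τ.ghPath gJ) G) (hGb : G ∈ Bdd I J R n)
    (hX : τ.IsPosition gJ X) :
    wickSum ħ θ (mul (τ.ghPath gJ) G (mul (τ.ghPath gJ) (τ.vertexTerm gJ A B e s) X)) =
      wickSum ħ θ (mul (τ.ghPath gJ) G (τ.vertexAction gJ A B e ħ θ s X)) := by
  have hi : ∀ f : SuperSeries R I, IndepBefore θ (some s)
      (rename (PathVar.x (some s)) f : SuperSeries R (PathVar I J n)) := fun f s' j h =>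
    pderiv_x_rename_ne (fun h' => h (by rw [← h', hs])) j f
  have h1 : ∀ j, wickSum ħ θ (mul (τ.ghPath gJ) G (mul (τ.ghPath gJ)
      (mul (τ.ghPath gJ) (rename (PathVar.x (some s)) (lift R (A j)))
        (coord (PathVar.p (some s) j))) X)) = wickSum ħ θ (mul (τ.ghPath gJ) G
      (mul (τ.ghPath gJ) (rename (PathVar.x (some s)) (lift R (A j))) (leg ħ θ (some s) j X))) := by
    intro j
    rw [SuperSeries.mul_assoc, ← SuperSeries.mul_assoc G, τ.wick_mul_coord_p_mul (IndepBefore.mul τ hG (hi _))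
      (hG0.mul (τ.homog_rename_x (hA j).lift _))
      (hGs.mul (τ.gradedSymm_rename_x (hA' j).lift _)) hX.symm (τ.bdd_mul hGb (bdd_rename _ _)) hX.bdd,
      SuperSeries.mul_assoc]
  -- Contracting p_i first and p_j second reverses the order of the two derivatives; the sign from
  -- passing p_j and the sign from reordering cancel.
  have h2 : ∀ i j, wickSum ħ θ (mul (τ.ghPath gJ) G (mul (τ.ghPath gJ)
      (mul (τ.ghPath gJ) (coord (PathVar.p (some s) i)) (coord (PathVar.p (some s) j))) X)) =
      wickSum ħ θ (mul (τ.ghPath gJ) G (leg ħ θ (some s) i (leg ħ θ (some s) j X))) := by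
    intro i j
    have hl := hX.leg (ħ := ħ) (θ := θ) (some s) i
    rw [SuperSeries.mul_assoc, τ.wick_mul_coord_p_mul hG hG0 hGs ((gradedSymm_coord _).mul hX.symm) hGb
      (τ.bdd_mul (bdd_coord _) hX.bdd), leg_coord_p_mul, SuperSeries.mul_smul,
      wick_units_smul (τ.bdd_mul hGb (τ.bdd_mul (bdd_coord _) hl.bdd)),
      τ.wick_mul_coord_p_mul hG hG0 hGs hl.symm hGb hl.bdd, τ.leg_leg_comm hX.symm,
      SuperSeries.mul_smul, wick_units_smul (τ.bdd_mul hGb ((hX.leg _ j).leg _ i).bdd),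
      negOnePow_cancel ⟨_, rfl⟩]
  have b1 : ∀ j, mul (τ.ghPath gJ) G (mul (τ.ghPath gJ)
      (mul (τ.ghPath gJ) (rename (PathVar.x (some s)) (lift R (A j)))
        (coord (PathVar.p (some s) j))) X) ∈ Bdd I J R n := fun j =>
    τ.bdd_mul hGb (τ.bdd_mul (τ.bdd_mul (bdd_rename _ _) (bdd_coord _)) hX.bdd)
  have b2 : ∀ i j, mul (τ.ghPath gJ) G (mul (τ.ghPath gJ)
      (mul (τ.ghPath gJ) (coord (PathVar.p (some s) i)) (coord (PathVar.p (some s) j))) X) ∈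
      Bdd I J R n := fun i j =>
    τ.bdd_mul hGb (τ.bdd_mul (τ.bdd_mul (bdd_coord _) (bdd_coord _)) hX.bdd)
  have b3 : ∀ j, mul (τ.ghPath gJ) G (mul (τ.ghPath gJ) (rename (PathVar.x (some s)) (lift R (A j)))
      (leg ħ θ (some s) j X)) ∈ Bdd I J R n := fun j =>
    τ.bdd_mul hGb (τ.bdd_mul (bdd_rename _ _) (hX.leg _ j).bdd)
  have b4 : ∀ i j, mul (τ.ghPath gJ) G (leg ħ θ (some s) i (leg ħ θ (some s) j X)) ∈ Bdd I J R n :=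
    fun i j => τ.bdd_mul hGb ((hX.leg _ j).leg _ i).bdd
  simp only [vertexTerm, vertexAction, smul_mul, SuperSeries.mul_smul, SuperSeries.add_mul, sum_mul,
    SuperSeries.mul_add, mul_sum]
  have c2 := fun i j => Submodule.smul_mem _ (algebraMap ℂ R (B i j)) (b2 i j)
  have c4 := fun i j => Submodule.smul_mem _ (algebraMap ℂ R (B i j)) (b4 i j)
  have d1 := Submodule.sum_mem _ (t := Finset.univ) fun j _ => b1 j
  have d3 := Submodule.sum_mem _ (t := Finset.univ) fun j _ => b3 j
  have d2 := fun i => Submodule.sum_mem _ (t := Finset.univ) fun j _ => c2 i j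
  have d4 := fun i => Submodule.sum_mem _ (t := Finset.univ) fun j _ => c4 i j
  have e2 := Submodule.sum_mem _ (t := Finset.univ) fun i _ => d2 i
  have e4 := Submodule.sum_mem _ (t := Finset.univ) fun i _ => d4 i
  rw [wick_smul (Submodule.add_mem _ d1 e2), wick_smul (Submodule.add_mem _ d3 e4), wick_add d1 e2,
    wick_add d3 e4, wick_sum _ b1, wick_sum _ b3, wick_sum _ d2, wick_sum _ d4]
  simp only [wick_sum _ (c2 _), wick_sum _ (c4 _), wick_smul (b2 _ _), wick_smul (b4 _ _), h1, h2]

theorem foldr_mul_induction {V : Type*} {g : V → ℤ} {P : SuperSeries R V → Prop} (h1 : P one)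
    (hm : ∀ f h, P f → P h → P (mul g f h)) (l : List (SuperSeries R V)) (hl : ∀ f ∈ l, P f) :
    P (l.foldr (mul g) one) := by
  induction l with
  | nil => exact h1
  | cons a l ih =>
    exact hm _ _ (hl a (by simp)) (ih fun f hf => hl f (by simp [hf]))

/-- The list runs from late to early times. The last, earliest vertex is contracted first with the
insertion; the result is again a function of positions before all remaining vertices, so the
induction peels vertices off the right end. -/
theorem wickSum_chain (hb : ∀ i a, b i a ≠ 0 → τ.gh i = gJ a)
    (hA : ∀ j, Homog τ.gh (τ.gh j) (A j)) (hA' : ∀ j, GradedSymm τ.gh (A j))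
    (hB : ∀ i j, B i j ≠ 0 → τ.gh i + τ.gh j = 0) (hu : u * ħ = 1) (he : e * ħ = -1)
    (hθ : ∀ s, θ none s = 1) (hθ' : ∀ s, θ (some s) (some s) = 0) (l : List (Fin n))
    (hl : l.Pairwise fun a b => θ (some a) (some b) = 1 ∧ θ (some b) (some a) = 0)
    {X : SuperSeries R (PathVar I J n)} (hX : τ.IsPosition gJ X)
    (hlX : ∀ s ∈ l, DependsBefore θ (some s) X) :
    wickSum ħ θ (mul (τ.ghPath gJ) (SuperSeries.exp (τ.ghPath gJ) (τ.boundaryTerm gJ b n u))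
      ((l.map (τ.vertexTerm gJ A B e)).foldr (mul (τ.ghPath gJ)) X)) =
      pullback b ((fun f => -τ.symbolOp A B ħ f)^[l.length] (diag X)) := by
  induction l using List.reverseRecOn generalizing X with
  | nil => exact τ.wickSum_exp_mul hb hu hθ hX
  | append_singleton l s ih =>
    rw [List.pairwise_append] at hl
    have hs : ∀ a ∈ l, θ (some a) (some s) = 1 ∧ θ (some s) (some a) = 0 := fun a ha =>
      hl.2.2 a ha s (by simp)
    have hX' := τ.isPosition_vertexAction (B := B) (e := e) (ħ := ħ) (θ := θ) hA' s hX
    rw [List.map_append, List.foldr_append, List.map_cons, List.map_nil, List.foldr_cons,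
      List.foldr_nil, foldr_mul, ← SuperSeries.mul_assoc, τ.wickSum_mul_vertexTerm hA hA' (hθ' s) _ _ _ _ hX,
      SuperSeries.mul_assoc, ← foldr_mul, ih hl.1 hX', τ.diag_vertexAction he hX (hlX s (by simp)),
      List.length_append, List.length_singleton, Function.iterate_succ_apply]
    -- The new insertion may also depend on the position at time s, which precedes every remaining
    -- time a.
    · intro a ha s'
      rcases hlX a (by simp [ha]) s' with h | h
      · exact Or.inl h
      · by_cases hss : some s = s'
        · subst hss; exact Or.inl (hs a ha).1
        · exact Or.inr fun i => τ.pderiv_x_vertexAction hss hX (h i)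
    · refine IndepBefore.mul τ (τ.indepBefore_exp hb _) fun s' j h => ?_
      refine foldr_mul_induction (P := fun F => pderiv (PathVar.x s' j) F = 0) (pderiv_one _)
        (fun _ _ => pderiv_mul_eq_zero) _ fun f hf => ?_
      obtain ⟨a, ha, rfl⟩ := List.mem_map.1 hf
      exact τ.pderiv_x_vertexTerm (fun h' => h (by rw [← h']; exact (hs a ha).2)) j
    · refine (τ.homog_boundaryTerm hb).exp.mul' ?_ (add_zero 0)
      refine foldr_mul_induction homog_one (fun _ _ h h' => h.mul' h' (add_zero 0)) _ fun f hf => ?_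
      obtain ⟨a, ha, rfl⟩ := List.mem_map.1 hf
      exact τ.homog_vertexTerm hA hB a
    · refine τ.gradedSymm_boundaryTerm.exp.mul ?_
      refine foldr_mul_induction gradedSymm_one (fun _ _ h h' => h.mul h') _ fun f hf => ?_
      obtain ⟨a, ha, rfl⟩ := List.mem_map.1 hf
      exact τ.gradedSymm_vertexTerm hA' a
    · refine τ.bdd_mul ⟨0, exp_mem_wtLE τ.boundaryTerm_mem_wtLE⟩ ?_
      refine foldr_mul_induction (P := (· ∈ Bdd I J R n)) ⟨0, one_mem_wtLE⟩
        (fun _ _ => τ.bdd_mul) _ fun f hf => ?_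
      obtain ⟨a, ha, rfl⟩ := List.mem_map.1 hf
      exact τ.bdd_vertexTerm a

end Chain

end BVTheory

namespace SuperSeries

variable {R V : Type*} [CommRing R] [Algebra ℂ R] [Fintype V] {g : V → ℤ}

theorem linDer_mul {A : V → V → ℂ} {a e : ℤ} (hA : ∀ j k, A j k ≠ 0 → g j = g k + a)
    {f : SuperSeries R V} (hf : Homog g e f) (h : SuperSeries R V) :
    linDer g A (mul g f h) =
      mul g (linDer g A f) h + (a * e).negOnePow • mul g f (linDer g A h) := by
  simp only [linDer, sum_mul, mul_sum, Finset.smul_sum, ← Finset.sum_add_distrib]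
  refine Finset.sum_congr rfl fun k _ => Finset.sum_congr rfl fun j _ => ?_
  by_cases h0 : A j k = 0
  · simp [h0]
  rw [pderiv_mul, hf.twist, mul_add, smul_add, smul_mul (A j k), mul_assoc, smul_mul, mul_smul,
    mul_left_comm_homog (homog_coord k) hf, smul_smul (Int.negOnePow _), ← Int.negOnePow_add,
    mul_smul, smul_comm (A j k) (Int.negOnePow _)]
  congr 2
  apply negOnePow_congr
  rw [hA j k h0]
  exact ⟨g k * e, by ring⟩

theorem linDer_rsmul (A : V → V → ℂ) (c : R) (f : SuperSeries R V) :
    linDer g A (c • f) = c • linDer g A f := by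
  simp only [linDer, pderiv_smul, mul_smul, Finset.smul_sum]
  exact Finset.sum_congr rfl fun k _ => Finset.sum_congr rfl fun j _ => smul_comm _ _ _

end SuperSeries

/-! ### Normal form of the classical Hamiltonian ℍ and of the operator H -/

namespace BVTheory

variable {I I' : Type*} [Fintype I] [DecidableEq I] [Fintype I'] [DecidableEq I']
variable (τ : BVTheory I I')

/-! The inverse of the symplectic form -/

/-- Deleting from ω⁻¹ all entries of the wrong degree leaves a right inverse of ω, so by uniqueness
nothing was deleted. -/
theorem w_deg (i j : I) (h : τ.w i j ≠ 0) : τ.gh i + τ.gh j = -1 := by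
  have h1 : τ.ω⁻¹ = Matrix.of fun j k => if τ.gh j + τ.gh k = -1 then τ.ω⁻¹ j k else 0 := by
    refine Matrix.inv_eq_right_inv (Matrix.ext fun i k => ?_)
    have h2 : (τ.ω * τ.ω⁻¹) i k = (1 : Matrix I I ℂ) i k := by
      rw [Matrix.mul_nonsing_inv _ τ.ω_nondeg]
    rw [Matrix.mul_apply] at h2 ⊢
    by_cases hik : τ.gh i = τ.gh k
    · rw [← h2]
      refine Finset.sum_congr rfl fun j _ => ?_
      by_cases h0 : τ.ω i j = 0
      · rw [h0, MulZeroClass.zero_mul, MulZeroClass.zero_mul]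
      · rw [Matrix.of_apply, if_pos (by have := τ.ω_deg i j h0; omega)]
    · rw [Matrix.one_apply_ne fun h => hik (by rw [h])]
      refine Finset.sum_eq_zero fun j _ => ?_
      by_cases h0 : τ.ω i j = 0
      · rw [h0, MulZeroClass.zero_mul]
      · rw [Matrix.of_apply, if_neg (by have := τ.ω_deg i j h0; omega), MulZeroClass.mul_zero]
  have h3 : τ.w i j = τ.ω⁻¹ j i := rfl
  rw [h3, h1, Matrix.of_apply] at h
  by_contra h4
  exact h (if_neg (by omega))

theorem w_skew (i j : I) : τ.w i j = -τ.w j i := by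
  have h1 : τ.ω.transpose = -τ.ω := Matrix.ext fun i j => τ.ω_skew j i
  have h2 : (τ.ω⁻¹).transpose = -τ.ω⁻¹ := by
    rw [Matrix.transpose_nonsing_inv, h1]
    exact Matrix.inv_eq_right_inv (by rw [neg_mul_neg, Matrix.mul_nonsing_inv _ τ.ω_nondeg])
  have := congrFun (congrFun h2 i) j
  exact this

/-- The symmetric matrix of the quadratic form `ω⁻¹(p, p)`. -/
def c (i j : I) : ℂ := (τ.gh i).negOnePow • τ.w i j

theorem c_deg (i j : I) (h : τ.c i j ≠ 0) : τ.gh i + τ.gh j = -1 :=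
  τ.w_deg i j fun h0 => h (by rw [c, h0, smul_zero])

theorem c_symm (i j : I) : τ.c i j = τ.c j i := by
  by_cases h : τ.w j i = 0
  · rw [c, c, w_skew, h, neg_zero, smul_zero, smul_zero]
  · have h1 := τ.w_deg j i h
    rw [c, c, w_skew, smul_neg, ← Units.neg_smul, ← Int.negOnePow_succ]
    congr 1
    exact negOnePow_congr ⟨τ.gh i + 1, by omega⟩

/-! The Hamiltonian vector field of the action -/

theorem homog_freeAction : Homog τ.gh 0 (freeAction τ.gh τ.ω τ.d) := by
  refine (Homog.sum fun i _ => Homog.sum fun j _ => Homog.sum fun k _ =>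
    Homog.smul_of_ne fun h => (homog_coord _).mul' (homog_coord _) ?_).smul _
  have h1 := τ.ω_deg _ _ (left_ne_zero_of_mul h)
  have h2 := τ.d_deg _ _ (right_ne_zero_of_mul h)
  omega

theorem gradedSymm_freeAction : GradedSymm τ.gh (freeAction τ.gh τ.ω τ.d) :=
  (GradedSymm.sum fun i _ => GradedSymm.sum fun j _ => GradedSymm.sum fun k _ =>
    ((gradedSymm_coord _).mul (gradedSymm_coord _)).smul _).smul _

theorem homog_S : Homog τ.gh 0 τ.S := τ.homog_freeAction.add τ.Sint_deg

theorem gradedSymm_S : GradedSymm τ.gh τ.S := τ.gradedSymm_freeAction.add τ.Sint_symm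

/-- The components of the Hamiltonian vector field of the action. -/
def q (j : I) : SuperSeries ℂ I := ∑ i, τ.w i j • rpderiv τ.gh i τ.S

theorem homog_q (j : I) : Homog τ.gh (1 + τ.gh j) (τ.q j) :=
  Homog.sum fun i _ => Homog.smul_of_ne fun h => τ.homog_S.rpderiv (by
    have := τ.w_deg i j h; omega)

theorem gradedSymm_q (j : I) : GradedSymm τ.gh (τ.q j) :=
  GradedSymm.sum fun i _ => (τ.gradedSymm_S.rpderiv i).smul _

/-- The matrix elements of `κ`. -/
abbrev κe (i j : I) : ℂ := τ.κ i j

theorem κe_deg : ∀ j k, τ.κe j k ≠ 0 → τ.gh j = τ.gh k + 1 := τ.κ_deg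

/-- The components of `κ`. -/
def ψ (m : I) : SuperSeries ℂ I := ∑ k, τ.κe m k • coord k

theorem homog_ψ (m : I) : Homog τ.gh (τ.gh m - 1) (τ.ψ m) :=
  Homog.sum fun k _ => Homog.smul_of_ne fun h => by
    have := τ.κe_deg m k h
    rw [show τ.gh m - 1 = τ.gh k by omega]
    exact homog_coord k

theorem gradedSymm_ψ (m : I) : GradedSymm τ.gh (τ.ψ m) :=
  GradedSymm.sum fun k _ => (gradedSymm_coord k).smul _

/-- The part of `ℍ` linear in the momenta. -/
def linPart (j : I) : SuperSeries ℂ I :=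
  ∑ m, (τ.κe j m • τ.q m + mul τ.gh (τ.ψ m) (pderiv m (τ.q j)))

/-- The part of `ℍ` quadratic in the momenta. -/
def quadPart (i j : I) : ℂ := ∑ m, τ.c i m * τ.κe j m

theorem homog_linPart (j : I) : Homog τ.gh (τ.gh j) (τ.linPart j) := by
  refine Homog.sum fun m _ => (Homog.smul_of_ne fun h => ?_).add ?_
  · have := τ.κe_deg j m h
    rw [show τ.gh j = 1 + τ.gh m by omega]
    exact τ.homog_q m
  · exact (τ.homog_ψ m).mul' ((τ.homog_q j).pderiv (e' := 1 + τ.gh j - τ.gh m) (by ring)) (by ring)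

theorem gradedSymm_linPart (j : I) : GradedSymm τ.gh (τ.linPart j) :=
  GradedSymm.sum fun m _ => ((τ.gradedSymm_q m).smul _).add
    ((τ.gradedSymm_ψ m).mul ((τ.gradedSymm_q j).pderiv m))

theorem quadPart_deg (i j : I) (h : τ.quadPart i j ≠ 0) : τ.gh i + τ.gh j = 0 := by
  obtain ⟨m, -, hm⟩ := Finset.exists_ne_zero_of_sum_ne_zero h
  have h1 := τ.c_deg _ _ (left_ne_zero_of_mul hm)
  have h2 := τ.κe_deg _ _ (right_ne_zero_of_mul hm)
  omega

/-! The classical Hamiltonian -/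

theorem homog_rename_inl {e : ℤ} {f : SuperSeries ℂ I} (hf : Homog τ.gh e f) :
    Homog τ.ghN e (rename Sum.inl f) := hf.rename (g := τ.ghN) Sum.inl_injective fun _ => rfl

theorem rename_inl_mul (f h : SuperSeries ℂ I) :
    rename Sum.inl (mul τ.gh f h) = mul τ.ghN (rename Sum.inl f) (rename Sum.inl h) :=
  rename_mul (g := τ.ghN) Sum.inl_injective (fun _ => rfl) f h

theorem pderiv_inr_rename_inl (m : I) (f : SuperSeries ℂ I) :
    pderiv (Sum.inr m : I ⊕ I) (rename Sum.inl f) = 0 :=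
  pderiv_rename_of_notMem _ fun _ => by simp

theorem Θ_eq : τ.Θ = (∑ j, mul τ.ghN (rename Sum.inl (τ.q j)) (coord (Sum.inr j))) +
    (1 / 2 : ℂ) • ∑ i, ∑ j, τ.c i j • mul τ.ghN (coord (Sum.inr i)) (coord (Sum.inr j)) := by
  have h : ∀ j, mul τ.ghN (rename Sum.inl (τ.q j)) (coord (Sum.inr j)) = ∑ i, τ.w i j •
      mul τ.ghN (rename Sum.inl (rpderiv τ.gh i τ.S)) (coord (Sum.inr j)) := by
    intro j
    simp only [q, rename_sum, rename_smul, sum_mul, smul_mul]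
  simp only [Θ, h, c, smul_assoc]
  rw [Finset.sum_comm]

theorem homog_Θ : Homog τ.ghN 1 τ.Θ := by
  rw [Θ_eq]
  refine (Homog.sum fun j _ => ?_).add ((Homog.sum fun i _ => Homog.sum fun j _ =>
    Homog.smul_of_ne fun h => ?_).smul _)
  · exact (τ.homog_rename_inl (τ.homog_q j)).mul' (homog_coord _) (by simp [ghN])
  · refine (homog_coord _).mul' (homog_coord _) ?_
    have := τ.c_deg i j h
    simp only [ghN, Sum.elim_inr]; omega

/-- Θ has degree 1, so the sign exponent |v|(1 - |v|) is a product of consecutive integers up to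
sign, hence even. -/
theorem rpderiv_Θ (v : I ⊕ I) : rpderiv τ.ghN v τ.Θ = pderiv v τ.Θ := by
  rw [rpderiv, (τ.homog_Θ.pderiv (e' := 1 - τ.ghN v) (by ring)).twist, Int.negOnePow_even,
    one_smul]
  have := Int.even_mul_succ_self (τ.ghN v - 1)
  rw [show τ.ghN v * (1 - τ.ghN v) = -((τ.ghN v - 1) * (τ.ghN v - 1 + 1)) by ring]
  exact this.neg

theorem pderiv_inr_Θ (m : I) : pderiv (Sum.inr m) τ.Θ = rename Sum.inl (τ.q m) +
    ∑ i, τ.c i m • coord (Sum.inr i) := by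
  have h1 : ∑ j, pderiv (Sum.inr m) (mul τ.ghN (rename Sum.inl (τ.q j)) (coord (Sum.inr j))) =
      rename Sum.inl (τ.q m) := by
    rw [Finset.sum_eq_single m]
    · rw [pderiv_mul, pderiv_inr_rename_inl, SuperSeries.zero_mul, zero_add, pderiv_coord_self,
        SuperSeries.mul_one, (τ.homog_rename_inl (τ.homog_q m)).twist, Int.negOnePow_even, one_smul]
      have := Int.even_mul_succ_self (τ.gh m)
      simp only [ghN, Sum.elim_inr]
      rw [neg_mul, add_comm]
      exact this.neg
    · intro j _ hj
      exact pderiv_mul_eq_zero (pderiv_inr_rename_inl m _) (pderiv_coord_ne (by simpa using hj.symm))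
    · simp
  have h2 : ∀ i j, τ.c i j • pderiv (Sum.inr m)
      (mul τ.ghN (coord (Sum.inr i)) (coord (Sum.inr j))) =
      (if i = m then τ.c m j • coord (Sum.inr j) else 0) +
        if j = m then τ.c i m • (coord (Sum.inr i) : SuperSeries ℂ (I ⊕ I)) else 0 := by
    intro i j
    rw [pderiv_mul, (homog_coord _).twist, smul_add]
    refine congrArg₂ (· + ·) ?_ ?_
    · split_ifs with h
      · rw [h, pderiv_coord_self, SuperSeries.one_mul]
      · rw [pderiv_coord_ne (by simpa using Ne.symm h), SuperSeries.zero_mul, smul_zero]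
    · split_ifs with h
      · rw [h, pderiv_coord_self, SuperSeries.mul_one]
        by_cases h0 : τ.c i m = 0
        · rw [h0, zero_smul, zero_smul]
        · rw [Int.negOnePow_even, one_smul]
          have h3 := τ.c_deg i m h0
          simp only [ghN, Sum.elim_inr]
          rw [show -τ.gh m * -τ.gh i = -(τ.gh m * (τ.gh m + 1)) by
            rw [show τ.gh i = -1 - τ.gh m by omega]; ring]
          exact (Int.even_mul_succ_self _).neg
      · rw [pderiv_coord_ne (by simpa using Ne.symm h), SuperSeries.mul_zero, smul_zero]
  rw [Θ_eq, pderiv_add, pderiv_sum, h1, pderiv_smul, pderiv_sum]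
  simp only [pderiv_sum, pderiv_smul, h2, Finset.sum_add_distrib]
  refine congrArg (_ + ·) ?_
  rw [Finset.sum_comm]
  simp only [Finset.sum_ite_eq', Finset.mem_univ, if_true, τ.c_symm m]
  rw [← two_smul ℂ, smul_smul]
  norm_num

theorem pderiv_inl_Θ (m : I) : pderiv (Sum.inl m) τ.Θ =
    ∑ j, mul τ.ghN (rename Sum.inl (pderiv m (τ.q j))) (coord (Sum.inr j)) := by
  have h1 : ∀ j, pderiv (Sum.inl m) (mul τ.ghN (rename Sum.inl (τ.q j)) (coord (Sum.inr j))) =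
      mul τ.ghN (rename Sum.inl (pderiv m (τ.q j))) (coord (Sum.inr j)) := by
    intro j
    rw [pderiv_mul, pderiv_rename Sum.inl_injective, pderiv_coord_ne (v := Sum.inr j) (by simp),
      SuperSeries.mul_zero, add_zero]
  have h2 : ∀ i j, pderiv (Sum.inl m) (mul τ.ghN (coord (Sum.inr i)) (coord (Sum.inr j))) =
      (0 : SuperSeries ℂ (I ⊕ I)) := fun i j =>
    pderiv_mul_eq_zero (pderiv_coord_ne (by simp)) (pderiv_coord_ne (by simp))
  rw [Θ_eq]
  simp only [pderiv_add, pderiv_smul, pderiv_sum, h1, h2, smul_zero, Finset.sum_const_zero,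
    add_zero]

theorem Ψ_eq : τ.Ψ = ∑ k, ∑ j, τ.κe j k • mul τ.ghN (coord (Sum.inl k)) (coord (Sum.inr j)) := rfl

theorem pderiv_inl_Ψ (m : I) : pderiv (Sum.inl m) τ.Ψ = ∑ j, τ.κe j m • coord (Sum.inr j) := by
  rw [Ψ_eq, pderiv_sum, Finset.sum_eq_single m]
  · rw [pderiv_sum]
    refine Finset.sum_congr rfl fun j _ => ?_
    rw [pderiv_smul, pderiv_mul, pderiv_coord_self, SuperSeries.one_mul,
      pderiv_coord_ne (v := Sum.inr j) (by simp), SuperSeries.mul_zero, add_zero]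
  · intro k _ hk
    rw [pderiv_sum]
    refine Finset.sum_eq_zero fun j _ => ?_
    rw [pderiv_smul, pderiv_mul_eq_zero (pderiv_coord_ne (by simpa using hk.symm))
      (pderiv_coord_ne (by simp)), smul_zero]
  · simp

theorem pderiv_inr_Ψ (m : I) : pderiv (Sum.inr m) τ.Ψ = rename Sum.inl (τ.ψ m) := by
  rw [Ψ_eq, pderiv_sum, ψ, rename_sum]
  refine Finset.sum_congr rfl fun k _ => ?_
  rw [pderiv_sum, Finset.sum_eq_single m]
  · rw [pderiv_smul, pderiv_mul, pderiv_coord_ne (by simp), SuperSeries.zero_mul, zero_add,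
      pderiv_coord_self, SuperSeries.mul_one, (homog_coord _).twist, rename_smul,
      rename_coord Sum.inl_injective]
    by_cases h0 : τ.κe m k = 0
    · rw [h0, zero_smul, zero_smul]
    · rw [Int.negOnePow_even, one_smul]
      simp only [ghN, Sum.elim_inr, Sum.elim_inl]
      rw [τ.κe_deg m k h0, neg_mul, _root_.mul_comm]
      exact (Int.even_mul_succ_self _).neg
  · intro j _ hj
    rw [pderiv_smul, pderiv_mul_eq_zero (pderiv_coord_ne (by simp))
      (pderiv_coord_ne (by simpa using hj.symm)), smul_zero]
  · simp

/-- All positions are collected to the left of the momenta. The minus sign in the bracket is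
consumed by moving ψ to the left of ∂Θ/∂x. -/
theorem Hcl_eq : τ.Hcl = ∑ j, mul τ.ghN (rename Sum.inl (τ.linPart j)) (coord (Sum.inr j)) +
    ∑ i, ∑ j, τ.quadPart i j • mul τ.ghN (coord (Sum.inr i)) (coord (Sum.inr j)) := by
  have h1 : ∀ m, (τ.gh m).negOnePow • mul τ.ghN (pderiv (Sum.inl m) τ.Θ)
      (rename Sum.inl (τ.ψ m)) = -∑ j, mul τ.ghN (rename Sum.inl
        (mul τ.gh (τ.ψ m) (pderiv m (τ.q j)))) (coord (Sum.inr j)) := by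
    intro m
    have h2 : Homog τ.ghN (1 - τ.gh m) (pderiv (Sum.inl m) τ.Θ) :=
      τ.homog_Θ.pderiv (by simp [ghN])
    rw [mul_comm_homog h2 (τ.homog_rename_inl (τ.homog_ψ m)), smul_smul, ← Int.negOnePow_add,
      pderiv_inl_Θ, mul_sum, Int.negOnePow_odd, Units.neg_smul,
      one_smul]
    · simp only [rename_inl_mul, SuperSeries.mul_assoc]
    · rw [show τ.gh m + (1 - τ.gh m) * (τ.gh m - 1) = -((τ.gh m - 1) * (τ.gh m - 1 - 1)) + 1 by ring]
      exact (Int.even_mul_pred_self _).neg.add_one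
  have h3 : ∀ m, mul τ.ghN (rename Sum.inl (τ.q m) + ∑ i, τ.c i m • coord (Sum.inr i))
      (∑ j, τ.κe j m • coord (Sum.inr j)) =
      ∑ j, mul τ.ghN (rename Sum.inl (τ.κe j m • τ.q m)) (coord (Sum.inr j)) +
      ∑ i, ∑ j, (τ.c i m * τ.κe j m) • mul τ.ghN (coord (Sum.inr i)) (coord (Sum.inr j)) := by
    intro m
    simp only [SuperSeries.add_mul, sum_mul, mul_sum, SuperSeries.mul_smul, smul_mul, rename_smul,
      smul_add, Finset.smul_sum, smul_smul, Finset.sum_add_distrib]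
    rw [Finset.sum_comm]
    simp only [_root_.mul_comm]
  simp only [Hcl, poisson, rpderiv_Θ, pderiv_inl_Ψ, pderiv_inr_Ψ, pderiv_inr_Θ, h1, h3,
    sub_neg_eq_add, Finset.sum_add_distrib]
  have h4 : ∀ j, mul τ.ghN (rename Sum.inl (τ.linPart j)) (coord (Sum.inr j)) =
      ∑ m, mul τ.ghN (rename Sum.inl (τ.κe j m • τ.q m)) (coord (Sum.inr j)) +
      ∑ m, mul τ.ghN (rename Sum.inl (mul τ.gh (τ.ψ m) (pderiv m (τ.q j)))) (coord (Sum.inr j)) := by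
    intro j
    simp only [linPart, rename_sum, rename_add, sum_mul, SuperSeries.add_mul,
      Finset.sum_add_distrib]
  have h5 : ∑ m, ∑ i, ∑ j, (τ.c i m * τ.κe j m) •
      mul τ.ghN (coord (Sum.inr i)) (coord (Sum.inr j) : SuperSeries ℂ (I ⊕ I)) =
      ∑ i, ∑ j, τ.quadPart i j • mul τ.ghN (coord (Sum.inr i)) (coord (Sum.inr j)) := by
    simp only [quadPart, Finset.sum_smul]
    rw [Finset.sum_comm]
    exact Finset.sum_congr rfl fun i _ => Finset.sum_comm
  simp only [h4, h5, Finset.sum_add_distrib]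
  rw [Finset.sum_comm (γ := I) (f := fun j m => mul τ.ghN (rename Sum.inl (τ.κe j m • τ.q m))
    (coord (Sum.inr j))), Finset.sum_comm (γ := I) (f := fun j m => mul τ.ghN (rename Sum.inl
    (mul τ.gh (τ.ψ m) (pderiv m (τ.q j)))) (coord (Sum.inr j)))]
  abel

/-! The quantum Hamiltonian -/

theorem linDer_κ_eq {R : Type*} [CommRing R] [Algebra ℂ R] (f : SuperSeries R I) :
    linDer τ.gh τ.κe f = ∑ m, mul τ.gh (lift R (τ.ψ m)) (pderiv m f) := by
  simp only [ψ, lift_sum, lift_smul, lift_coord, sum_mul, smul_mul]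
  rw [Finset.sum_comm]; rfl

theorem bracket_S {R : Type*} [CommRing R] [Algebra ℂ R] (f : SuperSeries R I) :
    bracket τ.gh τ.w (lift R τ.S) f = ∑ j, mul τ.gh (lift R (τ.q j)) (pderiv j f) := by
  simp only [q, lift_sum, lift_smul, sum_mul, smul_mul, lift_rpderiv]
  rw [Finset.sum_comm]; rfl

/-- The second order terms cancel: moving ∂_j past κ̂ and moving κ̂ past q_j give opposite signs.
What remains is the commutator of two vector fields. -/
theorem bracket_S_κ {R : Type*} [CommRing R] [Algebra ℂ R] {f : SuperSeries R I}
    (hf : GradedSymm τ.gh f) :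
    bracket τ.gh τ.w (lift R τ.S) (linDer τ.gh τ.κe f) +
      linDer τ.gh τ.κe (bracket τ.gh τ.w (lift R τ.S) f) =
    ∑ j, mul τ.gh (lift R (τ.linPart j)) (pderiv j f) := by
  have h1 : ∀ j, mul τ.gh (lift R (τ.q j)) (pderiv j (linDer τ.gh τ.κe f)) +
      linDer τ.gh τ.κe (mul τ.gh (lift R (τ.q j)) (pderiv j f)) =
      ∑ m, τ.κe m j • mul τ.gh (lift R (τ.q j)) (pderiv m f) +
        ∑ m, mul τ.gh (lift R (mul τ.gh (τ.ψ m) (pderiv m (τ.q j)))) (pderiv j f) := by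
    intro j
    rw [pderiv_linDer τ.κe_deg hf, linDer_mul τ.κe_deg (τ.homog_q j).lift, linDer_κ_eq τ (lift R _),
      SuperSeries.mul_add, SuperSeries.mul_smul]
    have h2 : (1 * (1 + τ.gh j)).negOnePow • mul τ.gh (lift R (τ.q j))
        (linDer τ.gh τ.κe (pderiv j f)) =
        -((τ.gh j * 1).negOnePow • mul τ.gh (lift R (τ.q j)) (linDer τ.gh τ.κe (pderiv j f))) := by
      rw [← Units.neg_smul, ← Int.negOnePow_succ]
      congr 2; ring
    rw [h2]
    simp only [mul_sum, sum_mul, SuperSeries.mul_smul, lift_mul, lift_pderiv]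
    abel
  rw [bracket_S, bracket_S]
  rw [linDer_sum, ← Finset.sum_add_distrib]
  simp only [h1, linPart, lift_sum, lift_add, lift_smul, sum_mul, SuperSeries.add_mul, smul_mul,
    Finset.sum_add_distrib]
  rw [Finset.sum_comm (γ := I) (f := fun j m => τ.κe m j • mul τ.gh (lift R (τ.q j)) (pderiv m f))]

theorem laplacian_eq {R : Type*} [CommRing R] [Algebra ℂ R] (f : SuperSeries R I) :
    laplacian τ.gh τ.w f = (1 / 2 : ℂ) • ∑ i, ∑ j, τ.c i j • pderiv i (pderiv j f) := by
  simp only [laplacian, c, smul_assoc]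

/-- Moving κ̂ past ∂_i∂_j gives a sign -1, as |i| + |j| is odd where the pairing is nonzero. Two
first order commutators remain; by symmetry of `c` they are equal and cancel the factor ½. -/
theorem laplacian_κ {R : Type*} [CommRing R] [Algebra ℂ R] {f : SuperSeries R I}
    (hf : GradedSymm τ.gh f) :
    laplacian τ.gh τ.w (linDer τ.gh τ.κe f) + linDer τ.gh τ.κe (laplacian τ.gh τ.w f) =
    ∑ i, ∑ j, τ.quadPart i j • pderiv i (pderiv j f) := by
  have h1 : ∀ i j, τ.c i j • pderiv i (pderiv j (linDer τ.gh τ.κe f)) +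
      τ.c i j • linDer τ.gh τ.κe (pderiv i (pderiv j f)) =
      ∑ m, (τ.c i j * τ.κe m j) • pderiv i (pderiv m f) +
        ∑ m, (τ.c j i * τ.κe m i) • pderiv j (pderiv m f) := by
    intro i j
    by_cases h0 : τ.c i j = 0
    · rw [← c_symm τ i j, h0]; simp
    have hd := τ.c_deg i j h0
    rw [pderiv_linDer τ.κe_deg hf, pderiv_add, pderiv_sum, pderiv_smul, pderiv_linDer τ.κe_deg
      (hf.pderiv j), smul_add (Int.negOnePow _), smul_smul (Int.negOnePow _), ← Int.negOnePow_add,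
      Int.negOnePow_odd (τ.gh j * 1 + τ.gh i * 1) ⟨-1, by omega⟩, Units.neg_smul, one_smul]
    -- Where the pairing and κ are both nonzero, |m| = -|j|, and the total sign is trivial.
    have h2 : (τ.gh j * 1).negOnePow • ∑ m, τ.κe m i • pderiv m (pderiv j f) =
        ∑ m, τ.κe m i • pderiv j (pderiv m f) := by
      rw [Finset.smul_sum]
      refine Finset.sum_congr rfl fun m _ => ?_
      by_cases h3 : τ.κe m i = 0
      · rw [h3, zero_smul, zero_smul, smul_zero]
      · have h4 := τ.κe_deg m i h3
        rw [hf.pderiv_comm m j, smul_comm (τ.κe m i), smul_smul, ← Int.negOnePow_add,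
          Int.negOnePow_even, one_smul]
        rw [show τ.gh m = -τ.gh j by omega,
          show τ.gh j * 1 + -τ.gh j * τ.gh j = -(τ.gh j * (τ.gh j - 1)) by ring]
        exact (Int.even_mul_pred_self _).neg
    rw [h2, ← c_symm τ i j]
    simp only [pderiv_smul, smul_add, smul_neg, Finset.smul_sum, smul_smul]
    abel
  have h5 : ∑ i, ∑ j, ∑ m, (τ.c i j * τ.κe m j) • pderiv i (pderiv m f) =
      ∑ i, ∑ j, τ.quadPart i j • pderiv i (pderiv j f) := by
    simp only [quadPart, Finset.sum_smul]
    exact Finset.sum_congr rfl fun i _ => Finset.sum_comm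
  rw [laplacian_eq, laplacian_eq, linDer_smul, ← smul_add]
  simp only [linDer_sum, linDer_smul, ← Finset.sum_add_distrib, h1]
  simp only [Finset.sum_add_distrib, h5]
  rw [Finset.sum_comm (γ := I) (f := fun i j => ∑ m, (τ.c j i * τ.κe m i) • pderiv j (pderiv m f)),
    h5, ← two_smul ℂ, smul_smul]
  norm_num

/-- The same coefficients appear here as in `Hcl_eq`: under p = -iħ∂ placed to the right, ℍ becomes
-iħH. The operator H is the normally ordered quantization of ℍ up to this factor. -/
theorem H_eq_symbolOp {f : τ.Fun} (hf : GradedSymm τ.gh f) :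
    τ.H f = τ.symbolOp τ.linPart τ.quadPart negIHbar f := by
  have h1 : ∀ f : τ.Fun, τ.Qħ f = bracket τ.gh τ.w (lift _ τ.S) f +
    negIHbar • laplacian τ.gh τ.w f := fun _ => rfl
  have h2 : ∀ f : τ.Fun, τ.κhat f = linDer τ.gh τ.κe f := fun _ => rfl
  rw [H, h1, h1, h2, h2, linDer_add, linDer_rsmul, symbolOp, ← τ.bracket_S_κ hf]
  simp only [← algebra_smul]
  rw [← τ.laplacian_κ hf, smul_add]
  abel

end BVTheory

/-! ### The path integral over Laurent series in ħ -/

namespace SuperSeries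

variable {R R' V W : Type*} [CommRing R] [Algebra ℂ R] [CommRing R'] [Algebra ℂ R'] [Fintype W]

theorem map_pullback (φ : R →ₐ[ℂ] R') (M : W → V → ℂ) (f : SuperSeries R W) :
    pullback M (fun L => φ (f L)) = fun L => φ (pullback M f L) := by
  funext L
  induction L generalizing f with
  | nil => rfl
  | cons v L ih =>
    rw [pullback_cons, pullback_cons, map_sum]
    refine Finset.sum_congr rfl fun w _ => ?_
    rw [map_smul, ← ih]; rfl

theorem lift_rename (φ : W → V) (f : SuperSeries ℂ W) :
    lift R (rename φ f) = rename φ (lift R f) :=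
  (map_pullback (Algebra.ofId ℂ R) _ f).symm

theorem rename_scalar_smul (φ : W → V) (c : R) (f : SuperSeries R W) :
    rename φ (c • f) = c • rename φ f := rename_smul φ c f

end SuperSeries

namespace BVTheory

variable {I I' J : Type*} [Fintype I] [DecidableEq I] [Fintype I'] [DecidableEq I'] [Fintype J]
variable (τ : BVTheory I I') {n : ℕ} {T : ℝ} {t : Fin n → ℝ} {gJ : J → ℤ} {b : Matrix I J ℂ}

/-! Laurent series -/

theorem algebraMap_laurent (z : ℂ) : algebraMap ℂ LaurentH z = HahnSeries.C z := by
  rw [HahnSeries.algebraMap_apply']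
  exact HahnSeries.ofPowerSeries_C z

theorem laurent_smul {V : Type*} (z : ℂ) (F : SuperSeries LaurentH V) :
    z • F = algebraMap ℂ LaurentH z • F := by
  funext L
  rw [Pi.smul_apply, Pi.smul_apply, algebraMap_laurent, smul_eq_mul, HahnSeries.C_mul_eq_smul]

/-- The inclusion of power series into Laurent series. -/
def toLaurent : PowerSeries ℂ →ₐ[ℂ] LaurentH where
  toRingHom := HahnSeries.ofPowerSeries ℤ ℂ
  commutes' z := by
    rw [algebraMap_laurent]
    exact HahnSeries.ofPowerSeries_C z

theorem toLaurent_negIHbar : toLaurent negIHbar = hbarPow 1 (-Complex.I) := by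
  change HahnSeries.ofPowerSeries ℤ ℂ negIHbar = _
  rw [negIHbar, _root_.map_mul, HahnSeries.ofPowerSeries_C, HahnSeries.ofPowerSeries_X]
  refine (HahnSeries.single_mul_single (a := (0 : ℤ))).trans ?_
  rw [zero_add, _root_.mul_one]; rfl

theorem coeff_toLaurent_of_neg (f : PowerSeries ℂ) {k : ℤ} (hk : k < 0) :
    (toLaurent f).coeff k = 0 := by
  change (HahnSeries.ofPowerSeries ℤ ℂ f).coeff k = 0
  rw [PowerSeries.coeff_coe, if_pos hk]

theorem coeff_toLaurent (f : PowerSeries ℂ) (k : ℕ) :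
    (toLaurent f).coeff k = PowerSeries.coeff k f :=
  HahnSeries.ofPowerSeries_apply_coeff f k

theorem hbarPow_mul (j k : ℤ) (a c : ℂ) : hbarPow j a * hbarPow k c = hbarPow (j + k) (a * c) :=
  HahnSeries.single_mul_single

theorem hbarPow_zero_one : hbarPow 0 1 = 1 := rfl

/-! The expectation value as an instance of the general one -/

/-- The step function of the propagator between `p` at `s` and `x` at `s'`. -/
def step (T : ℝ) (t : Fin n → ℝ) (s s' : Option (Fin n)) : LaurentH :=
  algebraMap ℂ LaurentH ((heaviside (Option.elim s T t - Option.elim s' 0 t) : ℝ) : ℂ)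

theorem step_eq_one {s s' : Option (Fin n)} (h : Option.elim s' 0 t < Option.elim s T t) :
    step T t s s' = 1 := by
  rw [step, heaviside, if_pos (by linarith)]; simp

theorem step_eq_zero {s s' : Option (Fin n)} (h : Option.elim s T t ≤ Option.elim s' 0 t) :
    step T t s s' = 0 := by
  rw [step, heaviside, if_neg (by linarith)]; simp

theorem contract_eq (F : SuperSeries LaurentH (PathVar I J n)) :
    τ.contract T t F = contractₗ (hbarPow 1 (-Complex.I)) (step T t) F := by
  rw [contract, contractₗ_apply, Finset.smul_sum]
  refine Finset.sum_congr rfl fun s _ => ?_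
  rw [Finset.sum_comm, Finset.smul_sum]
  simp only [leg_apply, laurent_smul]
  rfl

theorem wick_eq (F : SuperSeries LaurentH (PathVar I J n)) :
    τ.wick T t F = wickSum (hbarPow 1 (-Complex.I)) (step T t) F := by
  have h : τ.contract (J := J) T t = contractₗ (hbarPow 1 (-Complex.I)) (step T t) :=
    funext τ.contract_eq
  funext L
  simp only [wick, wickSum, h, algebraMap_laurent, HahnSeries.C_mul_eq_smul, Module.End.pow_apply]

theorem boundary_eq : τ.boundary gJ b n =
    τ.boundaryTerm gJ (fun i a => b i a) n (hbarPow (-1) Complex.I) := by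
  simp only [boundary, boundaryTerm, laurent_smul]

theorem vertex_eq (s : Fin n) : (τ.vertex s : SuperSeries LaurentH (PathVar I J n)) =
    τ.vertexTerm gJ τ.linPart τ.quadPart (hbarPow (-1) (-Complex.I)) s := by
  have hφ : Function.Injective (Sum.elim (PathVar.x (some s)) (PathVar.p (some s)) :
      I ⊕ I → PathVar I J n) := by
    rintro (a | a) (c | c) h <;> simp at h <;> rw [h]
  have hg : ∀ v : I ⊕ I, τ.ghPath gJ (Sum.elim (PathVar.x (some s)) (PathVar.p (some s)) v :
      PathVar I J n) = τ.ghN v := by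
    rintro (a | a) <;> rfl
  have h1 : ∀ f : SuperSeries ℂ I, rename (Sum.elim (PathVar.x (some s)) (PathVar.p (some s)) :
      I ⊕ I → PathVar I J n) (rename Sum.inl (lift LaurentH f)) =
      rename (PathVar.x (some s)) (lift LaurentH f) := fun f => by
    rw [rename_rename hφ Sum.inl_injective]; rfl
  rw [vertex, Hcl_eq]
  simp only [vertexTerm, lift_add, lift_sum, lift_smul, lift_mul, lift_coord, lift_rename]
  simp only [algebra_smul (R := LaurentH)]
  simp only [rename_add, rename_sum, rename_mul hφ hg, rename_scalar_smul, h1, rename_coord hφ,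
    Sum.elim_inr]

theorem symbolOp_toLaurent (f : τ.Fun) :
    τ.symbolOp τ.linPart τ.quadPart (hbarPow 1 (-Complex.I)) (fun L => toLaurent (f L)) =
      fun L => toLaurent (τ.symbolOp τ.linPart τ.quadPart negIHbar f L) := by
  have h1 : ∀ h : SuperSeries ℂ I, lift LaurentH h = fun L => toLaurent (lift (PowerSeries ℂ) h L) :=
    fun h => funext fun L => (toLaurent.commutes (h L)).symm
  funext L
  simp only [symbolOp, Pi.add_apply, Finset.sum_apply, Pi.smul_apply, smul_eq_mul, map_add, map_sum,
    _root_.map_mul, toLaurent_negIHbar, AlgHom.commutes]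
  refine congrArg₂ (· + ·) (Finset.sum_congr rfl fun j _ => ?_) rfl
  rw [h1]
  exact congrFun (map_mul (g := τ.gh) (toLaurent : PowerSeries ℂ →+* LaurentH)
    (lift (PowerSeries ℂ) (τ.linPart j)) (pderiv j f)) L

theorem symbolOp_iterate {f : τ.Fun} (hf : GradedSymm τ.gh f) (m : ℕ) :
    (fun f => -τ.symbolOp τ.linPart τ.quadPart (hbarPow 1 (-Complex.I)) f)^[m]
      (fun L => toLaurent (f L)) = fun L => toLaurent (((-1 : ℂ) ^ m • τ.H^[m] f) L) := by
  have hH : τ.H = τ.Hₗ := funext τ.H_eq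
  have hs : ∀ m, GradedSymm τ.gh (τ.H^[m] f) := by
    intro m
    induction m with
    | zero => exact hf
    | succ m ih =>
      rw [Function.iterate_succ_apply', H_eq]
      exact symm_H ih
  induction m with
  | zero => simp
  | succ m ih =>
    rw [Function.iterate_succ_apply', ih, symbolOp_toLaurent, Function.iterate_succ_apply',
      ← τ.H_eq_symbolOp ((hs m).smul _), hH, map_smul, pow_succ, mul_neg_one, neg_smul]
    funext L
    simp

/-! The integrand at generic times -/

/-- Pairwise different times in the interior of the interval. -/
def Generic (T : ℝ) (t : Fin n → ℝ) : Prop :=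
  Function.Injective t ∧ ∀ s, 0 < t s ∧ t s < T

/-- Vertices are even, so their product may be written in decreasing order of time, and the chain
lemma applies. The result does not depend on the times, and the Laurent series is the image of a
power series. -/
theorem integrand_of_generic (hb : ∀ i a, b i a ≠ 0 → τ.gh i = gJ a) (hT : 0 < T) {O : τ.Fun}
    (hO : GradedSymm τ.gh O) (ht : Generic T t) : τ.integrand gJ b T O n t =
      fun L => toLaurent (((-1 : ℂ) ^ n • pullback (fun i a => b i a) (τ.H^[n] O)) L) := by
  have hI : Complex.I * -Complex.I = 1 := by rw [mul_neg, Complex.I_mul_I, neg_neg]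
  have hI' : -Complex.I * -Complex.I = -1 := by rw [neg_mul_neg, Complex.I_mul_I]
  set l := (List.finRange n).insertionSort (fun a c => t c ≤ t a) with hl
  have : Std.Total (fun a c : Fin n => t c ≤ t a) := ⟨fun a c => le_total _ _⟩
  have : IsTrans (Fin n) (fun a c => t c ≤ t a) := ⟨fun a c d h h' => le_trans h' h⟩
  have hp : l.Perm (List.finRange n) := List.perm_insertionSort _ _
  have hl1 : l.Pairwise fun a c => t c ≤ t a := List.pairwise_insertionSort _ _
  have hl2 : l.Pairwise fun a c => a ≠ c := hp.nodup_iff.2 (List.nodup_finRange n)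
  have hlen : l.length = n := by rw [hp.length_eq, List.length_finRange]
  have hl3 : l.Pairwise fun a c =>
      step T t (some a) (some c) = 1 ∧ step T t (some c) (some a) = 0 := by
    refine hl1.imp₂ (fun a c h1 h2 => ?_) hl2
    have h3 : t c < t a := lt_of_le_of_ne h1 fun h => h2 (ht.1 h).symm
    exact ⟨step_eq_one h3, step_eq_zero h3.le⟩
  have hX : τ.IsPosition gJ (τ.inserted O : SuperSeries LaurentH (PathVar I J n)) :=
    IsPosition.rename (fun L₁ v w L₂ => by
      change toLaurent _ = _ • toLaurent _
      rw [hO, Units.smul_def, Units.smul_def, map_zsmul]) none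
  have hXs : ∀ s ∈ l, DependsBefore (step T t) (some s)
      (τ.inserted O : SuperSeries LaurentH (PathVar I J n)) := by
    rintro s - (_ | s')
    · exact Or.inl (step_eq_one (ht.2 s).1)
    · exact Or.inr fun i => pderiv_x_rename_ne (by simp) i _
  have hfold : (List.ofFn τ.vertex).foldr (mul (τ.ghPath gJ)) (τ.inserted O) =
      (l.map (τ.vertexTerm gJ τ.linPart τ.quadPart (hbarPow (-1) (-Complex.I)))).foldr
        (mul (τ.ghPath gJ)) (τ.inserted O) := by
    have h1 : (τ.vertex : Fin n → SuperSeries LaurentH (PathVar I J n)) =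
      τ.vertexTerm gJ τ.linPart τ.quadPart (hbarPow (-1) (-Complex.I)) := funext τ.vertex_eq
    rw [h1, List.ofFn_eq_map]
    refine (hp.symm.map _).foldr_eq' (fun f hf h hh z => ?_) _
    obtain ⟨s, -, rfl⟩ := List.mem_map.1 hf
    exact (mul_left_comm_even (τ.homog_vertexTerm τ.homog_linPart τ.quadPart_deg s) _ _).symm
  rw [integrand, wick_eq, boundary_eq, hfold,
    τ.wickSum_chain hb τ.homog_linPart τ.gradedSymm_linPart τ.quadPart_deg _ _ _ _ l hl3 hX hXs,
    inserted, diag_rename, hlen]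
  · have := τ.symbolOp_iterate hO n
    change pullback (fun i a => b i a) ((fun f => -τ.symbolOp τ.linPart τ.quadPart (hbarPow 1 (-Complex.I)) f)^[n]
      (fun L => toLaurent (O L))) = _
    rw [this, map_pullback, pullback_smul]
  · rw [hbarPow_mul, hI]; rfl
  · rw [hbarPow_mul, hI', ← hbarPow_zero_one]
    exact HahnSeries.single_neg 0 1
  · rintro (_ | s)
    -- The momentum at T against the position at 0: the only place where the length of the interval
    -- itself must be positive.
    · exact step_eq_one hT
    · exact step_eq_one (ht.2 s).2
  -- Normal ordering: θ(0) = 0 forbids contractions within a vertex.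
  · exact fun s => step_eq_zero le_rfl

open MeasureTheory in
-- Coinciding times and times at the end points lie on finitely many hyperplanes.
theorem ae_generic (T : ℝ) :
    ∀ᵐ t ∂(volume.restrict (Set.Icc (0 : Fin n → ℝ) (fun _ => T))), Generic T t := by
  have h1 : ∀ (c : ℝ) (s : Fin n), ∀ᵐ t : Fin n → ℝ, t s ≠ c := fun c s =>
    compl_mem_ae_iff.2 (Measure.pi_hyperplane (fun _ : Fin n => (volume : Measure ℝ)) s c)
  have h2 : ∀ s s' : Fin n, s ≠ s' → ∀ᵐ t : Fin n → ℝ, t s ≠ t s' := by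
    intro s s' hs
    have h3 := Measure.addHaar_submodule (volume : Measure (Fin n → ℝ))
      (LinearMap.ker (LinearMap.proj (R := ℝ) (φ := fun _ : Fin n => ℝ) s - LinearMap.proj s'))
      (fun h => by
        have h4 : Pi.single s (1 : ℝ) ∈ LinearMap.ker (LinearMap.proj (R := ℝ)
          (φ := fun _ : Fin n => ℝ) s - LinearMap.proj s') := h ▸ Submodule.mem_top
        simp [hs.symm] at h4)
    refine measure_mono_null (fun t ht => ?_) h3
    have h4 : t s = t s' := not_not.1 ht
    simp [h4]
  have h3 : ∀ᵐ t : Fin n → ℝ, ∀ s s' : Fin n, s ≠ s' → t s ≠ t s' :=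
    ae_all_iff.2 fun s => ae_all_iff.2 fun s' => by
      by_cases h : s = s'
      · simp [h]
      · filter_upwards [h2 s s' h] with t ht _ using ht
  have h4 := ae_restrict_of_ae (s := Set.Icc (0 : Fin n → ℝ) (fun _ => T)) h3
  have h5 := ae_restrict_of_ae (s := Set.Icc (0 : Fin n → ℝ) (fun _ => T))
    (ae_all_iff.2 fun s => h1 0 s)
  have h6 := ae_restrict_of_ae (s := Set.Icc (0 : Fin n → ℝ) (fun _ => T))
    (ae_all_iff.2 fun s => h1 T s)
  filter_upwards [h4, h5, h6, ae_restrict_mem measurableSet_Icc] with t h4 h5 h6 h7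
  exact ⟨fun s s' h => not_not.1 fun h' => h4 s s' h' h, fun s =>
    ⟨lt_of_le_of_ne (h7.1 s) (h5 s).symm, lt_of_le_of_ne (h7.2 s) (h6 s)⟩⟩

theorem hasSum_coeff_pullback {V W : Type*} [Fintype W] (M : W → V → ℂ)
    {u : ℕ → SuperSeries (PowerSeries ℂ) W} {s : SuperSeries (PowerSeries ℂ) W}
    (h : ∀ L k, HasSum (fun n => PowerSeries.coeff k (u n L)) (PowerSeries.coeff k (s L)))
    (L : List V) (k : ℕ) :
    HasSum (fun n => PowerSeries.coeff k (pullback M (u n) L))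
      (PowerSeries.coeff k (pullback M s L)) := by
  induction L generalizing u s with
  | nil => exact h [] k
  | cons v L ih =>
    simp only [pullback_cons, map_sum, PowerSeries.coeff_smul, smul_eq_mul]
    exact hasSum_sum fun w _ => (ih fun L k => h (w :: L) k).mul_left _

section PathIntegral

variable (hb : ∀ i a, b i a ≠ 0 → τ.gh i = gJ a) (hT : 0 < T) {O : τ.Fun}
  (hO : GradedSymm τ.gh O)

include hb hT hO

open MeasureTheory in
theorem integrand_ae (n : ℕ) (L : List J) (k : ℤ) :
    (fun t => (τ.integrand gJ b T O n t L).coeff k) =ᵐ[volume.restrict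
      (Set.Icc (0 : Fin n → ℝ) (fun _ => T))] fun _ => (toLaurent (((-1 : ℂ) ^ n •
        pullback (fun i a => b i a) (τ.H^[n] O)) L)).coeff k := by
  filter_upwards [ae_generic T] with t ht
  rw [τ.integrand_of_generic hb hT hO ht]

/-- The integrand is almost everywhere constant, so the integral is the volume Tⁿ of the cube times
(-H)ⁿO. -/
theorem pathIntegralTerm_eq (L : List J) (k : ℤ) (n : ℕ) :
    τ.pathIntegralTerm gJ b T O L k n =
      (toLaurent (pullback (fun i a => b i a) (τ.expTerm T O n) L)).coeff k := by
  have hv : (MeasureTheory.volume (Set.Icc (0 : Fin n → ℝ) fun _ => T)).toReal = T ^ n := by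
    refine (Real.volume_Icc_pi_toReal fun _ => hT.le).trans ?_
    simp
  rw [pathIntegralTerm, MeasureTheory.integral_congr_ae (τ.integrand_ae hb hT hO n L k),
    MeasureTheory.setIntegral_const, MeasureTheory.Measure.real, hv, expTerm, pullback_smul]
  have h : ∀ (z : ℂ) (f : PowerSeries ℂ), (toLaurent (z • f)).coeff k = z * (toLaurent f).coeff k := by
    intro z f
    rw [Algebra.smul_def, _root_.map_mul, AlgHom.commutes, algebraMap_laurent, HahnSeries.C_mul_eq_smul]; rfl
  rw [Pi.smul_apply, Pi.smul_apply, h, h]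
  rw [Complex.real_smul]
  push_cast
  rw [neg_pow (T : ℂ)]
  ring

theorem pathIntegral_converges : τ.PathIntegralConverges gJ b T O := by
  refine ⟨fun n L k => ?_, fun n L k hk => ?_, fun L k => ?_⟩
  · refine MeasureTheory.Integrable.congr ?_ (τ.integrand_ae hb hT hO n L k).symm
    exact MeasureTheory.integrableOn_const (isCompact_Icc.measure_lt_top.ne)
  · rw [τ.pathIntegralTerm_eq hb hT hO, coeff_toLaurent_of_neg _ hk]
  · have h1 : τ.pathIntegralTerm gJ b T O L k = fun n =>
        (toLaurent (pullback (fun i a => b i a) (τ.expTerm T O n) L)).coeff k :=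
      funext (τ.pathIntegralTerm_eq hb hT hO L k)
    rw [h1]
    rcases lt_or_ge k 0 with hk | hk
    · simp only [coeff_toLaurent_of_neg _ hk]
      exact summable_zero
    · lift k to ℕ using hk
      simp only [coeff_toLaurent]
      exact (hasSum_coeff_pullback _ (τ.coeff_expNegTH T O) L k).summable

theorem pathIntegral_eq :
    τ.pathIntegral gJ b T O = pullback (fun i a => b i a) (τ.expNegTH T O) := by
  funext L
  ext k
  rw [pathIntegral, PowerSeries.coeff_mk]
  simp only [τ.pathIntegralTerm_eq hb hT hO, coeff_toLaurent]
  exact (hasSum_coeff_pullback _ (τ.coeff_expNegTH T O) L k).tsum_eq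

end PathIntegral

end BVTheory

/-! ### Assembly of the theorem -/

namespace BVTheory

variable {I I' : Type*} [Fintype I] [DecidableEq I] [Fintype I'] [DecidableEq I']
variable (τ : BVTheory I I')

theorem one_deg (i a : I) (h : (1 : Matrix I I ℂ) i a ≠ 0) : τ.gh i = τ.gh a := by
  by_contra h0
  exact h (Matrix.one_apply_ne fun h1 => h0 (by rw [h1]))

theorem pathIntegral_one {T : ℝ} (hT : 0 < T) {O : τ.Fun} (hO : GradedSymm τ.gh O) :
    τ.pathIntegral τ.gh 1 T O = τ.expNegTH T O :=
  (τ.pathIntegral_eq τ.one_deg hT hO).trans (pullback_of_one (fun _ _ => Matrix.one_apply) _)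

end BVTheory

theorem theorem8p1 {I I' : Type*} [Fintype I] [DecidableEq I] [Fintype I'] [DecidableEq I']
    (τ : BVTheory I I') :
    -- the homological perturbation series defining `i_int`, `p_int`, `K_int` converge
    τ.HPLConverges ∧
    -- the path integral is `e^{-TH} O`
    (∀ O : τ.Fun, SuperSeries.GradedSymm τ.gh O → ∀ T : ℝ, 0 < T →
      τ.PathIntegralConverges τ.gh 1 T O ∧
      Summable (τ.expTerm T O) ∧
      τ.expNegTH T O = τ.pathIntegral τ.gh 1 T O) ∧
    -- `i_int(O')(x_out)`: observable `O'(π(x(0)))`, boundary condition `x(T) = x_out`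
    (∀ O' : τ.Fun', SuperSeries.GradedSymm τ.gh' O' →
      (∀ T : ℝ, 0 < T → τ.PathIntegralConverges τ.gh 1 T (SuperSeries.pullback τ.π O')) ∧
      Filter.Tendsto (fun T : ℝ => τ.pathIntegral τ.gh 1 T (SuperSeries.pullback τ.π O'))
        Filter.atTop (nhds (τ.iInt O'))) ∧
    -- `p_int(O)(x'_out)`: observable `O(x(0))`, boundary condition `x(T) = ι(x'_out)`
    (∀ O : τ.Fun, SuperSeries.GradedSymm τ.gh O →
      (∀ T : ℝ, 0 < T → τ.PathIntegralConverges τ.gh' τ.ι T O) ∧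
      Filter.Tendsto (fun T : ℝ => τ.pathIntegral τ.gh' τ.ι T O)
        Filter.atTop (nhds (τ.pInt O))) ∧
    -- `K_int(O)(x_out)`: `dT` component of the observable `O(x(0) + dT κ(x(0)))`, boundary
    -- condition `x(T) = x_out`, integrated over `T` from `0` to `∞`, coefficient by coefficient
    (∀ O : τ.Fun, SuperSeries.GradedSymm τ.gh O →
      (∀ T : ℝ, 0 < T → τ.PathIntegralConverges τ.gh 1 T (τ.dTComponent O)) ∧
      ∀ (L : List I) (k : ℕ),
        MeasureTheory.IntegrableOn
          (fun T : ℝ => PowerSeries.coeff k (τ.pathIntegral τ.gh 1 T (τ.dTComponent O) L))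
          (Set.Ioi 0) ∧
        ∫ T in Set.Ioi (0 : ℝ),
            PowerSeries.coeff k (τ.pathIntegral τ.gh 1 T (τ.dTComponent O) L) =
          PowerSeries.coeff k (τ.Kint O L)) := by
  refine ⟨τ.hplConverges, fun O hO T hT => ⟨τ.pathIntegral_converges τ.one_deg hT hO,
    τ.summable_expTerm T O, (τ.pathIntegral_one hT hO).symm⟩, fun O' hO' => ?_, fun O hO => ?_,
    fun O hO => ?_⟩
  · have hs : GradedSymm τ.gh (τ.iₗ O') := τ.symm_i hO'
    refine ⟨fun T hT => τ.pathIntegral_converges τ.one_deg hT hs, ?_⟩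
    refine (τ.tendsto_expNegTH_i hO').congr' ?_
    -- The path integral is identified with the flow for positive T only, which suffices for the
    -- limit.
    filter_upwards [Filter.eventually_gt_atTop 0] with T hT
    exact (τ.pathIntegral_one hT hs).symm
  · refine ⟨fun T hT => τ.pathIntegral_converges τ.ι_deg hT hO, ?_⟩
    refine (τ.tendsto_p_expNegTH hO).congr' ?_
    filter_upwards [Filter.eventually_gt_atTop 0] with T hT
    exact (τ.pathIntegral_eq τ.ι_deg hT hO).symm
  · have hs : GradedSymm τ.gh (τ.κₗ O) := BVTheory.symm_κ hO
    refine ⟨fun T hT => τ.pathIntegral_converges τ.one_deg hT hs, fun L k => ?_⟩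
    have h := τ.integral_expNegTH_κ hO L k
    have e : Set.EqOn (fun T => PowerSeries.coeff k (τ.expNegTH T (τ.κₗ O) L))
        (fun T => PowerSeries.coeff k (τ.pathIntegral τ.gh 1 T (τ.dTComponent O) L))
        (Set.Ioi 0) := fun T hT => by
      have := τ.pathIntegral_one hT hs
      change _ = PowerSeries.coeff k (τ.pathIntegral τ.gh 1 T (τ.κₗ O) L)
      rw [this]
    exact ⟨h.1.congr_fun e measurableSet_Ioi,
      (MeasureTheory.setIntegral_congr_fun measurableSet_Ioi e).symm.trans h.2⟩

end
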